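/- Let $\mathcal X$ be a projective, geometrically irreducible, nonsingular algebraic curve of genus $g$ defined over the finite field $\mathbb F_q$, let $u,m$ be coprime integers with $m>u\ge 1$, let $n\ge 2$, and let $\phi=(f_0:\dots:f_n):\mathcal X\to\mathbb P^n(\overline{\mathbb F}_q)$ be a nondegenerate morphism defined over $\mathbb F_q$; that is, $f_0,\dots,f_n\in\mathbb F_q(\mathcal X)$ are linearly independent over $\overline{\mathbb F}_q$. Points of $\mathcal X$ are points over $\overline{\mathbb F}_q$, $v_P$ is the normalized valuation at $P$, and $N_r$ is the number of $\mathbb F_{q^r}$-rational points of $\mathcal X$. Let $t\in\mathbb F_q(\mathcal X)$ be a separating variable and let $D_t^{(i)}$ be the $i$-th Hasse derivative with respect to $t$. Put $E=\sum_P e_P P$ with $e_P=-\min_i v_P(f_i)$, and let $d=\deg E$ be the degree of the linear series associated to $\phi$. For integers $\rho_0,\dots,\rho_{n-2}\ge 0$ let $\mathcal A_t^{\rho_0,\dots,\rho_{n-2}}$ be the determinant of the $(n+1)\times(n+1)$ matrix with rows $(f_j^{q^m})_j$, $(f_j^{q^u})_j$, $(D_t^{(\rho_0)}f_j)_j,\dots,(D_t^{(\rho_{n-2})}f_j)_j$,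 where $0\le j\le n$. The $(q^u,q^m)$-Frobenius order-sequence $(\kappa_0,\dots,\kappa_{n-2})$ is the lexicographically smallest sequence $0\le\kappa_0<\dots<\kappa_{n-2}$ with $\mathcal A_t^{\kappa_0,\dots,\kappa_{n-2}}\ne 0$, and the order-sequence $(\epsilon_0,\dots,\epsilon_n)$ is the lexicographically smallest sequence with $\det(D_t^{(\epsilon_i)}f_j)_{0\le i,j\le n}\neq 0$. Put $$T_{u,m}=\operatorname{div}(\mathcal A_t^{\kappa_0,\dots,\kappa_{n-2}})+(\kappa_0+\dots+\kappa_{n-2})\operatorname{div}(dt)+(q^m+q^u+n-1)E .$$ For $r\in\{1,u,m,m-u\}$ let $c_r=\min\{v_P(T_{u,m}) : P\in\mathcal X(\mathbb F_{q^r})\}$ (put $c_r=0$ if $\mathcal X(\mathbb F_{q^r})=\emptyset$). Then $$c_1N_1+c_u(N_u-N_1)+c_m(N_m-N_1)+c_{m-u}(N_{m-u}-N_1)\le(2g-2)\sum_{i=0}^{n-2}\kappa_i+(q^m+q^u+n-1)d .$$ In addition, $c_{m-u}\ge q^u$ if $\mathcal X(\mathbb F_{q^{m-u}})\ne\emptyset$,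 and $c_1\ge q^u+\epsilon_2(n-1)$ if $\mathcal X(\mathbb F_q)\neq\emptyset$. -/

import Mathlib

open scoped WithZero

noncomputable section

namespace FrobCurve

/-- `F` is an algebraic function field in one variable over `k`: a finitely generated field
extension of transcendence degree one. -/
structure IsFunctionField (k F : Type*) [Field k] [Field F] [Algebra k F] : Prop where
  fg : (⊤ : IntermediateField k F).FG
  trdeg : Algebra.trdeg k F = 1

/-- `t` is a separating variable of `F / k`: the extension `F / k(t)` is (algebraic and)
separable. -/
def IsSeparating (k : Type*) {F : Type*} [Field k] [Field F] [Algebra k F] (t : F) : Prop :=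
  Algebra.IsSeparable (IntermediateField.adjoin k {t}) F

/-- A lexicographically minimal element of a set of sequences (`0` if the set is empty). -/
def lexMin {s : ℕ} (S : Set (Fin s → ℕ)) : Fin s → ℕ :=
  open Classical in
  if h : S.Nonempty then
    ofLex ((wellFounded_lt (α := Lex (Fin s → ℕ))).min (ofLex ⁻¹' S)
      (h.elim fun a ha => ⟨toLex a, ha⟩))
  else 0

section Geometric

/-- Points of the nonsingular projective curve over the algebraically closed field `K` with
function field `L`: the normalized discrete valuations of `L` that are trivial on `K`. -/
structure Place (K L : Type*) [Field K] [Field L] [Algebra K L] where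
  /-- the valuation, in multiplicative notation -/
  v : Valuation L ℤᵐ⁰
  surj : Function.Surjective v
  triv : ∀ c : K, c ≠ 0 → v (algebraMap K L c) = 1

variable {K L : Type*} [Field K] [Field L] [Algebra K L]

/-- The order `v_P(f)` of a nonzero function at `P`, in additive notation. -/
def Place.ord (P : Place K L) (f : L) : ℤ := -WithZero.log (P.v f)

/-- The Riemann-Roch space of functions with `div f + D ≥ 0` (and `0`). -/
def riemannRochSpace (D : Place K L →₀ ℤ) : Submodule K L where
  carrier := {f | ∀ P : Place K L, P.v f ≤ WithZero.exp (D P)}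
  zero_mem' := fun P => by simp
  add_mem' := fun ha hb P => P.v.map_add_le (ha P) (hb P)
  smul_mem' := fun c f hf P => by
    rw [Algebra.smul_def, map_mul]
    by_cases hc : c = 0
    · simp [hc]
    · rw [P.triv c hc, one_mul]
      exact hf P

variable (K L) in
/-- The genus: the largest value of `deg D - ℓ(D) + 1` over all divisors `D`. -/
def genus : ℤ :=
  sSup {z : ℤ | ∃ D : Place K L →₀ ℤ,
    z = (D.sum fun _ a => a) - (Module.finrank K (riemannRochSpace D) : ℤ) + 1}

variable (K) in
/-- `D_t^{(r)} f`, the `r`-th Hasse derivative with respect to a separating variable `t`: the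
coefficient of `X ^ r` in `τ f`, where `τ : L → L⟦X⟧` is the unique homomorphism of `K`-algebras
that lifts the identity of `L` and maps `t` to `t + X`. -/
def hasseDeriv (t : L) (r : ℕ) (f : L) : L :=
  open Classical in
  if h : ∃ τ : L →ₐ[K] PowerSeries L,
      (∀ g, PowerSeries.constantCoeff (τ g) = g) ∧ τ t = PowerSeries.C t + PowerSeries.X
  then PowerSeries.coeff r (h.choose f)
  else 0

/-- The order of a differential at `P`: the order of `g` where `ω = g dπ` and `π` is a local
parameter at `P`. -/
def Place.ordDiff (P : Place K L) (ω : Ω[L⁄K]) : ℤ :=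
  P.ord (Classical.epsilon fun g : L =>
    ∃ π : L, P.ord π = 1 ∧ ω = g • KaehlerDifferential.D K L π)

variable {n : ℕ}

/-- `e_P = - min_i v_P(f_i)`, the coefficient at `P` of the divisor `E` attached to
`φ = (f_0 : ⋯ : f_n)`. Zero coordinates do not contribute. -/
def Place.baseCoeff (P : Place K L) (f : Fin (n + 1) → L) : ℤ :=
  WithZero.log (Finset.univ.sup' Finset.univ_nonempty fun i => P.v (f i))

variable (K) in
/-- The degree of the linear series attached to `φ = (f_0 : ⋯ : f_n)`, that is, `deg E`. -/
def seriesDegree (f : Fin (n + 1) → L) : ℤ := ∑ᶠ P : Place K L, P.baseCoeff f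

variable (K) in
/-- The order-sequence `(ε_0, …, ε_n)`: lexicographically minimal with
`det (D_t^{(ε_i)} f_j) ≠ 0`. -/
def orderSeq (t : L) (f : Fin (n + 1) → L) : Fin (n + 1) → ℕ :=
  lexMin {ε | (Matrix.of fun i j => hasseDeriv K t (ε i) (f j)).det ≠ 0}

variable (K) in
/-- The determinant with rows `f_j^b`, `f_j^a`, `D_t^{(ρ_0)} f_j`, …, `D_t^{(ρ_{n-2})} f_j`;
it is used for `a = q^u` and `b = q^m`. -/
def frobDet (t : L) (f : Fin (n + 1) → L) (a b : ℕ) (ρ : Fin (n - 1) → ℕ) : L :=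
  Matrix.det (Matrix.of fun i j : Fin (n + 1) =>
    if h0 : (i : ℕ) = 0 then f j ^ b
    else if h1 : (i : ℕ) = 1 then f j ^ a
    else hasseDeriv K t (ρ ⟨i - 2, by omega⟩) (f j))

variable (K) in
/-- The `(a, b)`-Frobenius order-sequence `(κ_0, …, κ_{n-2})`: the lexicographically minimal
strictly increasing sequence for which the determinant above is nonzero. -/
def frobOrderSeq (t : L) (f : Fin (n + 1) → L) (a b : ℕ) : Fin (n - 1) → ℕ :=
  lexMin {ρ | StrictMono ρ ∧ frobDet K t f a b ρ ≠ 0}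

/-- `v_P(T)`, the coefficient at `P` of the `(a, b)`-Frobenius divisor
`T = div(A) + (κ_0 + ⋯ + κ_{n-2}) div(dt) + (b + a + n - 1) E`, where `A` is the determinant
above for the `(a, b)`-Frobenius order-sequence `κ`. -/
def Place.frobCoeff (P : Place K L) (t : L) (f : Fin (n + 1) → L) (a b : ℕ) : ℤ :=
  P.ord (frobDet K t f a b (frobOrderSeq K t f a b))
    + (∑ i, (frobOrderSeq K t f a b i : ℤ)) * P.ordDiff (KaehlerDifferential.D K L t)
    + ((b : ℤ) + a + n - 1) * P.baseCoeff f

end Geometric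

/-- The set of `𝔽_Q`-rational points (`Q = q^r`) of the curve over `k = 𝔽_q` with function field
`F`, as a set of points of the curve over `K = 𝔽̄_q` with function field `L`: those `P` with
`f(P)^Q = f(P)` for every `f ∈ F` that is regular at `P`. -/
def rationalPoints (F K L : Type*) [Field F] [Field K] [Field L] [Algebra F L] [Algebra K L]
    (Q : ℕ) : Set (Place K L) :=
  {P | ∀ f : F, P.v (algebraMap F L f) ≤ 1 → P.v (algebraMap F L f ^ Q - algebraMap F L f) < 1}

end FrobCurve

end

set_option linter.unusedSectionVars false

noncomputable section

namespace FrobCurve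

section PlaceBasics

variable {K L : Type*} [Field K] [Field L] [Algebra K L]

/-- `P.ge n f` says that `f` vanishes to order at least `n` at `P` (or `f = 0`). -/
def Place.ge (P : Place K L) (n : ℤ) (f : L) : Prop := P.v f ≤ WithZero.exp (-n)

namespace Place

variable (P : Place K L)

theorem ext_v {P Q : Place K L} (h : P.v = Q.v) : P = Q := by
  cases P; cases Q; cases h; rfl

theorem v_ne_zero {f : L} (hf : f ≠ 0) : P.v f ≠ 0 := (Valuation.ne_zero_iff _).2 hf

theorem v_eq_exp {f : L} (hf : f ≠ 0) : P.v f = WithZero.exp (-P.ord f) := by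
  rw [ord, neg_neg, WithZero.exp_log (P.v_ne_zero hf)]

theorem ge_iff_le_ord {n : ℤ} {f : L} (hf : f ≠ 0) : P.ge n f ↔ n ≤ P.ord f := by
  rw [ge, P.v_eq_exp hf, WithZero.exp_le_exp]; omega

@[simp] theorem ge_zero (n : ℤ) : P.ge n 0 := by simp [ge]

theorem ge_ord (f : L) : P.ge (P.ord f) f := by
  by_cases hf : f = 0
  · subst hf; simp
  · exact (P.ge_iff_le_ord hf).2 le_rfl

variable {P}

theorem ge.mono {n m : ℤ} {f : L} (h : P.ge n f) (hm : m ≤ n) : P.ge m f :=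
  le_trans h (WithZero.exp_le_exp.2 (by omega))

theorem ge.le_ord {n : ℤ} {f : L} (h : P.ge n f) (hf : f ≠ 0) : n ≤ P.ord f :=
  (P.ge_iff_le_ord hf).1 h

theorem ge.add {n : ℤ} {f g : L} (hf : P.ge n f) (hg : P.ge n g) : P.ge n (f + g) :=
  P.v.map_add_le hf hg

theorem ge.neg {n : ℤ} {f : L} (hf : P.ge n f) : P.ge n (-f) := by
  rw [ge, Valuation.map_neg]; exact hf

theorem ge.sub {n : ℤ} {f g : L} (hf : P.ge n f) (hg : P.ge n g) : P.ge n (f - g) := by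
  rw [sub_eq_add_neg]; exact hf.add hg.neg

theorem ge.mul {n m : ℤ} {f g : L} (hf : P.ge n f) (hg : P.ge m g) : P.ge (n + m) (f * g) := by
  rw [ge, map_mul, neg_add, WithZero.exp_add]
  exact mul_le_mul' hf hg

theorem ge.sum {ι : Type*} {s : Finset ι} {n : ℤ} {f : ι → L} (h : ∀ i ∈ s, P.ge n (f i)) :
    P.ge n (∑ i ∈ s, f i) :=
  P.v.map_sum_le h

variable (P)

theorem ge_one_right : P.ge 0 (1 : L) := by simp [ge]

theorem ge_algebraMap (c : K) : P.ge 0 (algebraMap K L c) := by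
  by_cases hc : c = 0
  · simp [hc]
  · simp [ge, P.triv c hc]

variable {P}

theorem ge.pow {n : ℤ} {f : L} (hf : P.ge n f) (k : ℕ) : P.ge (k * n) (f ^ k) := by
  induction k with
  | zero => simpa using P.ge_one_right
  | succ k ih =>
    rw [pow_succ]
    convert ih.mul hf using 1
    push_cast; ring

theorem ge.prod {ι : Type*} {s : Finset ι} {n : ι → ℤ} {f : ι → L}
    (h : ∀ i ∈ s, P.ge (n i) (f i)) : P.ge (∑ i ∈ s, n i) (∏ i ∈ s, f i) := by
  classical
  induction s using Finset.induction_on with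
  | empty => simpa using P.ge_one_right
  | insert a s ha ih =>
    rw [Finset.sum_insert ha, Finset.prod_insert ha]
    exact (h a (Finset.mem_insert_self _ _)).mul
      (ih fun i hi => h i (Finset.mem_insert_of_mem hi))

theorem ge.smul {n : ℤ} {f : L} (hf : P.ge n f) (c : K) : P.ge n (c • f) := by
  rw [Algebra.smul_def, ← zero_add n]
  exact (P.ge_algebraMap c).mul hf

theorem ge.zero_mul {n : ℤ} {f g : L} (hf : P.ge 0 f) (hg : P.ge n g) : P.ge n (f * g) := by
  simpa using hf.mul hg

theorem ge.mul_zero {n : ℤ} {f g : L} (hf : P.ge n f) (hg : P.ge 0 g) : P.ge n (f * g) := by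
  simpa using hf.mul hg

variable (P)

theorem v_le_one_iff {f : L} : P.v f ≤ 1 ↔ P.ge 0 f := by simp [ge]

theorem v_lt_one_iff {f : L} : P.v f < 1 ↔ P.ge 1 f := by
  by_cases hf : f = 0
  · simp [hf]
  · rw [P.ge_iff_le_ord hf, P.v_eq_exp hf, ← WithZero.exp_zero, WithZero.exp_lt_exp]; omega

theorem ord_mul {f g : L} (hf : f ≠ 0) (hg : g ≠ 0) : P.ord (f * g) = P.ord f + P.ord g := by
  rw [ord, map_mul, WithZero.log_mul (P.v_ne_zero hf) (P.v_ne_zero hg), ord, ord]; ring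

@[simp] theorem ord_one : P.ord (1 : L) = 0 := by simp [ord]

@[simp] theorem ord_zero : P.ord (0 : L) = 0 := by simp [ord]

@[simp] theorem ord_inv (f : L) : P.ord f⁻¹ = -P.ord f := by
  simp [ord, map_inv₀, WithZero.log_inv]

@[simp] theorem ord_neg (f : L) : P.ord (-f) = P.ord f := by
  simp [ord, Valuation.map_neg]

@[simp] theorem ord_pow (f : L) (k : ℕ) : P.ord (f ^ k) = k * P.ord f := by
  simp [ord, WithZero.log_pow]

@[simp] theorem ord_zpow (f : L) (k : ℤ) : P.ord (f ^ k) = k * P.ord f := by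
  simp [ord, map_zpow₀, WithZero.log_zpow]

theorem ord_div {f g : L} (hf : f ≠ 0) (hg : g ≠ 0) : P.ord (f / g) = P.ord f - P.ord g := by
  rw [div_eq_mul_inv, P.ord_mul hf (inv_ne_zero hg), ord_inv]; ring

theorem ord_algebraMap (c : K) : P.ord (algebraMap K L c) = 0 := by
  by_cases hc : c = 0
  · simp [hc]
  · simp [ord, P.triv c hc]

theorem ord_prod {ι : Type*} (s : Finset ι) (f : ι → L) (h : ∀ i ∈ s, f i ≠ 0) :
    P.ord (∏ i ∈ s, f i) = ∑ i ∈ s, P.ord (f i) := by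
  classical
  induction s using Finset.induction_on with
  | empty => simp
  | insert a s ha ih =>
    rw [Finset.sum_insert ha, Finset.prod_insert ha, P.ord_mul (h a (by simp))
      (Finset.prod_ne_zero_iff.2 fun i hi => h i (by simp [hi])),
      ih fun i hi => h i (by simp [hi])]

theorem ord_eq_iff {f : L} {n : ℤ} (hf : f ≠ 0) : P.ord f = n ↔ P.ge n f ∧ ¬ P.ge (n + 1) f := by
  rw [P.ge_iff_le_ord hf, P.ge_iff_le_ord hf]; omega

theorem ne_zero_of_not_ge {f : L} {n : ℤ} (h : ¬ P.ge n f) : f ≠ 0 := by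
  rintro rfl; simp at h

theorem ne_zero_of_ord_ne {f : L} (h : P.ord f ≠ 0) : f ≠ 0 := by
  rintro rfl; simp at h

/-- The order of a sum is the order of its dominant term. -/
theorem ord_add_eq {f g : L} (hf : f ≠ 0) (hg : P.ge (P.ord f + 1) g) :
    f + g ≠ 0 ∧ P.ord (f + g) = P.ord f := by
  have h1 : ¬ P.ge (P.ord f + 1) (f + g) := fun h => by
    have := h.sub hg
    rw [add_sub_cancel_right, P.ge_iff_le_ord hf] at this
    omega
  have h0 := P.ne_zero_of_not_ge h1
  exact ⟨h0, (P.ord_eq_iff h0).2 ⟨(P.ge_ord f).add (hg.mono (by omega)), h1⟩⟩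

theorem exists_ord_eq_one : ∃ π : L, P.ord π = 1 := by
  obtain ⟨π, h⟩ := P.surj (WithZero.exp (-1))
  exact ⟨π, by simp [ord, h]⟩

/-- If the nonzero terms of a sum have distinct orders, then each of them has at least the order
of the sum. -/
theorem ge_of_ge_sum {ι : Type*} (s : Finset ι) (f : ι → L)
    (hd : ∀ i ∈ s, ∀ j ∈ s, f i ≠ 0 → f j ≠ 0 → P.ord (f i) = P.ord (f j) → i = j)
    {n : ℤ} (h : P.ge n (∑ i ∈ s, f i)) : ∀ i ∈ s, P.ge n (f i) := by
  classical
  by_contra hcon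
  push Not at hcon
  obtain ⟨i₀, hi₀, hn⟩ := hcon
  obtain ⟨i, hi, hmin⟩ := Finset.exists_min_image (s.filter fun i => f i ≠ 0) (fun i => P.ord (f i))
    ⟨i₀, by simp [hi₀, P.ne_zero_of_not_ge hn]⟩
  simp only [Finset.mem_filter] at hi hmin
  have hlt : P.ord (f i) < n := by
    have h0 := P.ne_zero_of_not_ge hn
    have := hmin i₀ ⟨hi₀, h0⟩
    rw [P.ge_iff_le_ord h0] at hn
    omega
  have hrest : P.ge (P.ord (f i) + 1) (∑ j ∈ s.erase i, f j) := by
    refine ge.sum fun j hj => ?_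
    by_cases hj0 : f j = 0
    · simp [hj0]
    · rw [P.ge_iff_le_ord hj0]
      have h1 := hmin j ⟨Finset.mem_of_mem_erase hj, hj0⟩
      have h2 : P.ord (f i) ≠ P.ord (f j) := fun he =>
        Finset.ne_of_mem_erase hj (hd i hi.1 j (Finset.mem_of_mem_erase hj) hi.2 hj0 he).symm
      omega
  have := P.ord_add_eq hi.2 hrest
  rw [Finset.add_sum_erase _ _ hi.1] at this
  have := h.le_ord this.1
  omega

variable {P}

/-- Two places are equal if the valuation ring of one contains that of the other. -/
theorem eq_of_ge_imp {P Q : Place K L} (h : ∀ f : L, P.ge 0 f → Q.ge 0 f) : P = Q := by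
  obtain ⟨π, hπ⟩ := P.exists_ord_eq_one
  have hπ0 : π ≠ 0 := P.ne_zero_of_ord_ne (by omega)
  have hzero : ∀ f : L, f ≠ 0 → P.ord f = 0 → Q.ord f = 0 := by
    intro f hf h0
    have h1 := (h f ((P.ge_iff_le_ord hf).2 h0.ge)).le_ord hf
    have h2 := (h f⁻¹ ((P.ge_iff_le_ord (inv_ne_zero hf)).2 (by simp [h0]))).le_ord
      (inv_ne_zero hf)
    simp at h2
    omega
  have hmul : ∀ f : L, f ≠ 0 → Q.ord f = P.ord f * Q.ord π := by
    intro f hf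
    have h1 : f * π ^ (-P.ord f) ≠ 0 := mul_ne_zero hf (zpow_ne_zero _ hπ0)
    have h2 := hzero _ h1 (by rw [P.ord_mul hf (zpow_ne_zero _ hπ0)]; simp [hπ])
    rw [Q.ord_mul hf (zpow_ne_zero _ hπ0), ord_zpow] at h2
    linarith
  have hπnn : 0 ≤ Q.ord π := (h π ((P.ge_iff_le_ord hπ0).2 (by omega))).le_ord hπ0
  obtain ⟨ϖ, hϖ⟩ := Q.exists_ord_eq_one
  have hϖ0 : ϖ ≠ 0 := Q.ne_zero_of_ord_ne (by omega)
  have h1 := hmul ϖ hϖ0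
  rw [hϖ] at h1
  have hone : Q.ord π = 1 := Int.eq_one_of_dvd_one hπnn ⟨P.ord ϖ, by linarith⟩
  refine ext_v (Valuation.ext fun f => ?_)
  by_cases hf : f = 0
  · simp [hf]
  · rw [P.v_eq_exp hf, Q.v_eq_exp hf, hmul f hf, hone, mul_one]

theorem exists_ge_not_ge {P Q : Place K L} (h : P ≠ Q) : ∃ f : L, P.ge 0 f ∧ ¬ Q.ge 0 f := by
  by_contra hcon
  push Not at hcon
  exact h (eq_of_ge_imp hcon)

/-- A function with a pole at `Q` and a zero at `P`. -/
theorem exists_zero_pole {P Q : Place K L} (h : P ≠ Q) :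
    ∃ f : L, f ≠ 0 ∧ 0 < P.ord f ∧ Q.ord f < 0 := by
  obtain ⟨f, hf, hf'⟩ := exists_ge_not_ge h
  obtain ⟨g, hg, hg'⟩ := exists_ge_not_ge h.symm
  have hf0 := Q.ne_zero_of_not_ge hf'
  have hg0 := P.ne_zero_of_not_ge hg'
  rw [ge_iff_le_ord _ hf0] at hf hf'
  rw [ge_iff_le_ord _ hg0] at hg hg'
  refine ⟨f / g, div_ne_zero hf0 hg0, ?_, ?_⟩ <;> rw [ord_div _ hf0 hg0] <;> omega

/-- For finitely many places different from `P`, there is a function with a zero at `P` and poles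
at all of them. -/
theorem exists_zero_poles (P : Place K L) (S : Finset (Place K L)) (hS : P ∉ S) :
    ∃ f : L, f ≠ 0 ∧ 0 < P.ord f ∧ ∀ Q ∈ S, Q.ord f < 0 := by
  classical
  induction S using Finset.induction_on with
  | empty =>
    obtain ⟨π, hπ⟩ := P.exists_ord_eq_one
    exact ⟨π, P.ne_zero_of_ord_ne (by omega), by omega, by simp⟩
  | insert R S hR ih =>
    simp only [Finset.mem_insert, not_or] at hS
    obtain ⟨f, hf0, hfP, hfS⟩ := ih hS.2
    obtain ⟨g, hg0, hgP, hgR⟩ := exists_zero_pole hS.1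
    by_cases hfR : 0 ≤ R.ord f
    · -- for large `k`, the function `f + g ^ k` works unless orders coincide; choose `k` suitably
      obtain ⟨k, hk1, hk⟩ : ∃ k : ℕ, 1 ≤ k ∧ ∀ Q ∈ S, Q.ord f ≠ k * Q.ord g := by
        refine ⟨1 + ∑ Q ∈ S, (Q.ord f).natAbs, by omega, fun Q hQ he => ?_⟩
        have h1 : (Q.ord f).natAbs ≤ ∑ Q ∈ S, (Q.ord f).natAbs :=
          Finset.single_le_sum (f := fun Q : Place K L => (Q.ord f).natAbs)
            (fun _ _ => Nat.zero_le _) hQ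
        have h2 : (Q.ord f).natAbs = (1 + ∑ Q ∈ S, (Q.ord f).natAbs) * (Q.ord g).natAbs := by
          rw [he, Int.natAbs_mul]; congr 1
        have h3 : (Q.ord g).natAbs ≠ 0 := fun h => by
          have := hfS Q hQ
          rw [h] at h2
          omega
        have h4 := Nat.le_mul_of_pos_right (1 + ∑ Q ∈ S, (Q.ord f).natAbs)
          (Nat.pos_of_ne_zero h3)
        omega
      have hgk : g ^ k ≠ 0 := pow_ne_zero _ hg0
      have hP : P.ge 1 (f + g ^ k) := by
        refine ge.add ((P.ge_iff_le_ord hf0).2 hfP) ((P.ge_iff_le_ord hgk).2 ?_)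
        rw [ord_pow]; nlinarith
      have hRr : f + g ^ k ≠ 0 ∧ R.ord (f + g ^ k) = R.ord (g ^ k) := by
        rw [add_comm]
        refine R.ord_add_eq hgk ((R.ge_iff_le_ord hf0).2 ?_)
        rw [ord_pow]; nlinarith
      refine ⟨f + g ^ k, hRr.1, ?_, fun Q hQ => ?_⟩
      · have := hP.le_ord hRr.1; omega
      · rcases Finset.mem_insert.1 hQ with rfl | hQ
        · rw [hRr.2, ord_pow]; nlinarith
        · rcases lt_or_gt_of_ne (hk Q hQ) with h | h
          · rw [(Q.ord_add_eq hf0 ((Q.ge_iff_le_ord hgk).2 (by rw [ord_pow]; omega))).2]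
            exact hfS Q hQ
          · rw [add_comm, (Q.ord_add_eq hgk ((Q.ge_iff_le_ord hf0).2 (by rw [ord_pow]; omega))).2,
              ord_pow]
            exact h.trans (hfS Q hQ)
    · refine ⟨f, hf0, hfP, fun Q hQ => ?_⟩
      rcases Finset.mem_insert.1 hQ with rfl | hQ
      · omega
      · exact hfS Q hQ

/-- Weak approximation: a function with a prescribed order at `P` that vanishes to high order at
finitely many other places. -/
theorem exists_ord_eq_ge (P : Place K L) (S : Finset (Place K L)) (hS : P ∉ S) (i : ℤ) (M : ℕ) :
    ∃ f : L, f ≠ 0 ∧ P.ord f = i ∧ ∀ Q ∈ S, Q.ge M f := by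
  obtain ⟨π, hπ⟩ := P.exists_ord_eq_one
  have hπ0 : π ≠ 0 := P.ne_zero_of_ord_ne (by omega)
  obtain ⟨f, hf0, hfP, hfS⟩ := exists_zero_poles P S hS
  have h1 : (1 : L) + f ≠ 0 ∧ P.ord (1 + f) = 0 := by
    have := P.ord_add_eq (one_ne_zero) (g := f) ((P.ge_iff_le_ord hf0).2 (by simp; omega))
    simpa using this
  obtain ⟨k, hk⟩ : ∃ k : ℕ, ∀ Q ∈ S, M + (Q.ord (π ^ i)).natAbs ≤ k :=
    ⟨∑ Q ∈ S, (M + (Q.ord (π ^ i)).natAbs), fun Q hQ =>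
      Finset.single_le_sum (f := fun Q : Place K L => M + (Q.ord (π ^ i)).natAbs)
        (fun _ _ => Nat.zero_le _) hQ⟩
  have hne : ((1 + f)⁻¹) ^ k ≠ 0 := pow_ne_zero _ (inv_ne_zero h1.1)
  have hz : π ^ i ≠ 0 := zpow_ne_zero _ hπ0
  refine ⟨((1 + f)⁻¹) ^ k * π ^ i, mul_ne_zero hne hz, ?_, fun Q hQ => ?_⟩
  · rw [ord_mul _ hne hz]; simp [h1.2, hπ]
  · rw [ge_iff_le_ord _ (mul_ne_zero hne hz), ord_mul _ hne hz, ord_pow, ord_inv]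
    have h2 : Q.ord (1 + f) = Q.ord f := by
      rw [add_comm]
      refine (Q.ord_add_eq hf0 ((Q.ge_iff_le_ord one_ne_zero).2 ?_)).2
      have := hfS Q hQ
      simp; omega
    have h3 := hfS Q hQ
    have h4 := hk Q hQ
    rw [h2]
    have : (k : ℤ) ≤ k * -Q.ord f := by nlinarith
    omega

end Place

end PlaceBasics

section FunctionField

variable {K L : Type*} [Field K] [Field L] [Algebra K L]

variable (K L) in
/-- There are nonconstant functions, and `L` is finite over `K(x)` for each such `x`. -/
class IsCurveField : Prop where
  finite : ∀ x : L, x ∉ Set.range (algebraMap K L) →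
    FiniteDimensional (IntermediateField.adjoin K {x}) L
  exists_notMem : ∃ x : L, x ∉ Set.range (algebraMap K L)

theorem transcendental_of_notMem_range [IsAlgClosed K] {x : L}
    (hx : x ∉ Set.range (algebraMap K L)) : Transcendental K x := by
  intro h
  have h_integral : IsIntegral K x := h.isIntegral
  exact hx (minpoly.mem_range_of_degree_eq_one K x
    (IsAlgClosed.degree_eq_one_of_irreducible K (minpoly.irreducible h_integral)))

theorem aeval_ne_zero_of_notMem_range [IsAlgClosed K] {x : L}
    (hx : x ∉ Set.range (algebraMap K L)) {p : Polynomial K} (hp : p ≠ 0) :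
    Polynomial.aeval x p ≠ 0 := fun h =>
  hp ((transcendental_iff.1 (transcendental_of_notMem_range hx)) p h)

open Polynomial in
theorem linearIndependent_adjoin_of_forall_polynomial {ι : Type*} [Finite ι] {x : L} (z : ι → L)
    (h : ∀ p : ι → K[X], ∑ᶠ i, aeval x (p i) * z i = 0 → ∀ i, aeval x (p i) = 0) :
    LinearIndependent (IntermediateField.adjoin K {x}) z := by
  classical
  cases nonempty_fintype ι
  rw [Fintype.linearIndependent_iff]
  intro g hg i
  have hmem : ∀ i, ∃ r s : K[X], (g i : L) = aeval x r / aeval x s := fun i =>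
    (IntermediateField.mem_adjoin_simple_iff K _).1 (g i).2
  choose r s hrs using hmem
  have hs : ∀ i, ∃ r s : K[X], aeval x s ≠ 0 ∧ (g i : L) = aeval x r / aeval x s := by
    intro i
    by_cases h0 : aeval x (s i) = 0
    · exact ⟨0, 1, by simp, by rw [hrs i, h0]; simp⟩
    · exact ⟨r i, s i, h0, hrs i⟩
  choose r s hs0 hrs using hs
  set p : ι → K[X] := fun i => r i * ∏ j ∈ Finset.univ.erase i, s j with hp
  have hpi : ∀ i, aeval x (p i) = (g i : L) * ∏ j, aeval x (s j) := by
    intro i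
    rw [hp, map_mul, map_prod, hrs i, ← Finset.mul_prod_erase _ _ (Finset.mem_univ i)]
    field_simp [hs0 i]
  have hprod : ∏ j, aeval x (s j) ≠ 0 := Finset.prod_ne_zero_iff.2 fun j _ => hs0 j
  have h1 := h p (by
    rw [finsum_eq_sum_of_fintype]
    calc ∑ i, aeval x (p i) * z i = (∏ j, aeval x (s j)) * ∑ i, (g i : L) * z i := by
          rw [Finset.mul_sum]
          exact Finset.sum_congr rfl fun i _ => by rw [hpi]; ring
      _ = 0 := by
          have : ∑ i, (g i : L) * z i = 0 := by simpa [IntermediateField.smul_def] using hg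
          rw [this, mul_zero]) i
  rw [hpi] at h1
  have := (mul_eq_zero.1 h1).resolve_right hprod
  exact_mod_cast this

open Polynomial in
/-- Elements that are independent modulo `x` are linearly independent over `K(x)`. -/
theorem linearIndependent_adjoin_of_mod {ι : Type*} [Fintype ι] {x : L} (hx0 : x ≠ 0)
    (O : Subalgebra K L) (hx : x ∈ O) (z : ι → L) (hz : ∀ i, z i ∈ O)
    (h : ∀ c : ι → K, ∀ b ∈ O, ∑ i, c i • z i = x * b → c = 0) :
    LinearIndependent (IntermediateField.adjoin K {x}) z := by
  have hdvd : ∀ n : ℕ, ∀ p : ι → K[X], ∑ i, aeval x (p i) * z i = 0 → ∀ i, X ^ n ∣ p i := by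
    intro n
    induction n with
    | zero => intro p _ i; simp
    | succ n ih =>
      intro p hp i
      have hdec : ∀ i, aeval x (p i) = x * aeval x (p i).divX + algebraMap K L ((p i).coeff 0) := by
        intro i
        conv_lhs => rw [← divX_mul_X_add (p i)]
        simp only [map_add, map_mul, aeval_X, aeval_C]
        ring
      have hc : (fun i => (p i).coeff 0) = 0 := by
        refine h _ (-∑ i, aeval x (p i).divX * z i) ?_ ?_
        · refine O.neg_mem (O.sum_mem fun i _ => O.mul_mem ?_ (hz i))
          exact Polynomial.aeval_mem_adjoin_singleton (R := K) x |> fun hh =>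
            Algebra.adjoin_le (Set.singleton_subset_iff.2 hx) hh
        · rw [mul_neg, eq_neg_iff_add_eq_zero, ← hp, Finset.mul_sum, ← Finset.sum_add_distrib]
          refine Finset.sum_congr rfl fun i _ => ?_
          rw [hdec i, Algebra.smul_def]; ring
      have hpX : ∀ i, p i = X * (p i).divX := by
        intro i
        have hci : (p i).coeff 0 = 0 := congrFun hc i
        conv_lhs => rw [← divX_mul_X_add (p i), hci]
        simp [mul_comm]
      have h2 := ih (fun i => (p i).divX) (by
        have : x * ∑ i, aeval x (p i).divX * z i = 0 := by
          rw [← hp, Finset.mul_sum]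
          refine Finset.sum_congr rfl fun i _ => ?_
          conv_rhs => rw [hpX i]
          simp; ring
        exact (mul_eq_zero.1 this).resolve_left hx0) i
      rw [hpX i, pow_succ, mul_comm]
      exact mul_dvd_mul_left X h2
  refine linearIndependent_adjoin_of_forall_polynomial z fun p hp i => ?_
  rw [finsum_eq_sum_of_fintype] at hp
  have : p i = 0 := by
    by_contra h0
    have h1 := hdvd ((p i).natDegree + 1) p hp i
    have := natDegree_le_of_dvd h1 h0
    simp at this
  simp [this]

theorem card_le_finrank_of_mod [IsCurveField K L] {ι : Type*} [Fintype ι] {x : L}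
    (hxK : x ∉ Set.range (algebraMap K L))
    (O : Subalgebra K L) (hx : x ∈ O) (z : ι → L) (hz : ∀ i, z i ∈ O)
    (h : ∀ c : ι → K, ∀ b ∈ O, ∑ i, c i • z i = x * b → c = 0) :
    Fintype.card ι ≤ Module.finrank (IntermediateField.adjoin K {x}) L := by
  have := IsCurveField.finite x hxK
  have hx0 : x ≠ 0 := fun h0 => hxK ⟨0, by simp [h0]⟩
  exact (linearIndependent_adjoin_of_mod hx0 O hx z hz h).fintype_card_le_finrank

namespace Place

variable (P : Place K L)

/-- The valuation ring of `P`. -/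
def integers : Subalgebra K L where
  carrier := {f | P.ge 0 f}
  mul_mem' := fun ha hb => by simpa using Place.ge.mul ha hb
  add_mem' := fun ha hb => Place.ge.add ha hb
  algebraMap_mem' := P.ge_algebraMap

theorem mem_integers {f : L} : f ∈ P.integers ↔ P.ge 0 f := Iff.rfl

theorem notMem_range_of_ord_ne {x : L} (h : P.ord x ≠ 0) : x ∉ Set.range (algebraMap K L) := by
  rintro ⟨c, rfl⟩
  exact h (P.ord_algebraMap c)

open Polynomial in
theorem exists_ge_one_sub_of_aeval [IsAlgClosed K] {y : L} :
    ∀ (n : ℕ) (p : K[X]), p.natDegree = n → p ≠ 0 → P.ge 1 (aeval y p) →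
      ∃ a : K, P.ge 1 (y - algebraMap K L a) := by
  intro n
  induction n with
  | zero =>
    intro p hp hp0 h
    rw [eq_C_of_natDegree_eq_zero hp] at h hp0
    have hc : p.coeff 0 ≠ 0 := by simpa using hp0
    rw [aeval_C] at h
    have := h.le_ord ((_root_.map_ne_zero _).2 hc)
    rw [P.ord_algebraMap] at this
    omega
  | succ n ih =>
    intro p hp hp0 h
    obtain ⟨a, ha⟩ := IsAlgClosed.exists_root p
      (by rw [degree_eq_natDegree hp0, hp]; exact_mod_cast Nat.succ_ne_zero n)
    obtain ⟨q, rfl⟩ := dvd_iff_isRoot.2 ha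
    have hq0 : q ≠ 0 := right_ne_zero_of_mul hp0
    by_cases h1 : P.ge 1 (y - algebraMap K L a)
    · exact ⟨a, h1⟩
    · refine ih q ?_ hq0 ?_
      · rw [natDegree_mul (X_sub_C_ne_zero a) hq0, natDegree_X_sub_C] at hp; omega
      · have hya := P.ne_zero_of_not_ge h1
        by_cases hqy : aeval y q = 0
        · simp [hqy]
        · rw [map_mul] at h
          simp only [map_sub, aeval_X, aeval_C] at h
          have h2 := h.le_ord (mul_ne_zero hya hqy)
          rw [P.ord_mul hya hqy] at h2
          rw [P.ge_iff_le_ord hya] at h1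
          rw [P.ge_iff_le_ord hqy]
          omega

/-- The residue field of a place is `K`. -/
theorem exists_ge_one_sub [IsAlgClosed K] [IsCurveField K L] {y : L} (hy : P.ge 0 y) :
    ∃ a : K, P.ge 1 (y - algebraMap K L a) := by
  classical
  obtain ⟨π, hπ⟩ := P.exists_ord_eq_one
  have hπ0 : π ≠ 0 := P.ne_zero_of_ord_ne (by omega)
  have hπK := P.notMem_range_of_ord_ne (x := π) (by omega)
  by_contra hcon
  set N := Module.finrank (IntermediateField.adjoin K {π}) L
  have hcard := card_le_finrank_of_mod (ι := Fin (N + 1)) hπK P.integers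
    ((P.ge_iff_le_ord hπ0).2 (by omega)) (fun i => y ^ (i : ℕ))
    (fun i => P.integers.pow_mem hy _) (fun c b hb hcb => by
      by_contra hc
      apply hcon
      refine P.exists_ge_one_sub_of_aeval _
        (∑ i : Fin (N + 1), Polynomial.C (c i) * Polynomial.X ^ (i : ℕ)) rfl ?_ ?_
      · intro h0
        apply hc
        funext i
        have := congrArg (fun q => Polynomial.coeff q (i : ℕ)) h0
        simpa [Polynomial.finsetSum_coeff, Polynomial.coeff_C_mul, Polynomial.coeff_X_pow,
          Fin.val_inj] using this
      · rw [map_sum]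
        simp only [map_mul, Polynomial.aeval_C, map_pow, Polynomial.aeval_X]
        simp only [Algebra.smul_def] at hcb
        rw [hcb]
        exact ge.mul_zero ((P.ge_iff_le_ord hπ0).2 hπ.ge) hb)
  simp [N] at hcard

/-- The value in `K` of a function that is regular at `P` (a junk value otherwise). -/
def eval (y : L) : K :=
  open Classical in
  if h : ∃ a : K, P.ge 1 (y - algebraMap K L a) then h.choose else 0

variable {P}

theorem eval_eq {y : L} {a : K} (h : P.ge 1 (y - algebraMap K L a)) : P.eval y = a := by
  classical
  have hex : ∃ a : K, P.ge 1 (y - algebraMap K L a) := ⟨a, h⟩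
  have h1 : P.ge 1 (y - algebraMap K L (P.eval y)) := by
    rw [eval, dif_pos hex]; exact hex.choose_spec
  have h2 := h.sub h1
  rw [sub_sub_sub_cancel_left, ← map_sub] at h2
  by_contra hne
  have := h2.le_ord ((map_ne_zero _).2 (sub_ne_zero.2 hne))
  rw [P.ord_algebraMap] at this
  omega

theorem eval_algebraMap (a : K) : P.eval (algebraMap K L a) = a := eval_eq (by simp)

section

variable [IsAlgClosed K] [IsCurveField K L]

theorem ge.sub_eval {y : L} (hy : P.ge 0 y) : P.ge 1 (y - algebraMap K L (P.eval y)) := by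
  obtain ⟨a, ha⟩ := P.exists_ge_one_sub hy
  rwa [eval_eq ha]

theorem eval_add {y z : L} (hy : P.ge 0 y) (hz : P.ge 0 z) :
    P.eval (y + z) = P.eval y + P.eval z := by
  refine eval_eq ?_
  convert hy.sub_eval.add hz.sub_eval using 1
  rw [map_add]; ring

theorem eval_mul {y z : L} (hy : P.ge 0 y) (hz : P.ge 0 z) :
    P.eval (y * z) = P.eval y * P.eval z := by
  refine eval_eq ?_
  convert (hy.sub_eval.mul_zero hz).add ((P.ge_algebraMap (P.eval y)).zero_mul hz.sub_eval)
    using 1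
  rw [map_mul]; ring

theorem eval_smul {y : L} (hy : P.ge 0 y) (a : K) : P.eval (a • y) = a * P.eval y := by
  rw [Algebra.smul_def, eval_mul (P.ge_algebraMap a) hy, eval_algebraMap]

theorem eval_pow {y : L} (hy : P.ge 0 y) (k : ℕ) : P.eval (y ^ k) = P.eval y ^ k := by
  induction k with
  | zero => rw [pow_zero, pow_zero, ← map_one (algebraMap K L), eval_algebraMap]
  | succ k ih => rw [pow_succ, pow_succ, eval_mul (P.integers.pow_mem hy k) hy, ih]

theorem eval_eq_zero_iff {y : L} (hy : P.ge 0 y) : P.eval y = 0 ↔ P.ge 1 y := by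
  constructor
  · intro h
    have := hy.sub_eval
    rwa [h, map_zero, sub_zero] at this
  · intro h
    exact eval_eq (by simpa using h)

end

end Place

variable [IsCurveField K L]

/-- A nonconstant function has at most `[L : K(x)]` zeros, counted with multiplicity. -/
theorem sum_ord_le_finrank {x : L} (hxK : x ∉ Set.range (algebraMap K L))
    (S : Finset (Place K L)) (hS : ∀ P ∈ S, 0 < P.ord x) :
    ∑ P ∈ S, P.ord x ≤ Module.finrank (IntermediateField.adjoin K {x}) L := by
  classical
  have hx0 : x ≠ 0 := fun h0 => hxK ⟨0, by simp [h0]⟩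
  have hz : ∀ P : S, ∀ i : ℕ, ∃ f : L, f ≠ 0 ∧ P.1.ord f = i ∧
      ∀ Q ∈ S.erase P.1, Q.ge (Q.ord x) f := by
    intro P i
    obtain ⟨f, hf0, hfP, hfQ⟩ := Place.exists_ord_eq_ge P.1 (S.erase P.1) (by simp) i
      (∑ Q ∈ S, (Q.ord x).natAbs)
    refine ⟨f, hf0, hfP, fun Q hQ => (hfQ Q hQ).mono ?_⟩
    have := Finset.single_le_sum (f := fun Q : Place K L => (Q.ord x).natAbs)
      (fun _ _ => Nat.zero_le _) (Finset.mem_of_mem_erase hQ)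
    omega
  choose z hz0 hzP hzQ using hz
  have hge : ∀ (P : S) (i : ℕ), ∀ Q ∈ S, Q.ge 0 (z P i) := by
    intro P i Q hQ
    by_cases h : Q = P.1
    · subst h; exact (Place.ge_ord _ _).mono (by rw [hzP]; omega)
    · exact (hzQ P i Q (Finset.mem_erase.2 ⟨h, hQ⟩)).mono (hS Q hQ).le
  let O : Subalgebra K L := ⨅ P : S, P.1.integers
  have hO : ∀ f, f ∈ O ↔ ∀ P ∈ S, P.ge 0 f := by
    intro f; simp [O, Algebra.mem_iInf, Place.mem_integers]
  have hcard := card_le_finrank_of_mod (ι := Σ P : S, Fin (P.1.ord x).toNat) hxK O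
    ((hO _).2 fun P hP => (P.ge_iff_le_ord hx0).2 (hS P hP).le) (fun a => z a.1 a.2)
    (fun a => (hO _).2 (hge _ _)) (fun c b hb hcb => by
      have hb' := (hO b).1 hb
      have key : ∀ P : S, ∀ i : Fin (P.1.ord x).toNat, c ⟨P, i⟩ = 0 := by
        intro P i
        have h1 : P.1.ge (P.1.ord x) (∑ i : Fin (P.1.ord x).toNat, c ⟨P, i⟩ • z P i) := by
          have h2 : P.1.ge (P.1.ord x) (x * b) := (Place.ge_ord _ _).mul_zero (hb' P.1 P.2)
          rw [← hcb, Fintype.sum_sigma, ← Finset.add_sum_erase _ _ (Finset.mem_univ P)] at h2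
          have h3 : P.1.ge (P.1.ord x) (∑ Q ∈ Finset.univ.erase P,
              ∑ i : Fin (Q.1.ord x).toNat, c ⟨Q, i⟩ • z Q i) := by
            refine Place.ge.sum fun Q hQ => Place.ge.sum fun i _ => Place.ge.smul ?_ _
            refine hzQ Q i P.1 (Finset.mem_erase.2 ⟨fun h => ?_, P.2⟩)
            exact Finset.ne_of_mem_erase hQ (Subtype.ext h.symm)
          simpa using h2.sub h3
        have h4 := P.1.ge_of_ge_sum Finset.univ (fun i : Fin (P.1.ord x).toNat =>
          c ⟨P, i⟩ • z P i) (by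
            intro i _ j _ hi hj hij
            have hci : c ⟨P, i⟩ ≠ 0 := fun h => hi (by simp [h])
            have hcj : c ⟨P, j⟩ ≠ 0 := fun h => hj (by simp [h])
            simp only [Algebra.smul_def] at hij
            rw [P.1.ord_mul ((map_ne_zero _).2 hci) (hz0 _ _),
              P.1.ord_mul ((map_ne_zero _).2 hcj) (hz0 _ _), P.1.ord_algebraMap,
              P.1.ord_algebraMap, hzP, hzP] at hij
            ext; omega) h1 i (Finset.mem_univ _)
        by_contra hci
        have h5 := h4.le_ord (by
          rw [Algebra.smul_def]; exact mul_ne_zero ((map_ne_zero _).2 hci) (hz0 _ _))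
        rw [Algebra.smul_def, P.1.ord_mul ((map_ne_zero _).2 hci) (hz0 _ _),
          P.1.ord_algebraMap, hzP] at h5
        have := i.2
        omega
      funext a
      exact key a.1 a.2)
  rw [Fintype.card_sigma] at hcard
  simp only [Fintype.card_fin] at hcard
  rw [Finset.sum_coe_sort S (fun P => (P.ord x).toNat)] at hcard
  calc ∑ P ∈ S, P.ord x = ∑ P ∈ S, ((P.ord x).toNat : ℤ) :=
        Finset.sum_congr rfl fun P hP => (Int.toNat_of_nonneg (hS P hP).le).symm
    _ ≤ _ := by exact_mod_cast hcard

theorem finite_zeros {x : L} (hx0 : x ≠ 0) : {P : Place K L | 0 < P.ord x}.Finite := by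
  by_cases hxK : x ∈ Set.range (algebraMap K L)
  · obtain ⟨c, rfl⟩ := hxK
    convert Set.finite_empty
    ext P
    simp [P.ord_algebraMap]
  · by_contra hinf
    obtain ⟨S, hS, hcard⟩ := Set.Infinite.exists_subset_card_eq hinf
      (Module.finrank (IntermediateField.adjoin K {x}) L + 1)
    have h1 := sum_ord_le_finrank hxK S fun P hP => hS hP
    have h2 : ∑ P ∈ S, (1 : ℤ) ≤ ∑ P ∈ S, P.ord x :=
      Finset.sum_le_sum fun P hP => by have := hS hP; simp at this; omega
    simp [hcard] at h2
    omega

theorem finite_ord_ne {x : L} : {P : Place K L | P.ord x ≠ 0}.Finite := by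
  by_cases hx0 : x = 0
  · simp [hx0]
  · refine ((finite_zeros hx0).union (finite_zeros (inv_ne_zero hx0))).subset fun P hP => ?_
    simp only [Set.mem_ofPred_eq, Set.mem_union, Place.ord_inv] at *
    omega

end FunctionField

section PlaceExistence

variable {K L : Type*} [Field K] [Field L] [Algebra K L]

/-- If the terms of a sum with nonzero coefficients have distinct valuations, then each of them is
bounded by the valuation of the sum. -/
theorem valuation_le_of_sum {Γ : Type*} [LinearOrderedCommGroupWithZero Γ] (v : Valuation L Γ)
    {ι : Type*} (s : Finset ι) (f : ι → L)
    (hd : ∀ i ∈ s, ∀ j ∈ s, f i ≠ 0 → f j ≠ 0 → v (f i) = v (f j) → i = j) :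
    ∀ i ∈ s, v (f i) ≤ v (∑ j ∈ s, f j) := by
  classical
  by_cases hall : ∀ i ∈ s, f i = 0
  · intro i hi
    rw [hall i hi, map_zero]
    exact zero_le
  push Not at hall
  obtain ⟨i₀, hi₀, h0⟩ := hall
  obtain ⟨i, hi, hmax⟩ := Finset.exists_max_image (s.filter fun i => f i ≠ 0) (fun i => v (f i))
    ⟨i₀, by simp [hi₀, h0]⟩
  simp only [Finset.mem_filter] at hi hmax
  have hrest : v (∑ j ∈ s.erase i, f j) < v (f i) := by
    refine v.map_sum_lt ((Valuation.ne_zero_iff _).2 hi.2) fun j hj => ?_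
    by_cases hj0 : f j = 0
    · rw [hj0, map_zero]
      exact zero_lt_iff.2 ((Valuation.ne_zero_iff _).2 hi.2)
    · exact lt_of_le_of_ne (hmax j ⟨Finset.mem_of_mem_erase hj, hj0⟩) fun he =>
        Finset.ne_of_mem_erase hj (hd j (Finset.mem_of_mem_erase hj) i hi.1 hj0 hi.2 he)
  have hsum : v (∑ j ∈ s, f j) = v (f i) := by
    rw [← Finset.add_sum_erase _ _ hi.1, v.map_add_eq_of_lt_left hrest]
  intro j hj
  rw [hsum]
  by_cases hj0 : f j = 0
  · rw [hj0, map_zero]; exact zero_le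
  · exact hmax j ⟨hj, hj0⟩

variable [IsCurveField K L]

/-- The number of values of a valuation ring strictly between a given one and `1` is bounded. -/
theorem card_le_finrank_of_valuation {Γ : Type*} [LinearOrderedCommGroupWithZero Γ]
    (v : Valuation L Γ) (hv : ∀ c : K, c ≠ 0 → v (algebraMap K L c) = 1) {x : L}
    (hxK : x ∉ Set.range (algebraMap K L)) (hx1 : v x ≤ 1) {m : ℕ} (z : Fin m → L)
    (hz1 : ∀ i, v (z i) ≤ 1) (hzx : ∀ i, v x < v (z i)) (hinj : Function.Injective (v ∘ z)) :
    m ≤ Module.finrank (IntermediateField.adjoin K {x}) L := by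
  let O : Subalgebra K L :=
    { carrier := {f | v f ≤ 1}
      mul_mem' := fun {a b} ha hb => by
        change v (a * b) ≤ 1
        rw [map_mul]; exact mul_le_one' ha hb
      add_mem' := fun ha hb => v.map_add_le ha hb
      algebraMap_mem' := fun c => by
        change v (algebraMap K L c) ≤ 1
        by_cases hc : c = 0
        · simp [hc]
        · rw [hv c hc] }
  have hvs : ∀ (c : K) (f : L), c ≠ 0 → v (c • f) = v f := fun c f hc => by
    rw [Algebra.smul_def, map_mul, hv c hc, one_mul]
  have := card_le_finrank_of_mod (ι := Fin m) hxK O hx1 z hz1 (fun c b hb hcb => by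
    funext i
    by_contra hci
    have hle := valuation_le_of_sum v Finset.univ (fun i => c i • z i) (by
      intro i _ j _ hi hj hij
      have hci : c i ≠ 0 := fun h => hi (by simp [h])
      have hcj : c j ≠ 0 := fun h => hj (by simp [h])
      simp only [hvs _ _ hci, hvs _ _ hcj] at hij
      exact hinj hij) i (Finset.mem_univ i)
    simp only [hvs _ _ hci] at hle
    rw [hcb, map_mul] at hle
    have hb1 : v b ≤ 1 := hb
    exact absurd (hle.trans (mul_le_of_le_one_right' hb1)) (not_le.2 (hzx i)))
  simpa using this

theorem exists_max_value {Γ : Type*} [LinearOrderedCommGroupWithZero Γ]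
    (v : Valuation L Γ) (hv : ∀ c : K, c ≠ 0 → v (algebraMap K L c) = 1) {x : L}
    (hxK : x ∉ Set.range (algebraMap K L)) (hx1 : v x < 1) :
    ∃ π : L, v π < 1 ∧ ∀ z : L, v z < 1 → v z ≤ v π := by
  by_contra hcon
  push Not at hcon
  have hstep : ∀ z : {z : L // v z < 1}, ∃ z' : {z : L // v z < 1}, v z.1 < v z'.1 := fun z => by
    obtain ⟨z', h1, h2⟩ := hcon z.1 z.2
    exact ⟨⟨z', h1⟩, h2⟩
  choose g hg using hstep
  let seq : ℕ → {z : L // v z < 1} := fun n => g^[n] ⟨x, hx1⟩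
  have hmono : StrictMono fun n => v (seq n).1 := strictMono_nat_of_lt_succ fun n => by
    simp only [seq, Function.iterate_succ_apply']
    exact hg _
  have := card_le_finrank_of_valuation v hv hxK hx1.le
    (m := Module.finrank (IntermediateField.adjoin K {x}) L + 1) (fun i => (seq (i + 1)).1)
    (fun i => (seq _).2.le) (fun i => hmono (Nat.succ_pos i))
    (fun i j hij => by
      have := hmono.injective hij
      ext; omega)
  omega

theorem exists_pow_value {Γ : Type*} [LinearOrderedCommGroupWithZero Γ]
    (v : Valuation L Γ) (hv : ∀ c : K, c ≠ 0 → v (algebraMap K L c) = 1) {π : L} (hπ0 : π ≠ 0)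
    (hπ1 : v π < 1) (hπ : ∀ z : L, v z < 1 → v z ≤ v π) {y : L} (hy0 : y ≠ 0) (hy1 : v y ≤ 1) :
    ∃ k : ℕ, v y = v π ^ k := by
  classical
  have hvπ : v π ≠ 0 := (Valuation.ne_zero_iff _).2 hπ0
  have hex : ∃ k : ℕ, v π ^ k ≤ v y := by
    by_contra hcon
    push Not at hcon
    have hy : v y < 1 := by simpa using hcon 0
    have hyK : y ∉ Set.range (algebraMap K L) := by
      rintro ⟨c, rfl⟩
      have hc : c ≠ 0 := fun h => hy0 (by simp [h])
      rw [hv c hc] at hy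
      exact lt_irrefl _ hy
    have hanti : StrictAnti fun n : ℕ => v π ^ n :=
      pow_right_strictAnti₀ (zero_lt_iff.2 hvπ) hπ1
    have := card_le_finrank_of_valuation v hv hyK hy1
      (m := Module.finrank (IntermediateField.adjoin K {y}) L + 1) (fun i => π ^ (i : ℕ))
      (fun i => by rw [map_pow]; exact pow_le_one₀ zero_le hπ1.le)
      (fun i => by rw [map_pow]; exact hcon _)
      (fun i j hij => by
        simp only [Function.comp, map_pow] at hij
        ext; exact hanti.injective hij)
    omega
  refine ⟨Nat.find hex, le_antisymm ?_ (Nat.find_spec hex)⟩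
  rcases hk : Nat.find hex with _ | k
  · simpa using hy1
  · have hlt : v y < v π ^ k := not_le.1 (Nat.find_min hex (by omega))
    have hpos : 0 < v π ^ k := zero_lt_iff.2 (pow_ne_zero _ hvπ)
    have h1 : v (y / π ^ k) < 1 := by
      rw [map_div₀, map_pow]; exact (div_lt_one₀ hpos).2 hlt
    have h2 := hπ _ h1
    rw [map_div₀, map_pow, div_le_iff₀ hpos] at h2
    rwa [pow_succ, mul_comm]

/-- A valuation of `L` that is trivial on `K` and not trivial is equivalent to a place. -/
theorem exists_place_of_valuation {Γ : Type*} [LinearOrderedCommGroupWithZero Γ]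
    (v : Valuation L Γ) (hv : ∀ c : K, c ≠ 0 → v (algebraMap K L c) = 1) {x : L} (hx0 : x ≠ 0)
    (hxK : x ∉ Set.range (algebraMap K L)) (hx1 : v x < 1) :
    ∃ P : Place K L, ∀ f : L, v f < 1 → P.ge 1 f := by
  classical
  obtain ⟨π, hπ1, hπ⟩ := exists_max_value v hv hxK hx1
  have hvπ : v π ≠ 0 := fun h => by
    have := hπ x hx1
    rw [h, le_zero_iff, Valuation.zero_iff] at this
    exact hx0 this
  have hπ0 : π ≠ 0 := (Valuation.ne_zero_iff _).1 hvπ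
  have hex : ∀ f : L, f ≠ 0 → ∃ k : ℤ, v f = v π ^ k := by
    intro f hf
    rcases le_total (v f) 1 with h | h
    · obtain ⟨k, hk⟩ := exists_pow_value v hv hπ0 hπ1 hπ hf h
      exact ⟨k, by rw [hk, zpow_natCast]⟩
    · obtain ⟨k, hk⟩ := exists_pow_value v hv hπ0 hπ1 hπ (inv_ne_zero hf)
        (by rw [map_inv₀]; exact inv_le_one_of_one_le₀ h)
      exact ⟨-k, by rw [zpow_neg, zpow_natCast, ← hk, map_inv₀, inv_inv]⟩
  have hpos : 0 < v π := zero_lt_iff.2 hvπ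
  have hanti : StrictAnti fun n : ℤ => v π ^ n := zpow_right_strictAnti₀ hpos hπ1
  choose k hk using hex
  have huniq : ∀ (f : L) (hf : f ≠ 0) (n : ℤ), v f = v π ^ n → k f hf = n := fun f hf n h =>
    hanti.injective ((hk f hf).symm.trans h)
  let w : Valuation L ℤᵐ⁰ :=
    { toFun := fun f => if hf : f = 0 then 0 else WithZero.exp (-k f hf)
      map_zero' := by simp
      map_one' := by simp [huniq 1 one_ne_zero 0 (by simp)]
      map_mul' := fun f g => by
        by_cases hf : f = 0
        · simp [hf]
        by_cases hg : g = 0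
        · simp [hg]
        rw [dif_neg (mul_ne_zero hf hg), dif_neg hf, dif_neg hg, ← WithZero.exp_add,
          huniq (f * g) (mul_ne_zero hf hg) (k f hf + k g hg)
            (by rw [map_mul, hk f hf, hk g hg, zpow_add₀ hvπ])]
        congr 1; ring
      map_add_le_max' := fun f g => by
        by_cases hf : f = 0
        · simp [hf]
        by_cases hg : g = 0
        · simp [hg]
        by_cases hfg : f + g = 0
        · simp [hfg]
        rw [dif_neg hf, dif_neg hg, dif_neg hfg, le_max_iff, WithZero.exp_le_exp,
          WithZero.exp_le_exp]
        have := v.map_add f g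
        rw [le_max_iff, hk _ hfg, hk f hf, hk g hg, hanti.le_iff_ge, hanti.le_iff_ge] at this
        omega }
  have hw : ∀ (f : L) (hf : f ≠ 0), w f = WithZero.exp (-k f hf) := fun f hf => dif_neg hf
  refine ⟨⟨w, ?_, ?_⟩, ?_⟩
  · intro a
    by_cases ha : a = 0
    · exact ⟨0, by simp [ha]⟩
    · refine ⟨π ^ (-WithZero.log a), ?_⟩
      rw [hw _ (zpow_ne_zero _ hπ0), huniq _ _ (-WithZero.log a) (by rw [map_zpow₀]), neg_neg,
        WithZero.exp_log ha]
  · intro c hc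
    rw [hw _ ((map_ne_zero _).2 hc), huniq _ _ 0 (by simp [hv c hc])]
    simp
  · intro f hf1
    by_cases hf : f = 0
    · simp [hf]
    · change w f ≤ _
      rw [hw f hf, WithZero.exp_le_exp]
      rw [hk f hf, ← zpow_zero (v π), hanti.lt_iff_gt] at hf1
      omega

/-- Every nonconstant function has a zero. -/
theorem exists_place_ord_pos [IsAlgClosed K] {x : L} (hxK : x ∉ Set.range (algebraMap K L)) :
    ∃ P : Place K L, 0 < P.ord x := by
  have hx0 : x ≠ 0 := fun h0 => hxK ⟨0, by simp [h0]⟩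
  have hxt := transcendental_of_notMem_range hxK
  let A : Subring L := (Algebra.adjoin K {x}).toSubring
  have hxA : x ∈ A := Algebra.self_mem_adjoin_singleton K x
  have hI : Ideal.span {(⟨x, hxA⟩ : A)} ≠ ⊤ := by
    rw [Ne, Ideal.span_singleton_eq_top]
    intro hu
    obtain ⟨b, hb⟩ := hu.exists_right_inv
    have hbm : (b : L) ∈ Algebra.adjoin K {x} := b.2
    rw [Algebra.adjoin_singleton_eq_range_aeval] at hbm
    obtain ⟨p, hp⟩ := hbm
    have h1 : x * Polynomial.aeval x p = 1 := by
      have := congrArg Subtype.val hb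
      simp only [Subring.coe_mul, Subring.coe_one] at this
      rw [← this]
      congr 1
    have h2 : Polynomial.X * p - 1 = 0 := by
      by_contra hne
      exact aeval_ne_zero_of_notMem_range hxK hne (by simp [h1])
    have := congrArg (fun q => Polynomial.coeff q 0) h2
    simp at this
  obtain ⟨B, hAB, hIB⟩ := Ideal.image_subset_nonunits_valuationSubring _ hI
  have hKB : ∀ c : K, algebraMap K L c ∈ B := fun c => hAB (Subalgebra.algebraMap_mem _ c)
  have hx1 : B.valuation x < 1 := by
    have : x ∈ B.nonunits := hIB ⟨⟨x, hxA⟩, Ideal.mem_span_singleton_self _, rfl⟩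
    exact (B.mem_nonunits_iff).1 this
  have hv : ∀ c : K, c ≠ 0 → B.valuation (algebraMap K L c) = 1 := by
    intro c hc
    refine le_antisymm ((B.valuation_le_one_iff _).2 (hKB c)) ?_
    have h1 := (B.valuation_le_one_iff _).2 (hKB c⁻¹)
    rw [map_inv₀, map_inv₀] at h1
    exact (inv_le_one₀ (zero_lt_iff.2 ((Valuation.ne_zero_iff _).2 ((map_ne_zero _).2 hc)))).1 h1
  obtain ⟨P, hP⟩ := exists_place_of_valuation B.valuation hv hx0 hxK hx1
  exact ⟨P, by have := (hP x hx1).le_ord hx0; omega⟩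

/-- A function without poles is constant. -/
theorem mem_range_of_forall_ge_zero [IsAlgClosed K] {x : L} (h : ∀ P : Place K L, P.ge 0 x) :
    x ∈ Set.range (algebraMap K L) := by
  by_contra hxK
  have hx0 : x ≠ 0 := fun h0 => hxK ⟨0, by simp [h0]⟩
  obtain ⟨P, hP⟩ := exists_place_ord_pos (K := K) (x := x⁻¹) (by
    rintro ⟨c, hc⟩
    exact hxK ⟨c⁻¹, by rw [map_inv₀, hc, inv_inv]⟩)
  have := (h P).le_ord hx0
  rw [P.ord_inv] at hP
  omega

end PlaceExistence

section RiemannRoch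

variable {K L : Type*} [Field K] [Field L] [Algebra K L]

/-- The degree of a divisor. -/
def divDeg (D : Place K L →₀ ℤ) : ℤ := D.sum fun _ a => a

@[simp] theorem divDeg_zero : divDeg (0 : Place K L →₀ ℤ) = 0 := Finsupp.sum_zero_index

theorem divDeg_add (D E : Place K L →₀ ℤ) : divDeg (D + E) = divDeg D + divDeg E :=
  Finsupp.sum_add_index' (fun _ => rfl) fun _ _ _ => rfl

theorem divDeg_sub (D E : Place K L →₀ ℤ) : divDeg (D - E) = divDeg D - divDeg E := by
  have := divDeg_add (D - E) E
  rw [sub_add_cancel] at this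
  omega

theorem divDeg_nsmul (r : ℕ) (D : Place K L →₀ ℤ) : divDeg (r • D) = r * divDeg D := by
  induction r with
  | zero => simp
  | succ r ih => rw [succ_nsmul, divDeg_add, ih]; push_cast; ring

@[simp] theorem divDeg_single (P : Place K L) (a : ℤ) : divDeg (Finsupp.single P a) = a :=
  Finsupp.sum_single_index rfl

theorem divDeg_eq_sum (D : Place K L →₀ ℤ) {S : Finset (Place K L)} (h : D.support ⊆ S) :
    divDeg D = ∑ P ∈ S, D P :=
  Finsupp.sum_of_support_subset _ h _ fun _ _ => rfl

theorem divDeg_nonneg {D : Place K L →₀ ℤ} (h : 0 ≤ D) : 0 ≤ divDeg D :=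
  Finset.sum_nonneg fun P _ => h P

theorem mem_riemannRochSpace {D : Place K L →₀ ℤ} {f : L} :
    f ∈ riemannRochSpace D ↔ ∀ P : Place K L, P.ge (-D P) f := by
  simp only [Place.ge, neg_neg]; rfl

theorem riemannRochSpace_mono {D E : Place K L →₀ ℤ} (h : D ≤ E) :
    riemannRochSpace D ≤ riemannRochSpace E := fun f hf => by
  rw [mem_riemannRochSpace] at *
  exact fun P => (hf P).mono (neg_le_neg (h P))

theorem finite_of_functional {V W : Submodule K L} [FiniteDimensional K V] (φ : W →ₗ[K] K)
    (h : ∀ w : W, φ w = 0 → (w : L) ∈ V) :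
    FiniteDimensional K W ∧ Module.finrank K W ≤ Module.finrank K V + 1 := by
  let ψ : LinearMap.ker φ →ₗ[K] V :=
    { toFun := fun w => ⟨w.1.1, h w.1 w.2⟩
      map_add' := fun _ _ => rfl
      map_smul' := fun _ _ => rfl }
  have hψ : Function.Injective ψ := fun a b hab => by
    have := congrArg Subtype.val hab
    exact Subtype.ext (Subtype.ext this)
  have hker : FiniteDimensional K (LinearMap.ker φ) := FiniteDimensional.of_injective ψ hψ
  have hquot : FiniteDimensional K (W ⧸ LinearMap.ker φ) :=
    FiniteDimensional.of_injective _ (LinearMap.quotKerEquivRange φ).injective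
  have hW : FiniteDimensional K W := Module.Finite.of_submodule_quotient (LinearMap.ker φ)
  refine ⟨hW, ?_⟩
  have h1 := LinearMap.finrank_range_add_finrank_ker φ
  have h2 := LinearMap.finrank_le_finrank_of_injective hψ
  have h3 : Module.finrank K (LinearMap.range φ) ≤ 1 := by
    simpa using Submodule.finrank_le (LinearMap.range φ)
  omega

variable [IsAlgClosed K] [IsCurveField K L]

/-- The leading coefficient at `P`, for functions of order at least `n`, as a linear form. -/
def leadingCoeff (P : Place K L) (n : ℤ) (W : Submodule K L) (hW : ∀ f ∈ W, P.ge n f)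
    {π : L} (hπ : P.ord π = 1) : W →ₗ[K] K :=
  have hge : ∀ f ∈ W, P.ge 0 (f * π ^ (-n)) := fun f hf => by
    simpa [hπ] using (hW f hf).mul (P.ge_ord (π ^ (-n)))
  { toFun := fun f => P.eval (f.1 * π ^ (-n))
    map_add' := fun f g => by
      rw [Submodule.coe_add, add_mul, Place.eval_add (hge _ f.2) (hge _ g.2)]
    map_smul' := fun c f => by
      rw [Submodule.coe_smul, smul_mul_assoc, Place.eval_smul (hge _ f.2)]; rfl }

theorem leadingCoeff_eq_zero {P : Place K L} {n : ℤ} {W : Submodule K L}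
    {hW : ∀ f ∈ W, P.ge n f} {π : L} {hπ : P.ord π = 1} {f : W}
    (h : leadingCoeff P n W hW hπ f = 0) : P.ge (n + 1) (f : L) := by
  have hπ0 : π ≠ 0 := P.ne_zero_of_ord_ne (by omega)
  have hge : P.ge 0 (f.1 * π ^ (-n)) := by
    simpa [hπ] using (hW f f.2).mul (P.ge_ord (π ^ (-n)))
  have h1 := ((Place.eval_eq_zero_iff hge).1 h).mul (P.ge_ord (π ^ n))
  rw [mul_assoc, ← zpow_add₀ hπ0, neg_add_cancel, zpow_zero, mul_one, Place.ord_zpow, hπ] at h1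
  exact h1.mono (by omega)

theorem finrank_add_single_le (D : Place K L →₀ ℤ) [FiniteDimensional K (riemannRochSpace D)]
    (P : Place K L) :
    FiniteDimensional K (riemannRochSpace (D + Finsupp.single P 1)) ∧
      Module.finrank K (riemannRochSpace (D + Finsupp.single P 1)) ≤
        Module.finrank K (riemannRochSpace D) + 1 := by
  classical
  obtain ⟨π, hπ⟩ := P.exists_ord_eq_one
  refine finite_of_functional (leadingCoeff P (-(D P) - 1) _ (fun f hf => ?_) hπ) fun f hf => ?_
  · refine (mem_riemannRochSpace.1 hf P).mono ?_
    simp; omega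
  · have h1 := leadingCoeff_eq_zero hf
    rw [mem_riemannRochSpace]
    intro Q
    by_cases hQ : Q = P
    · subst hQ; exact h1.mono (by omega)
    · have := mem_riemannRochSpace.1 f.2 Q
      rwa [Finsupp.add_apply, Finsupp.single_eq_of_ne hQ, add_zero] at this

theorem riemannRochSpace_zero :
    FiniteDimensional K (riemannRochSpace (0 : Place K L →₀ ℤ)) ∧
      Module.finrank K (riemannRochSpace (0 : Place K L →₀ ℤ)) = 1 := by
  have h : riemannRochSpace (0 : Place K L →₀ ℤ) = Submodule.span K {1} := by
    ext f
    rw [Submodule.mem_span_singleton, mem_riemannRochSpace]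
    constructor
    · intro hf
      obtain ⟨c, rfl⟩ := mem_range_of_forall_ge_zero (x := f) (fun P => by simpa using hf P)
      exact ⟨c, by rw [Algebra.smul_def, mul_one]⟩
    · rintro ⟨c, rfl⟩ P
      simpa using P.ge_one_right.smul c
  rw [h]
  exact ⟨inferInstance, finrank_span_singleton one_ne_zero⟩

theorem finrank_add_le (D : Place K L →₀ ℤ) [FiniteDimensional K (riemannRochSpace D)] :
    ∀ (n : ℕ) (A : Place K L →₀ ℤ), 0 ≤ A → divDeg A = n →
      FiniteDimensional K (riemannRochSpace (D + A)) ∧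
        Module.finrank K (riemannRochSpace (D + A)) ≤ Module.finrank K (riemannRochSpace D) + n := by
  classical
  intro n
  induction n with
  | zero =>
    intro A hA hdeg
    have : A = 0 := by
      ext P
      by_contra hP
      have hmem : P ∈ A.support := Finsupp.mem_support_iff.2 hP
      have := Finset.single_le_sum (fun Q _ => hA Q) hmem
      have h2 : divDeg A = ∑ P ∈ A.support, A P := rfl
      have h3 := hA P
      simp only [Finsupp.coe_zero, Pi.zero_apply] at *
      omega
    subst this
    rw [add_zero]
    exact ⟨inferInstance, by omega⟩
  | succ n ih =>
    intro A hA hdeg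
    obtain ⟨P, hP⟩ : ∃ P, A P ≠ 0 := by
      by_contra hcon
      push Not at hcon
      have : A = 0 := Finsupp.ext hcon
      rw [this, divDeg_zero] at hdeg
      omega
    have hA' : 0 ≤ A - Finsupp.single P 1 := fun Q => by
      have hQ := hA Q
      by_cases h : Q = P
      · subst h
        simp only [Finsupp.coe_zero, Pi.zero_apply, Finsupp.coe_sub, Pi.sub_apply,
          Finsupp.single_eq_same] at *
        omega
      · simpa [Finsupp.single_eq_of_ne h] using hQ
    obtain ⟨h1, h2⟩ := ih (A - Finsupp.single P 1) hA' (by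
      rw [divDeg_sub, divDeg_single, hdeg]; push_cast; ring)
    obtain ⟨h3, h4⟩ := finrank_add_single_le (D + (A - Finsupp.single P 1)) P
    rw [add_assoc, sub_add_cancel] at h3 h4
    exact ⟨h3, by omega⟩

instance finiteDimensional_riemannRochSpace (D : Place K L →₀ ℤ) :
    FiniteDimensional K (riemannRochSpace D) := by
  have h0 := (riemannRochSpace_zero (K := K) (L := L)).1
  have hnn : (0 : Place K L →₀ ℤ) ≤ D ⊔ 0 := le_sup_right
  obtain ⟨h1, -⟩ := finrank_add_le (0 : Place K L →₀ ℤ) (divDeg (D ⊔ 0)).toNat (D ⊔ 0) hnn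
    (Int.toNat_of_nonneg (divDeg_nonneg hnn)).symm
  rw [zero_add] at h1
  exact Submodule.finiteDimensional_of_le (riemannRochSpace_mono (le_sup_left : D ≤ D ⊔ 0))

/-- `ℓ(D)`. -/
def ell (D : Place K L →₀ ℤ) : ℤ := Module.finrank K (riemannRochSpace D)

theorem ell_sub_le {D E : Place K L →₀ ℤ} (h : D ≤ E) : ell E - ell D ≤ divDeg E - divDeg D := by
  have h0 : 0 ≤ E - D := sub_nonneg.2 h
  obtain ⟨-, h2⟩ := finrank_add_le D (divDeg (E - D)).toNat (E - D) h0
    (Int.toNat_of_nonneg (divDeg_nonneg h0)).symm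
  rw [add_sub_cancel] at h2
  have h3 := Int.toNat_of_nonneg (divDeg_nonneg h0)
  rw [divDeg_sub] at h3
  simp only [ell]
  rw [divDeg_sub] at h2
  omega

theorem ell_zero : ell (0 : Place K L →₀ ℤ) = 1 := by
  simp [ell, riemannRochSpace_zero.2]

theorem ell_le_of_nonneg {D : Place K L →₀ ℤ} (h : 0 ≤ D) : ell D ≤ divDeg D + 1 := by
  have := ell_sub_le h
  rw [ell_zero, divDeg_zero] at this
  omega

/-- The divisor of a function. -/
def divisor (x : L) : Place K L →₀ ℤ :=
  Finsupp.ofSupportFinite (fun P => P.ord x) finite_ord_ne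

@[simp] theorem divisor_apply (x : L) (P : Place K L) : divisor x P = P.ord x := rfl

/-- The divisor of poles of a function. -/
def poleDivisor (x : L) : Place K L →₀ ℤ :=
  Finsupp.ofSupportFinite (fun P => max 0 (-P.ord x)) (finite_ord_ne.subset fun P hP => by
    simp only [Function.mem_support] at hP
    simp only [Set.mem_ofPred_eq]
    intro h
    rw [h] at hP
    simp at hP)

@[simp] theorem poleDivisor_apply (x : L) (P : Place K L) :
    poleDivisor x P = max 0 (-P.ord x) := rfl

theorem poleDivisor_nonneg (x : L) : (0 : Place K L →₀ ℤ) ≤ poleDivisor x := fun P => by simp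

theorem divisor_eq (x : L) : (divisor x : Place K L →₀ ℤ) = poleDivisor x⁻¹ - poleDivisor x := by
  ext P
  simp
  omega

theorem ell_add_divisor (D : Place K L →₀ ℤ) {z : L} (hz : z ≠ 0) :
    ell (D + divisor z) = ell D := by
  have : riemannRochSpace (D + divisor z) =
      (riemannRochSpace D).map (LinearEquiv.smulOfNeZero L L z⁻¹ (inv_ne_zero hz) |>.restrictScalars
        K : L →ₗ[K] L) := by
    ext f
    simp only [Submodule.mem_map, mem_riemannRochSpace]
    constructor
    · intro h
      refine ⟨z * f, fun P => ?_, by simp [hz]⟩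
      convert (P.ge_ord z).mul (h P) using 1
      simp
    · rintro ⟨g, hg, rfl⟩ P
      convert (P.ge_ord z⁻¹).mul (hg P) using 1
      · simp [add_comm]
      · rfl
  rw [ell, ell, this]
  congr 1
  exact LinearEquiv.finrank_map_eq (LinearEquiv.restrictScalars K
    (LinearEquiv.smulOfNeZero L L z⁻¹ (inv_ne_zero hz))) _

theorem finrank_adjoin_inv (x : L) :
    Module.finrank (IntermediateField.adjoin K {x⁻¹}) L =
      Module.finrank (IntermediateField.adjoin K {x}) L := by
  have h : IntermediateField.adjoin K {x⁻¹} = IntermediateField.adjoin K {x} := by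
    apply le_antisymm <;> rw [IntermediateField.adjoin_le_iff, Set.singleton_subset_iff]
    · exact inv_mem (IntermediateField.mem_adjoin_simple_self K x)
    · rw [← inv_inv x]
      exact inv_mem (by
        rw [inv_inv]; exact IntermediateField.mem_adjoin_simple_self K x⁻¹)
  rw [h]

theorem divDeg_poleDivisor_le {x : L} (hxK : x ∉ Set.range (algebraMap K L)) :
    divDeg (poleDivisor x : Place K L →₀ ℤ) ≤
      Module.finrank (IntermediateField.adjoin K {x}) L := by
  have hxK' : x⁻¹ ∉ Set.range (algebraMap K L) := by
    rintro ⟨c, hc⟩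
    exact hxK ⟨c⁻¹, by rw [map_inv₀, hc, inv_inv]⟩
  rw [← finrank_adjoin_inv x]
  have h : ∀ P ∈ (poleDivisor x : Place K L →₀ ℤ).support, 0 < P.ord x⁻¹ := fun P hP => by
    simp at hP
    simp; omega
  refine le_trans (le_of_eq ?_) (sum_ord_le_finrank hxK' _ h)
  refine Finset.sum_congr rfl fun P hP => ?_
  have := h P hP
  simp at this ⊢
  omega

open Polynomial in
theorem linearIndependent_pow_mul {ι : Type*} [Fintype ι] {x : L}
    (hxK : x ∉ Set.range (algebraMap K L)) {u : ι → L}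
    (hu : LinearIndependent (IntermediateField.adjoin K {x}) u) (r : ℕ) :
    LinearIndependent K fun a : ι × Fin r => x ^ (a.2 : ℕ) * u a.1 := by
  classical
  rw [Fintype.linearIndependent_iff]
  intro c hc
  rw [Fintype.linearIndependent_iff] at hu
  let p : ι → K[X] := fun i => ∑ j : Fin r, C (c (i, j)) * X ^ (j : ℕ)
  have hp : ∀ i, aeval x (p i) = ∑ j : Fin r, c (i, j) • x ^ (j : ℕ) := fun i => by
    simp [p, map_sum, Algebra.smul_def]
  have hmem : ∀ i, aeval x (p i) ∈ IntermediateField.adjoin K {x} := fun i =>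
    IntermediateField.algebra_adjoin_le_adjoin K _ (aeval_mem_adjoin_singleton K x)
  have h1 := hu (fun i => ⟨aeval x (p i), hmem i⟩) (by
    rw [← hc, Fintype.sum_prod_type]
    refine Finset.sum_congr rfl fun i _ => ?_
    rw [IntermediateField.smul_def]
    simp only [hp, smul_eq_mul, Finset.sum_mul, smul_mul_assoc])
  rintro ⟨i, j⟩
  have h2 : aeval x (p i) = 0 := congrArg Subtype.val (h1 i)
  have h3 : p i = 0 := by
    by_contra hne
    exact aeval_ne_zero_of_notMem_range hxK hne h2
  have h4 := congrArg (fun q => coeff q (j : ℕ)) h3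
  simpa [p, finsetSum_coeff, coeff_C_mul, coeff_X_pow, Fin.val_inj] using h4

/-- A divisor bounding the poles of a finite family of functions. -/
theorem exists_divisor_bound {ι : Type*} [Fintype ι] (u : ι → L) :
    ∃ C : Place K L →₀ ℤ, 0 ≤ C ∧ ∀ i (P : Place K L), P.ge (-C P) (u i) := by
  refine ⟨∑ i, poleDivisor (u i), Finset.sum_nonneg fun i _ => poleDivisor_nonneg _, fun i P => ?_⟩
  refine (P.ge_ord _).mono ?_
  have h1 : (poleDivisor (u i) : Place K L →₀ ℤ) P ≤ ∑ i, (poleDivisor (u i) : Place K L →₀ ℤ) P :=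
    Finset.single_le_sum (f := fun i => (poleDivisor (u i) : Place K L →₀ ℤ) P)
      (fun i _ => poleDivisor_nonneg (u i) P) (Finset.mem_univ i)
  rw [Finsupp.finsetSum_apply]
  simp only [poleDivisor_apply] at *
  omega

theorem pow_mul_mem_riemannRochSpace {ι : Type*} {x : L} {u : ι → L} {C : Place K L →₀ ℤ}
    (hC : ∀ i (P : Place K L), P.ge (-C P) (u i)) {r j : ℕ} (hj : j ≤ r) (i : ι) :
    x ^ j * u i ∈ riemannRochSpace (r • poleDivisor x + C) := by
  rw [mem_riemannRochSpace]
  intro P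
  refine ((P.ge_ord (x ^ j)).mul (hC i P)).mono ?_
  simp only [Place.ord_pow, Finsupp.add_apply, Finsupp.smul_apply, poleDivisor_apply, nsmul_eq_mul]
  have h1 : -P.ord x ≤ max 0 (-P.ord x) := le_max_right _ _
  have h2 : 0 ≤ max 0 (-P.ord x) := le_max_left _ _
  have h3 : (j : ℤ) ≤ r := by exact_mod_cast hj
  nlinarith

theorem card_mul_le_ell {ι : Type*} [Fintype ι] {x : L}
    (hxK : x ∉ Set.range (algebraMap K L)) {u : ι → L}
    (hu : LinearIndependent (IntermediateField.adjoin K {x}) u) {C : Place K L →₀ ℤ}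
    (hC : ∀ i (P : Place K L), P.ge (-C P) (u i)) (r : ℕ) :
    (Fintype.card ι : ℤ) * (r + 1) ≤ ell (r • poleDivisor x + C) := by
  have h := linearIndependent_pow_mul hxK hu (r + 1)
  have h1 := finrank_span_eq_card h
  have h2 : Submodule.span K (Set.range fun a : ι × Fin (r + 1) => x ^ (a.2 : ℕ) * u a.1) ≤
      riemannRochSpace (r • poleDivisor x + C) := by
    rw [Submodule.span_le]
    rintro _ ⟨a, rfl⟩
    exact pow_mul_mem_riemannRochSpace hC (by have := a.2.2; omega) _
  have h3 := Submodule.finrank_mono h2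
  rw [h1, Fintype.card_prod, Fintype.card_fin] at h3
  rw [ell]
  exact_mod_cast h3

/-- A nonconstant function has exactly `[L : K(x)]` poles, counted with multiplicity. -/
theorem divDeg_poleDivisor {x : L} (hxK : x ∉ Set.range (algebraMap K L)) :
    divDeg (poleDivisor x : Place K L →₀ ℤ) =
      Module.finrank (IntermediateField.adjoin K {x}) L := by
  refine le_antisymm (divDeg_poleDivisor_le hxK) ?_
  have := IsCurveField.finite x hxK
  let u := Module.finBasis (IntermediateField.adjoin K {x}) L
  obtain ⟨C, hC0, hC⟩ := exists_divisor_bound (K := K) u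
  by_contra hlt
  push Not at hlt
  set r : ℕ := (divDeg C).toNat + 2 with hr
  have h1 := card_mul_le_ell hxK u.linearIndependent hC r
  have h2 := ell_le_of_nonneg (D := r • poleDivisor x + C)
    (add_nonneg (nsmul_nonneg (poleDivisor_nonneg x) r) hC0)
  rw [divDeg_add, divDeg_nsmul] at h2
  rw [Fintype.card_fin] at h1
  have h3 := Int.toNat_of_nonneg (divDeg_nonneg hC0)
  have h4 : (r : ℤ) = divDeg C + 2 := by rw [hr]; push_cast; omega
  rw [h4] at h1 h2
  have h5 := divDeg_nonneg hC0
  nlinarith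

/-- The product formula. -/
theorem divDeg_divisor (x : L) : divDeg (divisor x : Place K L →₀ ℤ) = 0 := by
  by_cases hxK : x ∈ Set.range (algebraMap K L)
  · obtain ⟨c, rfl⟩ := hxK
    have : (divisor (algebraMap K L c) : Place K L →₀ ℤ) = 0 := by
      ext P; simp [P.ord_algebraMap]
    rw [this, divDeg_zero]
  · have hxK' : x⁻¹ ∉ Set.range (algebraMap K L) := by
      rintro ⟨c, hc⟩
      exact hxK ⟨c⁻¹, by rw [map_inv₀, hc, inv_inv]⟩
    rw [divisor_eq, divDeg_sub, divDeg_poleDivisor hxK, divDeg_poleDivisor hxK',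
      finrank_adjoin_inv, sub_self]

theorem ell_le_of_ne_bot {D : Place K L →₀ ℤ} {f : L} (hf : f ∈ riemannRochSpace D)
    (hf0 : f ≠ 0) : ell D ≤ divDeg D + 1 := by
  have h : 0 ≤ D + divisor f := fun P => by
    have := (mem_riemannRochSpace.1 hf P).le_ord hf0
    simp; omega
  have := ell_le_of_nonneg h
  rwa [ell_add_divisor D hf0, divDeg_add, divDeg_divisor, add_zero] at this

theorem exists_ne_zero_of_ell_pos {D : Place K L →₀ ℤ} (h : 0 < ell D) :
    ∃ f ∈ riemannRochSpace D, f ≠ 0 := by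
  have hne : riemannRochSpace D ≠ ⊥ := fun hb => by
    rw [ell, hb] at h
    simp at h
  exact Submodule.exists_mem_ne_zero_of_ne_bot hne

/-- Riemann's theorem. -/
theorem exists_riemann_bound : ∃ γ : ℤ, ∀ D : Place K L →₀ ℤ, divDeg D - ell D ≤ γ := by
  obtain ⟨x, hxK⟩ := IsCurveField.exists_notMem (K := K) (L := L)
  have := IsCurveField.finite x hxK
  let u := Module.finBasis (IntermediateField.adjoin K {x}) L
  obtain ⟨C, hC0, hC⟩ := exists_divisor_bound (K := K) u
  set N : ℤ := (Module.finrank (IntermediateField.adjoin K {x}) L : ℤ) with hN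
  have hN0 : 0 < N := by
    rw [hN]; exact_mod_cast Module.finrank_pos
  have hB := divDeg_poleDivisor hxK
  have hr : ∀ r : ℕ, divDeg (r • poleDivisor x : Place K L →₀ ℤ) -
      ell (r • poleDivisor x : Place K L →₀ ℤ) ≤
      divDeg C - N := by
    intro r
    have h1 := card_mul_le_ell hxK u.linearIndependent hC r
    rw [Fintype.card_fin] at h1
    have h2 := ell_sub_le (D := (r • poleDivisor x : Place K L →₀ ℤ)) (E := r • poleDivisor x + C)
      (le_add_of_nonneg_right hC0)
    rw [divDeg_add] at h2
    rw [divDeg_nsmul, hB] at *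
    linarith
  refine ⟨divDeg C - N, fun D => ?_⟩
  have hpos : ∀ D : Place K L →₀ ℤ, 0 ≤ D → divDeg D - ell D ≤ divDeg C - N := by
    intro D hD
    set r : ℕ := (divDeg D + divDeg C - N + 1).toNat with hrdef
    have h1 := ell_sub_le (D := r • poleDivisor x - D) (E := r • poleDivisor x)
      (sub_le_self _ hD)
    have h2 := hr r
    rw [divDeg_sub] at h1
    have h3 : 0 < ell (r • poleDivisor x - D) := by
      rw [divDeg_nsmul, hB] at *
      have h4 : (r : ℤ) ≥ divDeg D + divDeg C - N + 1 := by rw [hrdef]; exact Int.self_le_toNat _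
      have h5 : (r : ℤ) ≤ r * N := by nlinarith
      linarith
    obtain ⟨z, hz, hz0⟩ := exists_ne_zero_of_ell_pos h3
    have h4 : D ≤ r • poleDivisor x + divisor z := fun P => by
      have := (mem_riemannRochSpace.1 hz P).le_ord hz0
      simp at this ⊢
      omega
    have h5 := ell_sub_le h4
    rw [ell_add_divisor _ hz0, divDeg_add, divDeg_divisor] at h5
    linarith
  have h1 := hpos (D ⊔ 0) le_sup_right
  have h2 := ell_sub_le (le_sup_left : D ≤ D ⊔ 0)
  linarith

theorem le_genus (D : Place K L →₀ ℤ) : divDeg D - ell D + 1 ≤ genus K L := by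
  obtain ⟨γ, hγ⟩ := exists_riemann_bound (K := K) (L := L)
  refine le_csSup ⟨γ + 1, ?_⟩ ⟨D, rfl⟩
  rintro _ ⟨E, rfl⟩
  have := hγ E
  change divDeg E - ell E + 1 ≤ γ + 1
  linarith

end RiemannRoch

section PBasis

variable {K L : Type*} [Field K] [Field L] [Algebra K L]

/-- Every element is a combination of `1, t, …, t ^ (p - 1)` with coefficients that are `p`-th
powers. -/
def IsPBasis (p : ℕ) (t : L) : Prop :=
  ∀ y : L, ∃ z : ℕ → L, y = ∑ i ∈ Finset.range p, z i ^ p * t ^ i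

namespace Place

variable (P : Place K L)

theorem ord_pow_mul_pow {π : L} (hπ : P.ord π = 1) {z : L} (hz : z ≠ 0) (q i : ℕ) :
    P.ord (z ^ q * π ^ i) = q * P.ord z + i := by
  have hπ0 : π ≠ 0 := P.ne_zero_of_ord_ne (by omega)
  rw [P.ord_mul (pow_ne_zero _ hz) (pow_ne_zero _ hπ0), ord_pow, ord_pow, hπ]
  ring

theorem ge_term_of_ge_sum {π : L} (hπ : P.ord π = 1) {q : ℕ} (z : ℕ → L) {n : ℤ}
    (h : P.ge n (∑ i ∈ Finset.range q, z i ^ q * π ^ i)) {i : ℕ} (hi : i < q) :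
    P.ge n (z i ^ q * π ^ i) := by
  have hπ0 : π ≠ 0 := P.ne_zero_of_ord_ne (by omega)
  have hq : q ≠ 0 := by omega
  refine P.ge_of_ge_sum (Finset.range q) (fun i => z i ^ q * π ^ i) ?_ h i (Finset.mem_range.2 hi)
  intro a ha b hb hza hzb hab
  have hza' : z a ≠ 0 := fun h0 => hza (by simp [h0, hq])
  have hzb' : z b ≠ 0 := fun h0 => hzb (by simp [h0, hq])
  simp only [Finset.mem_range] at ha hb
  simp only [P.ord_pow_mul_pow hπ hza', P.ord_pow_mul_pow hπ hzb'] at hab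
  have h1 : ((a : ℤ) - b) = q * (P.ord (z b) - P.ord (z a)) := by linarith
  have h2 : (q : ℤ) ∣ (a : ℤ) - b := ⟨_, h1⟩
  have h3 : (a : ℤ) - b = 0 := Int.eq_zero_of_abs_lt_dvd h2 (by rw [abs_lt]; omega)
  omega

theorem ge_coeff_of_ge_sum {π : L} (hπ : P.ord π = 1) {q : ℕ} (z : ℕ → L) {n : ℤ}
    (h : P.ge n (∑ i ∈ Finset.range q, z i ^ q * π ^ i)) {i : ℕ} (hi : i < q) {m : ℤ}
    (hm : q * (m - 1) + i < n) : P.ge m (z i) := by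
  by_cases hz : z i = 0
  · simp [hz]
  · have h1 := P.ge_term_of_ge_sum hπ z h hi
    have hπ0 : π ≠ 0 := P.ne_zero_of_ord_ne (by omega)
    have h2 := h1.le_ord (mul_ne_zero (pow_ne_zero _ hz) (pow_ne_zero _ hπ0))
    rw [P.ord_pow_mul_pow hπ hz] at h2
    rw [P.ge_iff_le_ord hz]
    by_contra hlt
    have : P.ord (z i) ≤ m - 1 := by omega
    nlinarith

end Place

variable {p : ℕ} [Fact p.Prime] [CharP L p]

theorem IsPBasis.of_ord_eq_one {t : L} (ht : IsPBasis p t) (P : Place K L) {π : L}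
    (hπ : P.ord π = 1) : IsPBasis p π := by
  classical
  have hp0 : p ≠ 0 := (Fact.out : p.Prime).ne_zero
  have hπ0 : π ≠ 0 := P.ne_zero_of_ord_ne (by omega)
  let Lp : Subfield L := (frobenius L p).fieldRange
  have hLp : ∀ z : L, z ^ p ∈ Lp := fun z => ⟨z, rfl⟩
  have hspan : ⊤ ≤ Submodule.span Lp (Set.range fun i : Fin p => t ^ (i : ℕ)) := by
    intro y _
    obtain ⟨z, rfl⟩ := ht y
    refine Submodule.sum_mem _ fun i hi => ?_
    have := Submodule.smul_mem (Submodule.span Lp (Set.range fun i : Fin p => t ^ (i : ℕ)))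
      (⟨z i ^ p, hLp _⟩ : Lp) (Submodule.subset_span ⟨⟨i, Finset.mem_range.1 hi⟩, rfl⟩)
    exact this
  have hfin : FiniteDimensional Lp L := Module.Finite.of_surjective
    (Fintype.linearCombination Lp (fun i : Fin p => t ^ (i : ℕ)))
    (LinearMap.range_eq_top.1 (top_le_iff.1 (by rwa [Fintype.range_linearCombination])))
  have hle : Module.finrank Lp L ≤ p := by
    have h1 := finrank_range_le_card (R := Lp) (fun i : Fin p => t ^ (i : ℕ))
    rw [Set.finrank, top_le_iff.1 hspan, finrank_top, Fintype.card_fin] at h1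
    exact h1
  have hli : LinearIndependent Lp (fun i : Fin p => π ^ (i : ℕ)) := by
    rw [Fintype.linearIndependent_iff]
    intro g hg i
    have hz : ∀ i : Fin p, ∃ z : L, z ^ p = (g i : L) := fun i => (g i).2
    choose z hz using hz
    let z' : ℕ → L := fun i => if h : i < p then z ⟨i, h⟩ else 0
    have hsum : ∑ i ∈ Finset.range p, z' i ^ p * π ^ i = 0 := by
      rw [← Fin.sum_univ_eq_sum_range (fun i => z' i ^ p * π ^ i), ← hg]
      refine Finset.sum_congr rfl fun i _ => ?_
      simp only [z', i.2, dif_pos, Fin.eta, hz]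
      rfl
    have hall : ∀ n : ℤ, P.ge n (z' i ^ p * π ^ (i : ℕ)) := fun n =>
      P.ge_term_of_ge_sum hπ z' (by rw [hsum]; simp) i.2
    have h0 : z' i ^ p * π ^ (i : ℕ) = 0 := by
      by_contra hne
      have := (hall (P.ord (z' i ^ p * π ^ (i : ℕ)) + 1)).le_ord hne
      omega
    have h1 : z' i ^ p = 0 := (mul_eq_zero.1 h0).resolve_right (pow_ne_zero _ hπ0)
    simp only [z', i.2, dif_pos, Fin.eta, hz] at h1
    exact_mod_cast h1
  have hcard : Fintype.card (Fin p) = Module.finrank Lp L := by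
    have := hli.fintype_card_le_finrank
    rw [Fintype.card_fin] at *
    omega
  have : Nonempty (Fin p) := ⟨⟨0, Nat.pos_of_ne_zero hp0⟩⟩
  have htop := hli.span_eq_top_of_card_eq_finrank hcard
  intro y
  have hy : y ∈ Submodule.span Lp (Set.range fun i : Fin p => π ^ (i : ℕ)) := by
    rw [htop]; trivial
  obtain ⟨c, hc⟩ := (Submodule.mem_span_range_iff_exists_fun Lp).1 hy
  have hz : ∀ i : Fin p, ∃ z : L, z ^ p = (c i : L) := fun i => (c i).2
  choose z hz using hz
  refine ⟨fun i => if h : i < p then z ⟨i, h⟩ else 0, ?_⟩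
  rw [← Fin.sum_univ_eq_sum_range
    (fun i => (if h : i < p then z ⟨i, h⟩ else 0) ^ p * π ^ i), ← hc]
  refine Finset.sum_congr rfl fun i _ => ?_
  simp only [i.2, dif_pos, Fin.eta, hz]
  rfl

theorem IsPBasis.pow {t : L} (ht : IsPBasis p t) (k : ℕ) : IsPBasis (p ^ k) t := by
  have hp : 0 < p := (Fact.out : p.Prime).pos
  induction k with
  | zero => intro y; exact ⟨fun _ => y, by simp⟩
  | succ k ih =>
    intro y
    obtain ⟨z, rfl⟩ := ht y
    choose w hw using fun i => ih (z i)
    refine ⟨fun n => w (n % p) (n / p), ?_⟩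
    have h1 : ∀ i, z i ^ p * t ^ i =
        ∑ j ∈ Finset.range (p ^ k), w i j ^ p ^ (k + 1) * t ^ (p * j + i) := fun i => by
      conv_lhs => rw [hw i, sum_pow_char p, Finset.sum_mul]
      refine Finset.sum_congr rfl fun j _ => ?_
      rw [mul_pow, ← pow_mul, ← pow_mul, pow_add, pow_succ, mul_comm j p]; ring
    rw [Finset.sum_congr rfl fun i _ => h1 i, ← Finset.sum_product']
    refine Finset.sum_nbij' (fun a => p * a.2 + a.1) (fun n => (n % p, n / p)) ?_ ?_ ?_ ?_ ?_
    · rintro ⟨i, j⟩ h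
      simp only [Finset.mem_product, Finset.mem_range] at h ⊢
      calc p * j + i < p * j + p := by omega
        _ = p * (j + 1) := by ring
        _ ≤ p * p ^ k := Nat.mul_le_mul_left _ h.2
        _ = p ^ (k + 1) := by ring
    · intro n h
      simp only [Finset.mem_product, Finset.mem_range] at h ⊢
      refine ⟨Nat.mod_lt _ hp, Nat.div_lt_of_lt_mul ?_⟩
      rwa [pow_succ, mul_comm] at h
    · rintro ⟨i, j⟩ h
      simp only [Finset.mem_product, Finset.mem_range] at h
      simp only [Nat.mul_add_mod, Nat.mod_eq_of_lt h.1, Nat.mul_add_div hp, Nat.div_eq_of_lt h.1,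
        add_zero]
    · intro n _
      exact Nat.div_add_mod n p
    · rintro ⟨i, j⟩ h
      simp only [Finset.mem_product, Finset.mem_range] at h
      simp only [Nat.mul_add_mod, Nat.mod_eq_of_lt h.1, Nat.mul_add_div hp, Nat.div_eq_of_lt h.1,
        add_zero]

theorem derivation_pow_char {M : Type*} [AddCommGroup M] [Module K M] [Module L M]
    (δ : Derivation K L M) (z : L) : δ (z ^ p) = 0 := by
  rw [Derivation.leibniz_pow, ← Nat.cast_smul_eq_nsmul L, CharP.cast_eq_zero, zero_smul]

theorem derivation_pBasis_sum {M : Type*} [AddCommGroup M] [Module K M] [Module L M]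
    (δ : Derivation K L M) (π : L) (z : ℕ → L) :
    δ (∑ i ∈ Finset.range p, z i ^ p * π ^ i) =
      (∑ i ∈ Finset.range p, z i ^ p * (i * π ^ (i - 1))) • δ π := by
  rw [map_sum, Finset.sum_smul]
  refine Finset.sum_congr rfl fun i _ => ?_
  rw [Derivation.leibniz, derivation_pow_char (p := p) δ (z i), smul_zero, add_zero, Derivation.leibniz_pow,
    ← Nat.cast_smul_eq_nsmul L, smul_smul, smul_smul, mul_assoc]

/-- Derivations are determined by their value at an element of a `p`-basis. -/
theorem IsPBasis.derivation_eq {M : Type*} [AddCommGroup M] [Module K M] [Module L M]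
    {π : L} (hπ : IsPBasis p π) {D : Derivation K L L} (hD : D π = 1) (δ : Derivation K L M)
    (y : L) : δ y = D y • δ π := by
  obtain ⟨z, rfl⟩ := hπ y
  rw [derivation_pBasis_sum, derivation_pBasis_sum, hD, smul_eq_mul, mul_one]

theorem IsPBasis.derivation_ne_zero {π : L} (hπ : IsPBasis p π) {D : Derivation K L L} {t : L}
    (hD : D t = 1) : D π ≠ 0 := by
  intro h
  obtain ⟨z, hz⟩ := hπ t
  have := derivation_pBasis_sum D π z
  rw [← hz, hD, h, smul_zero] at this
  exact one_ne_zero this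

/-- Rescaling a derivation so that it takes the value `1` at `π`. -/
def normDeriv (D : Derivation K L L) (π : L) : Derivation K L L := (D π)⁻¹ • D

theorem normDeriv_apply (D : Derivation K L L) (π y : L) :
    normDeriv D π y = D y / D π := by
  rw [normDeriv, Derivation.smul_apply, smul_eq_mul, div_eq_inv_mul]

theorem normDeriv_self {D : Derivation K L L} {π : L} (h : D π ≠ 0) : normDeriv D π π = 1 := by
  rw [normDeriv_apply, div_self h]

namespace Place

variable {P : Place K L}

theorem ge.derivation {t : L} (ht : IsPBasis p t) {π : L} (hπ : P.ord π = 1)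
    {δ : Derivation K L L} (hδ : δ π = 1) {y : L} (hy : P.ge 0 y) : P.ge 0 (δ y) := by
  have hπ0 : π ≠ 0 := P.ne_zero_of_ord_ne (by omega)
  obtain ⟨z, rfl⟩ := ht.of_ord_eq_one P hπ y
  rw [derivation_pBasis_sum, hδ, smul_eq_mul, mul_one]
  refine ge.sum fun i hi => ?_
  have hz : P.ge 0 (z i) := P.ge_coeff_of_ge_sum hπ z hy (Finset.mem_range.1 hi) (by
    have := Finset.mem_range.1 hi; omega)
  refine (P.integers.pow_mem hz p : P.ge 0 _).zero_mul
    (ge.zero_mul (P.integers.natCast_mem i : P.ge 0 _) ?_)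
  exact P.integers.pow_mem (show P.ge 0 π from (P.ge_iff_le_ord hπ0).2 (by omega)) _

/-- The derivative with respect to a local parameter of a function with a simple zero is a unit. -/
theorem ord_derivation_eq_zero {t : L} (ht : IsPBasis p t) {π : L} (hπ : P.ord π = 1)
    {δ : Derivation K L L} (hδ : δ π = 1) {y : L} (hy : P.ord y = 1) :
    δ y ≠ 0 ∧ P.ord (δ y) = 0 := by
  have hπ0 : π ≠ 0 := P.ne_zero_of_ord_ne (by omega)
  have hy0 : y ≠ 0 := P.ne_zero_of_ord_ne (by omega)
  have hu0 : y / π ≠ 0 := div_ne_zero hy0 hπ0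
  have hu : P.ord (y / π) = 0 := by rw [P.ord_div hy0 hπ0]; omega
  have h1 : δ y = y / π + π * δ (y / π) := by
    conv_lhs => rw [← div_mul_cancel₀ y hπ0]
    rw [Derivation.leibniz, hδ, smul_eq_mul, smul_eq_mul, mul_one]
  rw [h1, ← hu]
  refine P.ord_add_eq hu0 ?_
  rw [hu]
  exact ge.mul_zero ((P.ge_iff_le_ord hπ0).2 (by omega))
    (ge.derivation ht hπ hδ ((P.ge_iff_le_ord hu0).2 hu.ge))

/-- The logarithmic derivative has residue `ord f`. -/
theorem ge_logDeriv {t : L} (ht : IsPBasis p t) {π : L} (hπ : P.ord π = 1)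
    {δ : Derivation K L L} (hδ : δ π = 1) {f : L} (hf : f ≠ 0) :
    P.ge 1 (π * (δ f / f) - (P.ord f : L)) := by
  have hπ0 : π ≠ 0 := P.ne_zero_of_ord_ne (by omega)
  set k := P.ord f with hk
  set u := f * π ^ (-k) with hu
  have hu0 : u ≠ 0 := mul_ne_zero hf (zpow_ne_zero _ hπ0)
  have huo : P.ord u = 0 := by
    rw [hu, P.ord_mul hf (zpow_ne_zero _ hπ0), ord_zpow, hπ, ← hk]; ring
  have hf' : f = π ^ k * u := by
    rw [hu, mul_comm f, ← mul_assoc, ← zpow_add₀ hπ0, add_neg_cancel, zpow_zero, one_mul]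
  have h1 : π * (δ f / f) - (k : L) = π * (δ u * u⁻¹) := by
    have hd : δ f = π ^ k * δ u + u * (k * π ^ (k - 1)) := by
      rw [hf', Derivation.leibniz, Derivation.leibniz_zpow, hδ]
      simp
    rw [hd, hf', zpow_sub_one₀ hπ0]
    have := zpow_ne_zero k hπ0
    field_simp
    ring
  rw [h1]
  refine ge.mul_zero ((P.ge_iff_le_ord hπ0).2 (by omega)) (ge.zero_mul ?_ ?_)
  · exact ge.derivation ht hπ hδ ((P.ge_iff_le_ord hu0).2 huo.ge)
  · exact (P.ge_iff_le_ord (inv_ne_zero hu0)).2 (by simp [huo])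

variable (P)

/-- The order of `dt` at a place, in terms of the derivation `D = d/dt`. -/
theorem ordDiff_eq {t : L} (ht : IsPBasis p t) {D : Derivation K L L} (hD : D t = 1) {π : L}
    (hπ : P.ord π = 1) : P.ordDiff (KaehlerDifferential.D K L t) = -P.ord (D π) := by
  have hne : ∀ ϖ : L, P.ord ϖ = 1 → D ϖ ≠ 0 := fun ϖ hϖ =>
    (ht.of_ord_eq_one P hϖ).derivation_ne_zero hD
  have hdt : KaehlerDifferential.D K L t ≠ 0 := fun h => by
    have := D.liftKaehlerDifferential_comp_D t
    rw [h, map_zero, hD] at this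
    exact zero_ne_one this
  have hd : ∀ ϖ : L, KaehlerDifferential.D K L ϖ = D ϖ • KaehlerDifferential.D K L t :=
    fun ϖ => ht.derivation_eq hD _ ϖ
  have hex : ∃ g : L, ∃ ϖ : L, P.ord ϖ = 1 ∧
      KaehlerDifferential.D K L t = g • KaehlerDifferential.D K L ϖ :=
    ⟨(D π)⁻¹, π, hπ, by rw [hd π, smul_smul, inv_mul_cancel₀ (hne π hπ), one_smul]⟩
  obtain ⟨ϖ, hϖ, hg⟩ := Classical.epsilon_spec hex
  rw [ordDiff]
  set g := Classical.epsilon fun g : L => ∃ ϖ : L, P.ord ϖ = 1 ∧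
      KaehlerDifferential.D K L t = g • KaehlerDifferential.D K L ϖ
  rw [hd ϖ, smul_smul] at hg
  have hg1 : g * D ϖ = 1 := by
    have h2 : (1 - g * D ϖ) • KaehlerDifferential.D K L t = 0 := by
      rw [sub_smul, one_smul, ← hg, sub_self]
    have h3 := (smul_eq_zero.1 h2).resolve_right hdt
    exact (sub_eq_zero.1 h3).symm
  have hg2 : g = (D ϖ)⁻¹ := eq_inv_of_mul_eq_one_left hg1
  have h4 := (ord_derivation_eq_zero ht hπ (normDeriv_self (hne π hπ)) hϖ).2
  rw [normDeriv_apply, P.ord_div (hne ϖ hϖ) (hne π hπ)] at h4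
  rw [hg2, ord_inv]
  omega

end Place

end PBasis

section DiffSupport

variable {K L : Type*} [Field K] [Field L] [Algebra K L] [IsAlgClosed K] [IsCurveField K L]
variable {p : ℕ} [Fact p.Prime] [CharP L p]

theorem notMem_range_of_derivation {D : Derivation K L L} {t : L} (hD : D t = 1) :
    t ∉ Set.range (algebraMap K L) := by
  rintro ⟨c, rfl⟩
  rw [Derivation.map_algebraMap] at hD
  exact zero_ne_one hD

/-- A linear combination of functions with zero value at finitely many points. -/
theorem finrank_sub_card_le (W : Submodule K L) [FiniteDimensional K W] (S : Finset (Place K L))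
    (hW : ∀ P ∈ S, ∀ f ∈ W, P.ge 0 f) (V : Submodule K L) [FiniteDimensional K V]
    (hV : ∀ f ∈ W, (∀ P ∈ S, P.ge 1 f) → f ∈ V) :
    Module.finrank K W ≤ Module.finrank K V + S.card := by
  classical
  choose π hπ using fun P : Place K L => P.exists_ord_eq_one
  let φ : W →ₗ[K] (S → K) := LinearMap.pi fun P => leadingCoeff P.1 0 W (hW P.1 P.2) (hπ P.1)
  have hker : ∀ f : W, φ f = 0 → (f : L) ∈ V := fun f hf =>
    hV f f.2 fun P hP => by
      have : leadingCoeff P 0 W (hW P hP) (hπ P) f = 0 := congrFun hf ⟨P, hP⟩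
      simpa using leadingCoeff_eq_zero this
  let ψ : LinearMap.ker φ →ₗ[K] V :=
    { toFun := fun w => ⟨w.1.1, hker w.1 w.2⟩
      map_add' := fun _ _ => rfl
      map_smul' := fun _ _ => rfl }
  have hψ : Function.Injective ψ := fun a b hab => by
    have := congrArg Subtype.val hab
    exact Subtype.ext (Subtype.ext this)
  have h1 := LinearMap.finrank_range_add_finrank_ker φ
  have h2 := LinearMap.finrank_le_finrank_of_injective hψ
  have h3 : Module.finrank K (LinearMap.range φ) ≤ S.card := by
    simpa using Submodule.finrank_le (LinearMap.range φ)
  omega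

theorem finite_ordDiff_pos {t : L} (ht : IsPBasis p t) {D : Derivation K L L} (hD : D t = 1) :
    {P : Place K L | 0 < P.ordDiff (KaehlerDifferential.D K L t)}.Finite := by
  classical
  have htK := notMem_range_of_derivation hD
  have := IsCurveField.finite t htK
  let u := Module.finBasis (IntermediateField.adjoin K {t}) L
  obtain ⟨C, hC0, hC⟩ := exists_divisor_bound (K := K) u
  set N : ℤ := (Module.finrank (IntermediateField.adjoin K {t}) L : ℤ) with hN
  have hN0 : 0 < N := by
    rw [hN]; exact_mod_cast Module.finrank_pos
  let S₀ : Set (Place K L) := {P | P.ord t ≠ 0} ∪ ⋃ i, ({P | P.ord (u i) ≠ 0} ∪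
    {P | P.ord (D (u i)) ≠ 0})
  have hS₀ : S₀.Finite := finite_ord_ne.union
    (Set.finite_iUnion fun i => finite_ord_ne.union finite_ord_ne)
  refine Set.Finite.of_sdiff ?_ hS₀
  by_contra hinf
  obtain ⟨S, hS, hcard⟩ := Set.Infinite.exists_subset_card_eq hinf (divDeg C + 2).toNat
  have hreg : ∀ P ∈ S, P.ge 0 t ∧ (∀ i, P.ge 0 (u i)) ∧ (∀ i, P.ge 0 (D (u i))) ∧
      0 < P.ordDiff (KaehlerDifferential.D K L t) := by
    intro P hP
    have h := hS hP
    simp only [Set.mem_sdiff, Set.mem_ofPred_eq, S₀, Set.mem_union, Set.mem_iUnion, not_or,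
      not_exists, not_not] at h
    refine ⟨(P.ge_ord t).mono h.2.1.ge, fun i => (P.ge_ord _).mono (h.2.2 i).1.ge,
      fun i => (P.ge_ord _).mono (h.2.2 i).2.ge, h.1⟩
  set r : ℕ := S.card
  let b : Fin (Module.finrank (IntermediateField.adjoin K {t}) L) × Fin (r + 1) → L :=
    fun a => t ^ (a.2 : ℕ) * u a.1
  have hb : LinearIndependent K b := linearIndependent_pow_mul htK u.linearIndependent (r + 1)
  have hWreg : ∀ P ∈ S, ∀ f ∈ Submodule.span K (Set.range b), P.ge 0 f ∧ P.ge 0 (D f) := by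
    intro P hP f hf
    obtain ⟨h1, h2, h3, -⟩ := hreg P hP
    induction hf using Submodule.span_induction with
    | mem x hx =>
      obtain ⟨a, rfl⟩ := hx
      refine ⟨(P.integers.pow_mem h1 _ : P.ge 0 _).zero_mul (h2 _), ?_⟩
      simp only [b]
      rw [Derivation.leibniz, Derivation.leibniz_pow, hD]
      refine Place.ge.add ((P.integers.pow_mem h1 _ : P.ge 0 _).zero_mul (h3 _)) ?_
      refine (h2 _).zero_mul ?_
      rw [smul_eq_mul, mul_one]
      exact P.integers.nsmul_mem (P.integers.pow_mem h1 _) _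
    | zero => simp
    | add x y _ _ hx hy => exact ⟨hx.1.add hy.1, by rw [map_add]; exact hx.2.add hy.2⟩
    | smul c x _ hx => exact ⟨hx.1.smul c, by rw [Derivation.map_smul]; exact hx.2.smul c⟩
  let E : Place K L →₀ ℤ := r • poleDivisor t + C - ∑ P ∈ S, Finsupp.single P 2
  have hsingle : ∀ Q : Place K L, (∑ P ∈ S, Finsupp.single P (2 : ℤ)) Q = if Q ∈ S then 2 else 0 := by
    intro Q
    rw [Finsupp.finsetSum_apply]
    simp only [Finsupp.single_apply]
    rw [Finset.sum_ite_eq']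
  have hfin : FiniteDimensional K (Submodule.span K (Set.range b)) :=
    FiniteDimensional.span_of_finite K (Set.finite_range b)
  have hE := finrank_sub_card_le (Submodule.span K (Set.range b)) S
    (fun P hP f hf => (hWreg P hP f hf).1) (riemannRochSpace E) (fun f hf hf1 => by
      have hmem : Submodule.span K (Set.range b) ≤ riemannRochSpace (r • poleDivisor t + C) := by
        rw [Submodule.span_le]
        rintro _ ⟨a, rfl⟩
        exact pow_mul_mem_riemannRochSpace hC (by have := a.2.2; omega) _
      have hnn : ∀ P : Place K L, 0 ≤ (r • poleDivisor t + C : Place K L →₀ ℤ) P := fun P =>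
        add_nonneg (nsmul_nonneg (poleDivisor_nonneg t) r) hC0 P
      rw [mem_riemannRochSpace]
      intro P
      simp only [E, Finsupp.sub_apply, hsingle]
      by_cases hP : P ∈ S
      · rw [if_pos hP]
        obtain ⟨-, -, -, h4⟩ := hreg P hP
        refine Place.ge.mono (n := 2) ?_ (by have := hnn P; omega)
        by_cases hf0 : f = 0
        · simp [hf0]
        rw [P.ge_iff_le_ord hf0]
        have h5 := (hf1 P hP).le_ord hf0
        by_contra hlt
        have h6 : P.ord f = 1 := by omega
        obtain ⟨π, hπ⟩ := P.exists_ord_eq_one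
        have hDπ : D π ≠ 0 := (ht.of_ord_eq_one P hπ).derivation_ne_zero hD
        obtain ⟨h7, h8⟩ := Place.ord_derivation_eq_zero ht hπ (normDeriv_self hDπ) h6
        rw [P.ordDiff_eq ht hD hπ] at h4
        have h9 : D f ≠ 0 := fun h => h7 (by rw [normDeriv_apply, h, zero_div])
        rw [normDeriv_apply, P.ord_div h9 hDπ] at h8
        have := (hWreg P hP f hf).2.le_ord h9
        omega
      · rw [if_neg hP, sub_zero]
        exact mem_riemannRochSpace.1 (hmem hf) P)
  rw [finrank_span_eq_card hb, Fintype.card_prod, Fintype.card_fin, Fintype.card_fin] at hE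
  have hE' : N * (r + 1) ≤ ell E + r := by
    rw [ell, hN]; exact_mod_cast hE
  have hpos : 0 < ell E := by nlinarith
  obtain ⟨f, hf, hf0⟩ := exists_ne_zero_of_ell_pos hpos
  have h1 := ell_le_of_ne_bot hf hf0
  have h2 : divDeg (∑ P ∈ S, Finsupp.single P (2 : ℤ)) = 2 * r := by
    rw [divDeg_eq_sum _ (S := S) (fun Q hQ => by
      rw [Finsupp.mem_support_iff, hsingle] at hQ
      by_contra h
      rw [if_neg h] at hQ
      exact hQ rfl)]
    rw [Finset.sum_congr rfl fun Q hQ => (hsingle Q).trans (if_pos hQ)]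
    simp [r, mul_comm]
  rw [divDeg_sub, divDeg_add, divDeg_nsmul, divDeg_poleDivisor htK, h2, ← hN] at h1
  have h3 : (r : ℤ) = divDeg C + 2 := by
    rw [hcard]
    exact Int.toNat_of_nonneg (by have := divDeg_nonneg hC0; omega)
  nlinarith

theorem finite_ordDiff_ne {t : L} (ht : IsPBasis p t) {D : Derivation K L L} (hD : D t = 1) :
    {P : Place K L | P.ordDiff (KaehlerDifferential.D K L t) ≠ 0}.Finite := by
  refine ((finite_ordDiff_pos ht hD).union (finite_ord_ne (K := K) (x := t))).subset fun P hP => ?_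
  simp only [Set.mem_ofPred_eq, Set.mem_union] at *
  by_contra hcon
  push Not at hcon
  obtain ⟨π, hπ⟩ := P.exists_ord_eq_one
  have hDπ : D π ≠ 0 := (ht.of_ord_eq_one P hπ).derivation_ne_zero hD
  have h1 := Place.ge.derivation ht hπ (normDeriv_self hDπ) (y := t)
    ((P.ge_ord t).mono hcon.2.ge)
  rw [normDeriv_apply, hD] at h1
  have h2 := h1.le_ord (one_div_ne_zero hDπ)
  rw [one_div, P.ord_inv, ← P.ordDiff_eq ht hD hπ] at h2
  omega

/-- The canonical divisor `div(dt)`. -/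
def diffDivisor {t : L} (ht : IsPBasis p t) {D : Derivation K L L} (hD : D t = 1) :
    Place K L →₀ ℤ :=
  Finsupp.ofSupportFinite (fun P => P.ordDiff (KaehlerDifferential.D K L t))
    (finite_ordDiff_ne ht hD)

theorem diffDivisor_apply {t : L} (ht : IsPBasis p t) {D : Derivation K L L} (hD : D t = 1)
    (P : Place K L) : diffDivisor ht hD P = P.ordDiff (KaehlerDifferential.D K L t) := rfl

end DiffSupport

section Jacobson

variable {K L : Type*} [Field K] [Field L] [Algebra K L]

/-- The connection `D + h`. -/
def conn (D : Derivation K L L) (h : L) : Module.End K L := D.toLinearMap + LinearMap.mulLeft K h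

@[simp] theorem conn_apply (D : Derivation K L L) (h y : L) : conn D h y = D y + h * y := rfl

theorem conn_zero (D : Derivation K L L) : conn D 0 = (D.toLinearMap : Module.End K L) := by
  ext y; simp

theorem natCast_end_eq_zero {p : ℕ} [CharP L p] (V : Type*) [AddCommGroup V] [Module K V] :
    ((p : ℕ) : Module.End K V) = 0 := by
  have h : (p : K) = 0 := by
    apply (algebraMap K L).injective
    rw [map_natCast, map_zero, CharP.cast_eq_zero]
  rw [← map_natCast (algebraMap K (Module.End K V)), h, map_zero]

variable {p : ℕ} [Fact p.Prime] [CharP L p]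

open TensorProduct in
/-- The `p`-th power of a connection on a tensor product of rank-one connections. -/
theorem conn_add_pow_char (D : Derivation K L L) (h k a b : L) :
    (conn D (h + k) ^ p) (a * b) = (conn D k ^ p) a * b + a * (conn D h ^ p) b := by
  let A : Module.End K (L ⊗[K] L) := TensorProduct.map (conn D k) LinearMap.id
  let B : Module.End K (L ⊗[K] L) := TensorProduct.map LinearMap.id (conn D h)
  have hAB : Commute A B := by
    refine TensorProduct.ext' fun x y => ?_
    simp [A, B]
  have hm : ∀ n : ℕ, ∀ w : L ⊗[K] L,
      LinearMap.mul' K L (((A + B) ^ n) w) = (conn D (h + k) ^ n) (LinearMap.mul' K L w) := by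
    intro n
    induction n with
    | zero => intro w; simp
    | succ n ih =>
      intro w
      rw [pow_succ', pow_succ', Module.End.mul_apply, Module.End.mul_apply, ← ih]
      generalize ((A + B) ^ n) w = w'
      induction w' using TensorProduct.induction_on with
      | zero => simp
      | tmul x y =>
        simp [A, B]
        ring
      | add x y hx hy => rw [map_add, map_add, hx, hy, map_add, map_add]
  have hpow : (A + B) ^ p = A ^ p + B ^ p := by
    obtain ⟨r, hr⟩ := hAB.exists_add_pow_prime_eq (Fact.out : p.Prime)
    rw [hr, natCast_end_eq_zero (L := L)]
    simp
  have h1 := hm p (a ⊗ₜ b)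
  rw [hpow, LinearMap.add_apply, TensorProduct.map_pow, TensorProduct.map_pow] at h1
  rw [map_add, LinearMap.mul'_apply, TensorProduct.map_tmul, TensorProduct.map_tmul,
    LinearMap.mul'_apply, LinearMap.mul'_apply] at h1
  rw [← h1]
  simp [← Module.End.one_eq_id]

/-- The coefficient of `λ ^ d` in `(D + λ h) ^ n (1)`. -/
def connCoeff (D : Derivation K L L) (h : L) : ℕ → ℕ → L
  | 0, 0 => 1
  | 0, _ + 1 => 0
  | n + 1, 0 => D (connCoeff D h n 0)
  | n + 1, d + 1 => D (connCoeff D h n (d + 1)) + h * connCoeff D h n d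

theorem connCoeff_eq_zero (D : Derivation K L L) (h : L) :
    ∀ n d : ℕ, n < d → connCoeff D h n d = 0
  | 0, 0, hd => absurd hd (lt_irrefl _)
  | 0, _ + 1, _ => rfl
  | _ + 1, 0, hd => absurd hd (Nat.not_lt_zero _)
  | n + 1, d + 1, hd => by
    rw [connCoeff, connCoeff_eq_zero D h n (d + 1) (by omega),
      connCoeff_eq_zero D h n d (by omega), map_zero, mul_zero, add_zero]

theorem connCoeff_self (D : Derivation K L L) (h : L) (n : ℕ) : connCoeff D h n n = h ^ n := by
  induction n with
  | zero => rw [pow_zero, connCoeff]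
  | succ n ih =>
    rw [connCoeff, connCoeff_eq_zero D h n (n + 1) (by omega), ih, map_zero, zero_add, pow_succ']

theorem connCoeff_zero (D : Derivation K L L) (h : L) (n : ℕ) : connCoeff D h (n + 1) 0 = 0 := by
  induction n with
  | zero => rw [connCoeff, connCoeff, Derivation.map_one_eq_zero]
  | succ n ih => rw [connCoeff, ih, map_zero]

theorem connCoeff_one (D : Derivation K L L) (h : L) (n : ℕ) :
    connCoeff D h (n + 1) 1 = (D.toLinearMap ^ n : Module.End K L) h := by
  induction n with
  | zero => simp [connCoeff]
  | succ n ih =>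
    rw [connCoeff, ih, connCoeff_zero, mul_zero, add_zero, pow_succ', Module.End.mul_apply]
    rfl

theorem conn_smul_pow_one (D : Derivation K L L) (h : L) (a : K) (n : ℕ) :
    (conn D (a • h) ^ n) 1 = ∑ d ∈ Finset.range (n + 1), a ^ d • connCoeff D h n d := by
  induction n with
  | zero => simp [connCoeff]
  | succ n ih =>
    rw [pow_succ', Module.End.mul_apply, ih, conn_apply, map_sum, Finset.mul_sum,
      Finset.sum_range_succ' _ (n + 1), Finset.sum_range_succ' (fun d => D _) n]
    have h1 : ∀ d, a ^ (d + 1) • connCoeff D h (n + 1) (d + 1) =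
        D (a ^ (d + 1) • connCoeff D h n (d + 1)) + (a • h) * (a ^ d • connCoeff D h n d) := by
      intro d
      rw [connCoeff, Derivation.map_smul, smul_add, smul_mul_smul_comm, ← pow_succ']
    rw [Finset.sum_congr rfl fun d _ => h1 d, Finset.sum_add_distrib,
      Finset.sum_range_succ (fun d => D _) n, connCoeff_eq_zero D h n (n + 1) (by omega),
      smul_zero, map_zero, connCoeff, pow_zero, one_smul, one_smul]
    ring

open Polynomial in
/-- A polynomial that is additive on an infinite subfield has vanishing derivative apart from its
constant term. -/
theorem coeff_eq_zero_of_additive [Infinite K] (Q : L[X])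
    (hQ : ∀ a b : K, Q.eval (algebraMap K L (a + b)) =
      Q.eval (algebraMap K L a) + Q.eval (algebraMap K L b)) (d : ℕ) (hd : 2 ≤ d) :
    (d : L) * Q.coeff d = 0 := by
  have hinf : (Set.range (algebraMap K L)).Infinite :=
    Set.infinite_range_of_injective (algebraMap K L).injective
  have h1 : ∀ b : K, Q.comp (X + C (algebraMap K L b)) = Q + C (Q.eval (algebraMap K L b)) := by
    intro b
    refine eq_of_infinite_eval_eq _ _ (hinf.mono ?_)
    rintro _ ⟨a, rfl⟩
    simpa using hQ a b
  have h2 : derivative Q = C ((derivative Q).eval 0) := by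
    refine eq_of_infinite_eval_eq _ _ (hinf.mono ?_)
    rintro _ ⟨b, rfl⟩
    have h3 := congrArg (fun R => (derivative R).eval 0) (h1 b)
    simpa [derivative_comp] using h3
  have h4 := congrArg (fun R => R.coeff (d - 1)) h2
  simp only [coeff_derivative, coeff_C, if_neg (show d - 1 ≠ 0 by omega)] at h4
  have h5 : ((d - 1 : ℕ) : L) + 1 = d := by
    rw [Nat.cast_sub (by omega)]; simp
  rwa [Nat.sub_add_cancel (by omega), h5, mul_comm] at h4

/-- Jacobson's formula for `(D + h) ^ p`. -/
theorem conn_pow_char [Infinite K] (D : Derivation K L L) (h y : L) :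
    (conn D h ^ p) y = (D.toLinearMap ^ p : Module.End K L) y +
      ((D.toLinearMap ^ (p - 1) : Module.End K L) h + h ^ p) * y := by
  have hp : p.Prime := Fact.out
  have h1 : (conn D h ^ p) y = (conn D h ^ p) 1 * y + (D.toLinearMap ^ p : Module.End K L) y := by
    have := conn_add_pow_char (p := p) D 0 h 1 y
    rwa [zero_add, one_mul, one_mul, conn_zero] at this
  have h2 : (conn D h ^ p) 1 = (D.toLinearMap ^ (p - 1) : Module.End K L) h + h ^ p := by
    let Q : Polynomial L := ∑ d ∈ Finset.range (p + 1),
      Polynomial.C (connCoeff D h p d) * Polynomial.X ^ d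
    have hQe : ∀ a : K, Q.eval (algebraMap K L a) = (conn D (a • h) ^ p) 1 := by
      intro a
      rw [conn_smul_pow_one, Polynomial.eval_finsetSum]
      refine Finset.sum_congr rfl fun d _ => ?_
      rw [Polynomial.eval_mul, Polynomial.eval_C, Polynomial.eval_pow, Polynomial.eval_X,
        Algebra.smul_def, map_pow, mul_comm]
    have hQc : ∀ d, d ≤ p → Q.coeff d = connCoeff D h p d := by
      intro d hd
      rw [Polynomial.finsetSum_coeff, Finset.sum_eq_single d]
      · simp
      · intro b _ hb
        rw [Polynomial.coeff_C_mul, Polynomial.coeff_X_pow, if_neg hb.symm, mul_zero]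
      · intro hnd
        exact absurd (Finset.mem_range.2 (by omega)) hnd
    have hadd : ∀ a b : K, Q.eval (algebraMap K L (a + b)) =
        Q.eval (algebraMap K L a) + Q.eval (algebraMap K L b) := by
      intro a b
      have := conn_add_pow_char (p := p) D (b • h) (a • h) 1 1
      rw [mul_one, mul_one, one_mul] at this
      rw [hQe, hQe, hQe, add_smul, add_comm (a • h), this]
    have hzero : ∀ d, 2 ≤ d → d < p → connCoeff D h p d = 0 := by
      intro d hd hdp
      have h3 := coeff_eq_zero_of_additive Q hadd d hd
      rw [hQc d hdp.le] at h3
      refine (mul_eq_zero.1 h3).resolve_left fun h4 => ?_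
      rw [CharP.cast_eq_zero_iff L p] at h4
      exact absurd (Nat.le_of_dvd (by omega) h4) (by omega)
    have h4 := conn_smul_pow_one D h (1 : K) p
    rw [one_smul] at h4
    rw [h4, Finset.sum_range_succ, one_pow, one_smul, connCoeff_self]
    congr 1
    obtain ⟨m, rfl⟩ : ∃ m, p = m + 1 := ⟨p - 1, by have := hp.pos; omega⟩
    rw [Finset.sum_eq_single 1, one_pow, one_smul, connCoeff_one, Nat.add_sub_cancel]
    · intro d hd hd1
      rw [one_pow, one_smul]
      rcases Nat.lt_or_ge d 2 with h5 | h5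
      · have : d = 0 := by omega
        rw [this, connCoeff_zero]
      · exact hzero d h5 (Finset.mem_range.1 hd)
    · intro h5
      have := hp.two_le
      exact absurd (Finset.mem_range.2 (by omega)) h5
  rw [h1, h2, add_comm]

/-- Logarithmic derivatives satisfy `D ^ (p - 1) h = - h ^ p`. -/
theorem logDeriv_pow_char [Infinite K] {D : Derivation K L L}
    (hD : (D.toLinearMap ^ p : Module.End K L) = 0) {y : L} (hy : y ≠ 0) :
    (D.toLinearMap ^ (p - 1) : Module.End K L) (D y / y) = -(D y / y) ^ p := by
  have h1 : ∀ n : ℕ, ∀ g : L,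
      (conn D (D y / y) ^ n) g = y⁻¹ * (D.toLinearMap ^ n : Module.End K L) (y * g) := by
    intro n
    induction n with
    | zero => intro g; simp [hy]
    | succ n ih =>
      intro g
      rw [pow_succ, Module.End.mul_apply, ih, pow_succ, Module.End.mul_apply]
      congr 2
      rw [conn_apply]
      change y * (D g + D y / y * g) = D (y * g)
      rw [Derivation.leibniz, smul_eq_mul, smul_eq_mul]
      field_simp
  have h2 := h1 p 1
  rw [conn_pow_char, hD] at h2
  simp at h2
  exact eq_neg_of_add_eq_zero_left h2

/-- A function `h` with `D ^ (p - 1) h = - h ^ p` is a logarithmic derivative. -/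
theorem exists_logDeriv [Infinite K] {D : Derivation K L L}
    (hD : (D.toLinearMap ^ p : Module.End K L) = 0) {h : L}
    (hh : (D.toLinearMap ^ (p - 1) : Module.End K L) h = -h ^ p) :
    ∃ f : L, f ≠ 0 ∧ D f = h * f := by
  classical
  have hex : ∃ n : ℕ, (conn D (-h) ^ n) 1 = 0 := by
    refine ⟨p, ?_⟩
    rw [conn_pow_char, hD, map_neg, hh]
    have : (-h) ^ p = -h ^ p := by
      have := map_neg (frobenius L p) h
      simpa [frobenius_def] using this
    rw [this]
    simp
  rcases hn : Nat.find hex with _ | n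
  · have := Nat.find_spec hex
    rw [hn] at this
    simp at this
  · have h1 := Nat.find_spec hex
    rw [hn, pow_succ', Module.End.mul_apply, conn_apply] at h1
    refine ⟨_, Nat.find_min hex (m := n) (by omega), ?_⟩
    rw [neg_mul] at h1
    exact add_neg_eq_zero.1 h1

theorem derivation_pow_apply {D : Derivation K L L} {t : L} (hD : D t = 1) (z : L) (i n : ℕ) :
    (D.toLinearMap ^ n : Module.End K L) (z ^ p * t ^ i) =
      z ^ p * ((i.descFactorial n : L) * t ^ (i - n)) := by
  induction n with
  | zero => simp
  | succ n ih =>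
    rw [pow_succ', Module.End.mul_apply, ih]
    change D _ = _
    rw [Derivation.leibniz, derivation_pow_char (p := p) D z, smul_zero, add_zero,
      Derivation.leibniz, Derivation.map_natCast, smul_zero, add_zero, Derivation.leibniz_pow, hD,
      Nat.descFactorial_succ, ← Nat.cast_smul_eq_nsmul L]
    simp only [smul_eq_mul, mul_one, Nat.cast_mul, Nat.sub_sub]
    ring

theorem IsPBasis.derivation_pow_char_eq_zero {D : Derivation K L L} {t : L} (ht : IsPBasis p t)
    (hD : D t = 1) : (D.toLinearMap ^ p : Module.End K L) = 0 := by
  ext y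
  obtain ⟨z, rfl⟩ := ht y
  rw [map_sum]
  refine Finset.sum_eq_zero fun i hi => ?_
  rw [derivation_pow_apply hD, Nat.descFactorial_of_lt (Finset.mem_range.1 hi)]
  simp

theorem natCast_factorial_pred : (((p - 1).factorial : ℕ) : L) = -1 := by
  have h := ZMod.wilsons_lemma p
  have h2 := congrArg (ZMod.castHom (dvd_refl p) L) h
  rwa [map_natCast, map_neg, map_one] at h2

theorem derivation_pow_pred_sum {D : Derivation K L L} {t : L} (hD : D t = 1) (z : ℕ → L) :
    (D.toLinearMap ^ (p - 1) : Module.End K L) (∑ i ∈ Finset.range p, z i ^ p * t ^ i) =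
      -z (p - 1) ^ p := by
  have hp := (Fact.out : p.Prime).pos
  rw [map_sum, Finset.sum_eq_single (p - 1)]
  · rw [derivation_pow_apply hD, Nat.descFactorial_self, natCast_factorial_pred]
    simp
  · intro i hi hne
    have := Finset.mem_range.1 hi
    rw [derivation_pow_apply hD, Nat.descFactorial_of_lt (by omega)]
    simp
  · intro h
    exact absurd (Finset.mem_range.2 (by omega)) h

end Jacobson

section SemilinearSurjective

open Polynomial in
/-- If `C` is a `p⁻¹`-semilinear endomorphism of a finite-dimensional space over an algebraically
closed field, then `1 - C` is surjective. -/
theorem exists_sub_eq_of_semilinear {K V : Type*} [Field K] [IsAlgClosed K] {p : ℕ}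
    [Fact p.Prime] [CharP K p] [AddCommGroup V] [Module K V] [FiniteDimensional K V]
    (C : V →+ V) (hC : ∀ (a : K) (v : V), C (a ^ p • v) = a • C v) (v : V) :
    ∃ w : V, w - C w = v := by
  classical
  have hp := (Fact.out : p.Prime)
  obtain ⟨k, c, hc, hc0⟩ : ∃ (k : ℕ) (c : ℕ → K), ∑ i ∈ Finset.range (k + 1), c i • C^[i] v = 0 ∧
      ∃ i ∈ Finset.range (k + 1), c i ≠ 0 := by
    have hdep : ¬ LinearIndependent K fun i : Fin (Module.finrank K V + 1) => C^[(i : ℕ)] v :=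
      fun h => by
        have := h.fintype_card_le_finrank
        simp at this
    rw [Fintype.not_linearIndependent_iff] at hdep
    obtain ⟨g, hg, i, hi⟩ := hdep
    refine ⟨Module.finrank K V, fun i => if h : i < Module.finrank K V + 1 then g ⟨i, h⟩ else 0,
      ?_, i, Finset.mem_range.2 i.2, by beta_reduce; rwa [dif_pos i.2]⟩
    rw [← Fin.sum_univ_eq_sum_range (fun i => (if h : i < Module.finrank K V + 1 then g ⟨i, h⟩
      else 0) • C^[i] v), ← hg]
    exact Finset.sum_congr rfl fun i _ => by rw [dif_pos i.2]
  obtain ⟨s, hs⟩ : ∃ s : K, ∑ i ∈ Finset.range (k + 1), (c i * s) ^ p ^ i = 1 := by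
    let Q : K[X] := ∑ i ∈ Finset.range (k + 1), Polynomial.C (c i ^ p ^ i) * X ^ p ^ i
    have hQdeg : (Q - 1).degree ≠ 0 := by
      obtain ⟨i, hi, hci⟩ := hc0
      have hcoeff : (Q - 1).coeff (p ^ i) ≠ 0 := by
        rw [coeff_sub, finsetSum_coeff, Finset.sum_eq_single i]
        · have : p ^ i ≠ 0 := (pow_pos hp.pos i).ne'
          rw [coeff_C_mul, coeff_X_pow, if_pos rfl, mul_one, coeff_one, if_neg this, sub_zero]
          exact pow_ne_zero _ hci
        · intro j _ hj
          rw [coeff_C_mul, coeff_X_pow, if_neg, mul_zero]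
          exact fun h => hj (Nat.pow_right_injective hp.two_le h).symm
        · exact fun h => absurd hi h
      intro hdeg
      have h1 := le_degree_of_ne_zero hcoeff
      rw [hdeg] at h1
      have h2 : (p ^ i : ℕ) ≤ 0 := by exact_mod_cast h1
      exact absurd h2 (not_le.2 (pow_pos hp.pos i))
    obtain ⟨s, hs⟩ := IsAlgClosed.exists_root (Q - 1) hQdeg
    refine ⟨s, ?_⟩
    rw [IsRoot, eval_sub, eval_one, sub_eq_zero, eval_finsetSum] at hs
    rw [← hs]
    exact Finset.sum_congr rfl fun i _ => by simp [mul_pow]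
  choose ρ hρ using fun a : K => IsAlgClosed.exists_pow_nat_eq a hp.pos
  let b : ℕ → K := fun n => Nat.rec (1 - s * c 0) (fun i bi => ρ bi - s * c (i + 1)) n
  have hb0 : b 0 = 1 - s * c 0 := rfl
  have hbs : ∀ i, b (i + 1) = ρ (b i) - s * c (i + 1) := fun _ => rfl
  have hbpow : ∀ n, b n ^ p ^ n = 1 - ∑ i ∈ Finset.range (n + 1), (c i * s) ^ p ^ i := by
    intro n
    induction n with
    | zero => simp [hb0, mul_comm]
    | succ n ih =>
      rw [hbs, sub_pow_char_pow, pow_succ' p n, pow_mul, hρ, ih, Finset.sum_range_succ _ (n + 1),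
        pow_succ' p n, mul_comm s]
      ring
  have hbk : b k = 0 := by
    have := hbpow k
    rw [hs, sub_self] at this
    exact pow_eq_zero_iff (pow_pos hp.pos k).ne' |>.1 this
  refine ⟨∑ i ∈ Finset.range k, b i • C^[i] v, ?_⟩
  have hCw : C (∑ i ∈ Finset.range k, b i • C^[i] v) =
      ∑ i ∈ Finset.range k, (b (i + 1) • C^[i + 1] v + (s * c (i + 1)) • C^[i + 1] v) := by
    rw [map_sum]
    refine Finset.sum_congr rfl fun i _ => ?_
    rw [← add_smul, hbs, sub_add_cancel, Function.iterate_succ_apply', ← hC, hρ]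
  have h1 : ∑ i ∈ Finset.range k, b (i + 1) • C^[i + 1] v + b 0 • v =
      ∑ i ∈ Finset.range k, b i • C^[i] v := by
    have h2 := Finset.sum_range_succ (fun i => b i • C^[i] v) k
    have h3 := Finset.sum_range_succ' (fun i => b i • C^[i] v) k
    rw [hbk, zero_smul, add_zero] at h2
    rw [← h2, h3]
    rfl
  have h4 : ∑ i ∈ Finset.range k, (s * c (i + 1)) • C^[i + 1] v + (s * c 0) • v = 0 := by
    have h5 := Finset.sum_range_succ' (fun i => c i • C^[i] v) k
    rw [hc] at h5
    have h6 := congrArg (fun w => s • w) h5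
    simp only [smul_zero, smul_add, Finset.smul_sum, smul_smul] at h6
    exact h6.symm
  rw [hCw, Finset.sum_add_distrib, ← h1]
  have h7 : b 0 • v = v - (s * c 0) • v := by rw [hb0, sub_smul, one_smul]
  rw [h7, eq_neg_of_add_eq_zero_left h4]
  abel

end SemilinearSurjective

section Cartier

variable {K L : Type*} [Field K] [Field L] [Algebra K L]
variable (p : ℕ) [Fact p.Prime] [CharP L p]

/-- The Cartier operator `h dt ↦ cartier h dt`, where `D = d/dt`. -/
def cartier (D : Derivation K L L) (h : L) : L :=
  open Classical in
  if ex : ∃ c : L, c ^ p = -(D.toLinearMap ^ (p - 1) : Module.End K L) h then ex.choose else 0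

variable {p}

theorem cartier_eq {D : Derivation K L L} {h c : L}
    (hc : c ^ p = -(D.toLinearMap ^ (p - 1) : Module.End K L) h) : cartier p D h = c := by
  have ex : ∃ c : L, c ^ p = -(D.toLinearMap ^ (p - 1) : Module.End K L) h := ⟨c, hc⟩
  rw [cartier, dif_pos ex]
  exact frobenius_inj L p (ex.choose_spec.trans hc.symm)

variable {D : Derivation K L L} {t : L}

theorem cartier_pow (ht : IsPBasis p t) (hD : D t = 1) (h : L) :
    cartier p D h ^ p = -(D.toLinearMap ^ (p - 1) : Module.End K L) h := by
  have ex : ∃ c : L, c ^ p = -(D.toLinearMap ^ (p - 1) : Module.End K L) h := by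
    obtain ⟨z, rfl⟩ := ht h
    exact ⟨z (p - 1), by rw [derivation_pow_pred_sum hD, neg_neg]⟩
  rw [cartier, dif_pos ex]
  exact ex.choose_spec

theorem cartier_add (ht : IsPBasis p t) (hD : D t = 1) (g h : L) :
    cartier p D (g + h) = cartier p D g + cartier p D h := by
  refine cartier_eq ?_
  rw [add_pow_char, cartier_pow ht hD, cartier_pow ht hD, map_add, neg_add]

theorem derivation_pow_pow_char_mul (D : Derivation K L L) (a h : L) (n : ℕ) :
    (D.toLinearMap ^ n : Module.End K L) (a ^ p * h) =
      a ^ p * (D.toLinearMap ^ n : Module.End K L) h := by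
  induction n with
  | zero => simp
  | succ n ih =>
    rw [pow_succ', Module.End.mul_apply, ih, Module.End.mul_apply]
    change D _ = _ * D _
    rw [Derivation.leibniz, derivation_pow_char (p := p) D a, smul_zero, add_zero, smul_eq_mul]

theorem cartier_pow_mul (ht : IsPBasis p t) (hD : D t = 1) (a h : L) :
    cartier p D (a ^ p * h) = a * cartier p D h := by
  refine cartier_eq ?_
  rw [mul_pow, cartier_pow ht hD, derivation_pow_pow_char_mul, mul_neg]

theorem derivation_pow_pred_pow_mul [Infinite K] (ht : IsPBasis p t) (hD : D t = 1) {π : L}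
    (hπ : π ≠ 0) {i : ℕ} (hi : i < p) :
    (D.toLinearMap ^ (p - 1) : Module.End K L) (π ^ i * D π) =
      if i = p - 1 then -(D π) ^ p else 0 := by
  have hp := (Fact.out : p.Prime).pos
  have hDp := ht.derivation_pow_char_eq_zero hD
  split_ifs with h
  · have h1 : π ^ i * D π = π ^ p * (D π / π) := by
      obtain ⟨m, rfl⟩ : ∃ m, p = m + 1 := ⟨p - 1, by omega⟩
      rw [h, Nat.add_sub_cancel, pow_succ]
      field_simp
    rw [h1, derivation_pow_pow_char_mul, logDeriv_pow_char hDp hπ, div_pow, mul_neg,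
      mul_div_cancel₀ _ (pow_ne_zero _ hπ)]
  · have hne : ((i + 1 : ℕ) : L) ≠ 0 := fun h0 => by
      rw [CharP.cast_eq_zero_iff L p] at h0
      have := Nat.le_of_dvd (by omega) h0
      omega
    have h1 : ((i + 1 : ℕ) : L) * (D.toLinearMap ^ (p - 1) : Module.End K L) (π ^ i * D π) = 0 := by
      rw [← nsmul_eq_mul, ← map_nsmul]
      have h2 : (i + 1) • (π ^ i * D π) = D (π ^ (i + 1)) := by
        rw [Derivation.leibniz_pow, Nat.add_sub_cancel, smul_eq_mul]
      rw [h2]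
      have h3 : (D.toLinearMap ^ (p - 1) : Module.End K L) (D (π ^ (i + 1))) =
          (D.toLinearMap ^ (p - 1 + 1) : Module.End K L) (π ^ (i + 1)) := by
        rw [pow_succ (D.toLinearMap : Module.End K L) (p - 1), Module.End.mul_apply]; rfl
      rw [h3, Nat.sub_add_cancel hp, hDp, LinearMap.zero_apply]
    exact (mul_eq_zero.1 h1).resolve_left hne

/-- The Cartier operator in terms of a local parameter `π`. -/
theorem cartier_local [Infinite K] (ht : IsPBasis p t) (hD : D t = 1) {π : L} (hπ : π ≠ 0)
    (z : ℕ → L) :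
    cartier p D ((∑ i ∈ Finset.range p, z i ^ p * π ^ i) * D π) = z (p - 1) * D π := by
  have hp := (Fact.out : p.Prime).pos
  refine cartier_eq ?_
  rw [Finset.sum_mul, map_sum, Finset.sum_eq_single (p - 1)]
  · rw [mul_assoc, derivation_pow_pow_char_mul, derivation_pow_pred_pow_mul ht hD hπ (by omega),
      if_pos rfl]
    ring
  · intro i hi hne
    rw [mul_assoc, derivation_pow_pow_char_mul,
      derivation_pow_pred_pow_mul ht hD hπ (Finset.mem_range.1 hi), if_neg hne, mul_zero]
  · intro h
    exact absurd (Finset.mem_range.2 (by omega)) h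

end Cartier

section Residue

variable {K L : Type*} [Field K] [Field L] [Algebra K L] [IsAlgClosed K] [IsCurveField K L]
variable {p : ℕ} [Fact p.Prime] [CharP L p]

/-- A chosen local parameter. -/
def Place.unif (P : Place K L) : L := P.exists_ord_eq_one.choose

theorem Place.ord_unif (P : Place K L) : P.ord P.unif = 1 := P.exists_ord_eq_one.choose_spec

theorem Place.unif_ne_zero (P : Place K L) : P.unif ≠ 0 :=
  P.ne_zero_of_ord_ne (by rw [P.ord_unif]; omega)

/-- The residue at `P` of `h dt`, for differentials with at most a simple pole at `P`, where
`D = d/dt`. -/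
def Place.residue (P : Place K L) (D : Derivation K L L) (h : L) : K :=
  P.eval (P.unif * (h / D P.unif))

variable {t : L} {D : Derivation K L L}

theorem Place.derivation_unif_ne_zero (P : Place K L) (ht : IsPBasis p t) (hD : D t = 1) :
    D P.unif ≠ 0 :=
  (ht.of_ord_eq_one P P.ord_unif).derivation_ne_zero hD

theorem Place.ge_cartier (P : Place K L) (ht : IsPBasis p t) (hD : D t = 1) {h : L} {n : ℤ}
    (hn : n = 0 ∨ n = -1) (hh : P.ge n (h / D P.unif)) :
    P.ge n (cartier p D h / D P.unif) := by
  have hp := (Fact.out : p.Prime).two_le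
  have hK : Infinite K := IsAlgClosed.instInfinite
  have hDu := P.derivation_unif_ne_zero ht hD
  obtain ⟨z, hz⟩ := ht.of_ord_eq_one P P.ord_unif (h / D P.unif)
  rw [eq_comm, eq_div_iff hDu] at hz
  rw [← hz, mul_div_cancel_right₀ _ hDu] at hh
  rw [← hz, cartier_local ht hD P.unif_ne_zero, mul_div_cancel_right₀ _ hDu]
  refine P.ge_coeff_of_ge_sum P.ord_unif z hh (by omega) ?_
  have h1 : ((p - 1 : ℕ) : ℤ) = p - 1 := by omega
  rw [h1]
  rcases hn with rfl | rfl <;> linarith [(by exact_mod_cast hp : (2 : ℤ) ≤ p)]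

theorem Place.ge_unif_mul (P : Place K L) {y : L} {n : ℤ} (h : P.ge n y) :
    P.ge (n + 1) (P.unif * y) := by
  have := (P.ge_ord P.unif).mul h
  rwa [P.ord_unif, add_comm] at this

theorem Place.residue_cartier (P : Place K L) (ht : IsPBasis p t) (hD : D t = 1) {h : L}
    (hh : P.ge (-1) (h / D P.unif)) :
    P.residue D (cartier p D h) ^ p = P.residue D h := by
  have hp := (Fact.out : p.Prime).two_le
  have hK : Infinite K := IsAlgClosed.instInfinite
  have hDu := P.derivation_unif_ne_zero ht hD
  have hc := P.ge_cartier ht hD (Or.inr rfl) hh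
  obtain ⟨z, hz⟩ := ht.of_ord_eq_one P P.ord_unif (h / D P.unif)
  have hz' := hz
  rw [eq_comm, eq_div_iff hDu] at hz
  rw [residue, residue, ← eval_pow (by simpa using P.ge_unif_mul hc), hz', ← hz,
    cartier_local ht hD P.unif_ne_zero, mul_div_cancel_right₀ _ hDu]
  rw [hz'] at hh
  have h1 : P.unif * ∑ i ∈ Finset.range p, z i ^ p * P.unif ^ i =
      (P.unif * z (p - 1)) ^ p + P.unif * ∑ i ∈ Finset.range (p - 1), z i ^ p * P.unif ^ i := by
    obtain ⟨m, rfl⟩ : ∃ m, p = m + 1 := ⟨p - 1, by omega⟩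
    rw [Finset.sum_range_succ, Nat.add_sub_cancel]
    ring
  have h2 : P.ge 1 (P.unif * ∑ i ∈ Finset.range (p - 1), z i ^ p * P.unif ^ i) := by
    refine P.ge_unif_mul (n := 0) (ge.sum fun i hi => ?_)
    have hi' := Finset.mem_range.1 hi
    have hzi : P.ge 0 (z i) := P.ge_coeff_of_ge_sum P.ord_unif z hh (by omega) (by omega)
    exact ge.zero_mul (P.integers.pow_mem hzi p)
      (P.integers.pow_mem (show P.ge 0 _ from (P.ge_ord P.unif).mono (by rw [P.ord_unif]; omega)) i)
  have h3 : P.ge 0 ((P.unif * z (p - 1)) ^ p) := by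
    have h4 : P.ge (-1) (z (p - 1)) := by
      refine P.ge_coeff_of_ge_sum P.ord_unif z hh (by omega) ?_
      have h1 : ((p - 1 : ℕ) : ℤ) = p - 1 := by omega
      rw [h1]
      linarith [(by exact_mod_cast hp : (2 : ℤ) ≤ p)]
    exact P.integers.pow_mem (show P.ge 0 _ by simpa using P.ge_unif_mul h4) p
  rw [h1, eval_add h3 (h2.mono (by omega)), (eval_eq_zero_iff (h2.mono (by omega))).2 h2, add_zero]

/-- The reduced divisor of a finite set of places. -/
def pointDivisor (S : Finset (Place K L)) : Place K L →₀ ℤ := ∑ P ∈ S, Finsupp.single P 1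

open Classical in
theorem pointDivisor_apply (S : Finset (Place K L)) (Q : Place K L) :
    pointDivisor S Q = if Q ∈ S then 1 else 0 := by
  rw [pointDivisor, Finsupp.finsetSum_apply]
  simp only [Finsupp.single_apply]
  rw [Finset.sum_ite_eq']

theorem divDeg_pointDivisor (S : Finset (Place K L)) : divDeg (pointDivisor S) = S.card := by
  classical
  rw [divDeg_eq_sum _ (S := S) (fun Q hQ => by
    rw [Finsupp.mem_support_iff, pointDivisor_apply] at hQ
    by_contra h
    rw [if_neg h] at hQ
    exact hQ rfl)]
  rw [Finset.sum_congr rfl fun Q hQ => (pointDivisor_apply S Q).trans (if_pos hQ)]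
  simp

theorem Place.ge_div_derivation_iff (P : Place K L) (ht : IsPBasis p t) (hD : D t = 1) {h : L}
    {n : ℤ} : P.ge n (h / D P.unif) ↔ P.ge (n - diffDivisor ht hD P) h := by
  have hDu := P.derivation_unif_ne_zero ht hD
  by_cases hh : h = 0
  · simp [hh]
  · rw [P.ge_iff_le_ord hh, P.ge_iff_le_ord (div_ne_zero hh hDu), P.ord_div hh hDu,
      diffDivisor_apply, P.ordDiff_eq ht hD P.ord_unif]
    omega

theorem mem_riemannRochSpace_diff (ht : IsPBasis p t) (hD : D t = 1) {E : Place K L →₀ ℤ} {h : L} :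
    h ∈ riemannRochSpace (diffDivisor ht hD + E) ↔ ∀ P : Place K L, P.ge (-E P) (h / D P.unif) := by
  rw [mem_riemannRochSpace]
  refine forall_congr' fun P => ?_
  rw [P.ge_div_derivation_iff ht hD, Finsupp.add_apply, neg_add, sub_eq_add_neg, add_comm]

theorem charP_base (K : Type*) {L : Type*} [Field K] [Field L] [Algebra K L] (p : ℕ) [CharP L p] :
    CharP K p :=
  (algebraMap K L).charP (algebraMap K L).injective p

/-- The sum of the residues at the points of `S`, for differentials with at most simple poles, all
of them in `S`. -/
def residueSum (ht : IsPBasis p t) (hD : D t = 1) (S : Finset (Place K L)) :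
    riemannRochSpace (diffDivisor ht hD + pointDivisor S) →ₗ[K] K :=
  have hge : ∀ h ∈ riemannRochSpace (diffDivisor ht hD + pointDivisor S), ∀ P ∈ S,
      P.ge 0 (P.unif * (h / D P.unif)) := fun h hh P hP => by
    have := P.ge_unif_mul ((mem_riemannRochSpace_diff ht hD).1 hh P)
    rw [pointDivisor_apply, if_pos hP] at this
    simpa using this
  { toFun := fun h => ∑ P ∈ S, P.residue D h.1
    map_add' := fun g h => by
      rw [← Finset.sum_add_distrib]
      refine Finset.sum_congr rfl fun P hP => ?_
      rw [Place.residue, Submodule.coe_add, add_div, mul_add,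
        Place.eval_add (hge _ g.2 P hP) (hge _ h.2 P hP)]
      rfl
    map_smul' := fun c h => by
      rw [RingHom.id_apply, smul_eq_mul, Finset.mul_sum]
      refine Finset.sum_congr rfl fun P hP => ?_
      rw [Place.residue, Submodule.coe_smul, smul_div_assoc, mul_smul_comm,
        Place.eval_smul (hge _ h.2 P hP)]
      rfl }

theorem residueSum_apply (ht : IsPBasis p t) (hD : D t = 1) (S : Finset (Place K L))
    (h : riemannRochSpace (diffDivisor ht hD + pointDivisor S)) :
    residueSum ht hD S h = ∑ P ∈ S, P.residue D (h : L) := rfl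

theorem cartier_mem (ht : IsPBasis p t) (hD : D t = 1) (S : Finset (Place K L)) {h : L}
    (hh : h ∈ riemannRochSpace (diffDivisor ht hD + pointDivisor S)) :
    cartier p D h ∈ riemannRochSpace (diffDivisor ht hD + pointDivisor S) := by
  classical
  rw [mem_riemannRochSpace_diff] at *
  intro P
  refine P.ge_cartier ht hD ?_ (hh P)
  rw [pointDivisor_apply]
  split_ifs <;> simp

/-- The residue theorem for logarithmic differentials. -/
theorem sum_residue_logDeriv (ht : IsPBasis p t) (hD : D t = 1) (S : Finset (Place K L)) {f : L}
    (hf : f ≠ 0) (hS : ∀ P ∉ S, P.ge 0 (D f / f / D P.unif)) :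
    ∑ P ∈ S, P.residue D (D f / f) = 0 := by
  classical
  have hres : ∀ P : Place K L, P.residue D (D f / f) = (P.ord f : K) := by
    intro P
    have hDu := P.derivation_unif_ne_zero ht hD
    refine Place.eval_eq ?_
    have := Place.ge_logDeriv ht P.ord_unif (normDeriv_self hDu) hf
    rw [normDeriv_apply] at this
    rwa [map_intCast, div_right_comm]
  have hout : ∀ P ∉ S, (P.ord f : K) = 0 := by
    intro P hP
    have h1 := P.ge_unif_mul (hS P hP)
    rw [← hres P, Place.residue]
    exact (Place.eval_eq_zero_iff (h1.mono (by omega))).2 h1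
  rw [Finset.sum_congr rfl fun P _ => hres P]
  have h2 : divDeg (divisor f : Place K L →₀ ℤ) =
      ∑ P ∈ S ∪ (divisor f : Place K L →₀ ℤ).support, P.ord f :=
    divDeg_eq_sum _ Finset.subset_union_right
  have h3 : ∑ P ∈ S, (P.ord f : K) =
      ∑ P ∈ S ∪ (divisor f : Place K L →₀ ℤ).support, (P.ord f : K) :=
    Finset.sum_subset Finset.subset_union_left fun P _ hP => hout P hP
  rw [h3, ← Int.cast_sum, ← h2, divDeg_divisor, Int.cast_zero]

/-- The residue theorem for differentials with at most simple poles. -/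
theorem residueSum_eq_zero (ht : IsPBasis p t) (hD : D t = 1) (S : Finset (Place K L))
    (h : riemannRochSpace (diffDivisor ht hD + pointDivisor S)) : residueSum ht hD S h = 0 := by
  classical
  have hK : Infinite K := IsAlgClosed.instInfinite
  have hcharK : CharP K p := charP_base K (L := L) p
  let V := riemannRochSpace (diffDivisor ht hD + pointDivisor S)
  set lam : V →ₗ[K] K := residueSum ht hD S with hlam
  let C : V →+ V :=
    { toFun := fun h => ⟨cartier p D h.1, cartier_mem ht hD S h.2⟩
      map_zero' := by
        refine Subtype.ext (cartier_eq ?_)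
        simp [(Fact.out : p.Prime).ne_zero]
      map_add' := fun g h => Subtype.ext (cartier_add ht hD _ _) }
  have hCs : ∀ (a : K) (v : V), C (a ^ p • v) = a • C v := fun a v => by
    refine Subtype.ext ?_
    change cartier p D (a ^ p • (v : L)) = a • cartier p D v
    rw [Algebra.smul_def, Algebra.smul_def, map_pow, cartier_pow_mul ht hD]
  have hlamC : ∀ v : V, lam (C v) ^ p = lam v := fun v => by
    rw [hlam, residueSum_apply, residueSum_apply, sum_pow_char p]
    refine Finset.sum_congr rfl fun P hP => P.residue_cartier ht hD ?_
    have := (mem_riemannRochSpace_diff ht hD).1 v.2 P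
    rwa [pointDivisor_apply, if_pos hP] at this
  by_contra hne
  set v : V := (lam h)⁻¹ • h with hv
  have hv1 : lam v = 1 := by rw [hv, map_smul, smul_eq_mul, inv_mul_cancel₀ hne]
  have hCv1 : lam (C v) = 1 := by
    have := hlamC v
    rw [hv1] at this
    exact frobenius_inj K p (by simpa [frobenius_def] using this)
  let C₀ : LinearMap.ker lam →+ LinearMap.ker lam :=
    { toFun := fun w => ⟨C w.1, by
        have h1 := hlamC w.1
        rw [LinearMap.mem_ker.1 w.2] at h1
        exact pow_eq_zero_iff (Fact.out : p.Prime).ne_zero |>.1 h1⟩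
      map_zero' := Subtype.ext (map_zero C)
      map_add' := fun a b => Subtype.ext (map_add C _ _) }
  obtain ⟨w, hw⟩ := exists_sub_eq_of_semilinear (p := p) C₀
    (fun a w => Subtype.ext (hCs a w.1))
    (⟨v - C v, by rw [LinearMap.mem_ker, map_sub, hv1, hCv1, sub_self]⟩ : LinearMap.ker lam)
  have hw' : w.1 - C w.1 = v - C v := congrArg Subtype.val hw
  set η : V := v - w.1 with hη
  have hη1 : lam η = 1 := by
    rw [hη, map_sub, hv1, LinearMap.mem_ker.1 w.2, sub_zero]
  have hfix : C η = η := by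
    rw [hη, map_sub]
    have : C v - C w.1 - (v - w.1) = (w.1 - C w.1) - (v - C v) := by abel
    rw [hw', sub_self] at this
    exact sub_eq_zero.1 this
  have hfix' : cartier p D (η : L) = η := congrArg Subtype.val hfix
  have hpow := cartier_pow ht hD (η : L)
  rw [hfix'] at hpow
  obtain ⟨f, hf0, hf⟩ := exists_logDeriv (ht.derivation_pow_char_eq_zero hD) (h := (η : L))
    (by rw [hpow, neg_neg])
  have hηf : (η : L) = D f / f := by rw [hf, mul_div_cancel_right₀ _ hf0]
  have hzero : lam η = 0 := by
    rw [hlam, residueSum_apply, hηf]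
    refine sum_residue_logDeriv ht hD S hf0 fun P hP => ?_
    have := (mem_riemannRochSpace_diff ht hD).1 η.2 P
    rwa [pointDivisor_apply, if_neg hP, neg_zero, hηf] at this
  rw [hη1] at hzero
  exact one_ne_zero hzero

/-- A differential with at most one pole, and that simple, is regular. -/
theorem ell_diff_add_point (ht : IsPBasis p t) (hD : D t = 1) (P : Place K L) :
    ell (diffDivisor ht hD + pointDivisor {P}) = ell (diffDivisor ht hD) := by
  classical
  have : riemannRochSpace (diffDivisor ht hD + pointDivisor {P}) =
      riemannRochSpace (diffDivisor ht hD) := by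
    apply le_antisymm
    · intro h hh
      have h1 := residueSum_eq_zero ht hD {P} ⟨h, hh⟩
      rw [residueSum_apply, Finset.sum_singleton] at h1
      have h2 := (mem_riemannRochSpace_diff ht hD).1 hh
      rw [← add_zero (diffDivisor ht hD), mem_riemannRochSpace_diff ht hD]
      intro Q
      have hQ := h2 Q
      rw [pointDivisor_apply] at hQ
      by_cases hQP : Q = P
      · subst hQP
        simp only [Finset.mem_singleton, if_true] at hQ
        have h3 := (Place.eval_eq_zero_iff (by simpa using Q.ge_unif_mul hQ)).1 h1
        have h4 := (Q.ge_ord Q.unif⁻¹).mul h3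
        rw [← mul_assoc, inv_mul_cancel₀ Q.unif_ne_zero, one_mul, Q.ord_inv, Q.ord_unif] at h4
        simpa using h4
      · rw [if_neg (by simpa using hQP)] at hQ
        simpa using hQ
    · refine riemannRochSpace_mono (le_add_of_nonneg_right fun Q => ?_)
      rw [pointDivisor_apply]
      split_ifs <;> simp
  rw [ell, ell, this]

theorem infinite_place : Infinite (Place K L) := by
  have hK : Infinite K := IsAlgClosed.instInfinite
  obtain ⟨x, hxK⟩ := IsCurveField.exists_notMem (K := K) (L := L)
  have hex : ∀ a : K, ∃ P : Place K L, 0 < P.ord (x - algebraMap K L a) := fun a =>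
    exists_place_ord_pos (by
      rintro ⟨c, hc⟩
      exact hxK ⟨c + a, by rw [map_add, hc, sub_add_cancel]⟩)
  choose P hP using hex
  refine Infinite.of_injective P fun a b hab => ?_
  have h1 : (P a).ge 1 (x - algebraMap K L a) := (Place.ge_ord _ _).mono (hP a)
  have h2 : (P a).ge 1 (x - algebraMap K L b) := by
    rw [hab]; exact (Place.ge_ord _ _).mono (hP b)
  rw [← Place.eval_eq h1, Place.eval_eq h2]

/-- A space of functions of dimension `n` is separated by `n` suitable points. -/
theorem exists_points (W : Place K L →₀ ℤ) :
    ∀ (n : ℕ) (V : Submodule K L), V ≤ riemannRochSpace W → Module.finrank K V = n →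
      ∀ T : Finset (Place K L), ∃ S : Finset (Place K L), S.card = n ∧ Disjoint S T ∧
        V ⊓ riemannRochSpace (W - pointDivisor S) = ⊥ := by
  classical
  intro n
  induction n with
  | zero =>
    intro V hV hn T
    have hfin : FiniteDimensional K V := Submodule.finiteDimensional_of_le hV
    refine ⟨∅, rfl, by simp, ?_⟩
    rw [Submodule.finrank_eq_zero.1 hn, bot_inf_eq]
  | succ n ih =>
    intro V hV hn T
    have hfin : FiniteDimensional K V := Submodule.finiteDimensional_of_le hV
    have hVne : V ≠ ⊥ := fun h => by rw [h, finrank_bot] at hn; omega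
    obtain ⟨f, hfV, hf0⟩ := Submodule.exists_mem_ne_zero_of_ne_bot hVne
    have hinf := infinite_place (K := K) (L := L)
    obtain ⟨P, hP⟩ := Infinite.exists_notMem_finset
      (T ∪ W.support ∪ (divisor f : Place K L →₀ ℤ).support)
    simp only [Finset.mem_union, Finsupp.mem_support_iff, not_or, not_not, divisor_apply] at hP
    let V' := V ⊓ riemannRochSpace (W - pointDivisor {P})
    have hV'V : V' ≤ V := inf_le_left
    have hfV' : f ∉ V' := fun h => by
      have := (mem_riemannRochSpace.1 h.2 P).le_ord hf0
      rw [Finsupp.sub_apply, pointDivisor_apply, if_pos (by simp), hP.1.2, hP.2] at this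
      omega
    have hlt : Module.finrank K V' < Module.finrank K V :=
      Submodule.finrank_lt_finrank_of_lt (lt_of_le_of_ne hV'V fun h => hfV' (h ▸ hfV))
    have hfin' : FiniteDimensional K V' := Submodule.finiteDimensional_of_le hV'V
    have hle := (finite_of_functional (V := V') (leadingCoeff P (-W P) V
      (fun g hg => mem_riemannRochSpace.1 (hV hg) P) P.ord_unif) (fun g hg => by
        refine ⟨g.2, mem_riemannRochSpace.2 fun Q => ?_⟩
        rw [Finsupp.sub_apply, pointDivisor_apply]
        split_ifs with hQ
        · rw [Finset.mem_singleton] at hQ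
          subst hQ
          exact (leadingCoeff_eq_zero hg).mono (by omega)
        · rw [sub_zero]
          exact mem_riemannRochSpace.1 (hV g.2) Q)).2
    obtain ⟨S, hS, hST, hSV⟩ := ih V' (hV'V.trans hV) (by omega) (insert P T)
    rw [Finset.disjoint_insert_right] at hST
    refine ⟨insert P S, by rw [Finset.card_insert_of_notMem hST.1, hS],
      Finset.disjoint_insert_left.2 ⟨hP.1.1, hST.2⟩, ?_⟩
    rw [eq_bot_iff, ← hSV]
    intro g hg
    refine ⟨⟨hg.1, ?_⟩, ?_⟩
    all_goals
      refine riemannRochSpace_mono (fun Q => ?_) hg.2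
      simp only [Finsupp.sub_apply, pointDivisor_apply, Finset.mem_insert, Finset.mem_singleton]
      by_cases h1 : Q = P
      · simp [h1, hST.1]
      · by_cases h2 : Q ∈ S <;> simp [h1, h2]

/-- Regular differentials: `ℓ(W) ≤ g`. -/
theorem ell_diffDivisor_le_genus (ht : IsPBasis p t) (hD : D t = 1) :
    ell (diffDivisor ht hD : Place K L →₀ ℤ) ≤ genus K L := by
  classical
  set W := (diffDivisor ht hD : Place K L →₀ ℤ) with hW
  obtain ⟨S, hS, -, hSV⟩ := exists_points W _ (riemannRochSpace W) le_rfl rfl ∅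
  rw [inf_eq_right.2 (riemannRochSpace_mono (sub_le_self _ fun Q => by
    rw [pointDivisor_apply]; split_ifs <;> simp))] at hSV
  have hreg : ∀ f ∈ riemannRochSpace W, ∀ P : Place K L, P.ge 0 (f / D P.unif) := fun f hf P => by
    rw [← add_zero W, hW, mem_riemannRochSpace_diff ht hD] at hf
    simpa using hf P
  let ev : riemannRochSpace W →ₗ[K] (S → K) :=
    { toFun := fun f P => P.1.eval (f.1 / D P.1.unif)
      map_add' := fun f g => by
        funext P
        rw [Submodule.coe_add, add_div, Place.eval_add (hreg _ f.2 _) (hreg _ g.2 _)]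
        rfl
      map_smul' := fun c f => by
        funext P
        rw [Submodule.coe_smul, smul_div_assoc, Place.eval_smul (hreg _ f.2 _)]
        rfl }
  have hinj : Function.Injective ev := by
    rw [← LinearMap.ker_eq_bot, LinearMap.ker_eq_bot']
    intro f hf
    have hmem : (f : L) ∈ riemannRochSpace (W - pointDivisor S) := by
      change (f : L) ∈ riemannRochSpace (diffDivisor ht hD - pointDivisor S)
      rw [sub_eq_add_neg, mem_riemannRochSpace_diff ht hD]
      intro P
      rw [Finsupp.neg_apply, neg_neg, pointDivisor_apply]
      split_ifs with hP
      · exact (Place.eval_eq_zero_iff (hreg _ f.2 P)).1 (congrFun hf ⟨P, hP⟩)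
      · exact hreg _ f.2 P
    rw [hSV, Submodule.mem_bot] at hmem
    exact Subtype.ext hmem
  have hsurj : Function.Surjective ev :=
    (LinearMap.injective_iff_surjective_of_finrank_eq_finrank (by simp [hS])).1 hinj
  have hD1 : riemannRochSpace (pointDivisor S) ≤ riemannRochSpace (0 : Place K L →₀ ℤ) := by
    intro h hh
    rw [mem_riemannRochSpace] at *
    intro P
    have hP := hh P
    rw [pointDivisor_apply] at hP
    split_ifs at hP with hPS
    swap
    · simpa using hP
    obtain ⟨ω, hω⟩ := hsurj (Pi.single ⟨P, hPS⟩ 1)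
    have hpole : ∀ Q ∈ S, Q.ge 0 (Q.unif * h) := fun Q hQ => by
      have := Q.ge_unif_mul (hh Q)
      rw [pointDivisor_apply, if_pos hQ] at this
      simpa using this
    have hmem : h * (ω : L) ∈ riemannRochSpace (diffDivisor ht hD + pointDivisor S) := by
      rw [mem_riemannRochSpace_diff ht hD]
      intro Q
      rw [mul_div_assoc]
      exact (hh Q).mul_zero (hreg _ ω.2 Q)
    have h1 := residueSum_eq_zero ht hD S ⟨_, hmem⟩
    rw [residueSum_apply] at h1
    have h2 : ∀ Q ∈ S, Q.residue D (h * (ω : L)) = if Q = P then P.eval (P.unif * h) else 0 := by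
      intro Q hQ
      rw [Place.residue, mul_div_assoc, ← mul_assoc,
        Place.eval_mul (hpole Q hQ) (hreg _ ω.2 Q)]
      have h3 : Q.eval ((ω : L) / D Q.unif) = (Pi.single ⟨P, hPS⟩ 1 : S → K) ⟨Q, hQ⟩ :=
        congrFun hω ⟨Q, hQ⟩
      rw [h3]
      by_cases hQP : Q = P
      · subst hQP; simp
      · rw [if_neg hQP, Pi.single_eq_of_ne (fun h => hQP (congrArg Subtype.val h)), mul_zero]
    rw [Finset.sum_congr rfl h2, Finset.sum_ite_eq' S P, if_pos hPS] at h1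
    have h3 := (Place.eval_eq_zero_iff (hpole P hPS)).1 h1
    have h4 := (P.ge_ord P.unif⁻¹).mul h3
    rw [← mul_assoc, inv_mul_cancel₀ P.unif_ne_zero, one_mul, P.ord_inv, P.ord_unif] at h4
    simpa using h4
  have hell : ell (pointDivisor S) ≤ 1 := by
    rw [← ell_zero (K := K) (L := L)]
    have := Submodule.finrank_mono hD1
    simpa [ell] using this
  have h5 := le_genus (pointDivisor S)
  rw [divDeg_pointDivisor, hS] at h5
  rw [ell]
  linarith

/-- The degree of a canonical divisor is at most `2 * g - 2`. -/
theorem divDeg_diffDivisor_le (ht : IsPBasis p t) (hD : D t = 1) :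
    divDeg (diffDivisor ht hD : Place K L →₀ ℤ) ≤ 2 * genus K L - 2 := by
  have hinf := infinite_place (K := K) (L := L)
  obtain ⟨P⟩ : Nonempty (Place K L) := inferInstance
  have h1 := le_genus (diffDivisor ht hD + pointDivisor {P})
  rw [ell_diff_add_point, divDeg_add, divDeg_pointDivisor, Finset.card_singleton] at h1
  have h2 := ell_diffDivisor_le_genus (K := K) ht hD
  push_cast at h1
  linarith

end Residue

open PowerSeries in
/-- `τ` is the Taylor expansion with respect to `t`. -/
structure IsTaylor {K L : Type*} [Field K] [Field L] [Algebra K L] (t : L)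
    (τ : L →ₐ[K] PowerSeries L) : Prop where
  const : ∀ g, constantCoeff (τ g) = g
  map_self : τ t = C t + X

section Existence

open IntermediateField

variable {K L : Type*} [Field K] [Field L] [Algebra K L]

theorem isUnit_of_constantCoeff_ne_zero {f : PowerSeries L} (h : PowerSeries.constantCoeff f ≠ 0) :
    IsUnit f := by
  rw [PowerSeries.isUnit_iff_constantCoeff]
  exact isUnit_iff_ne_zero.2 h

/-- The Taylor expansion of a rational function of `t`. -/
theorem exists_taylor_adjoin {t : L} (ht : Transcendental K t) :
    ∃ σ : K⟮t⟯ →ₐ[K] PowerSeries L, (∀ g, PowerSeries.constantCoeff (σ g) = g) ∧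
      σ (AdjoinSimple.gen K t) = PowerSeries.C t + PowerSeries.X := by
  let φ : Polynomial K →ₐ[K] PowerSeries L := Polynomial.aeval (PowerSeries.C t + PowerSeries.X)
  let ε : PowerSeries L →ₐ[K] L :=
    { (PowerSeries.constantCoeff : PowerSeries L →+* L) with
      commutes' := fun r => by
        rw [IsScalarTower.algebraMap_apply K L (PowerSeries L)]
        simp }
  have hε : ∀ g, ε g = PowerSeries.constantCoeff g := fun g => rfl
  have hφ : ∀ g : Polynomial K, ε (φ g) = Polynomial.aeval t g := by
    intro g
    rw [← Polynomial.aeval_algHom_apply]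
    congr 2
    simp [hε]
  have hu : ∀ y : nonZeroDivisors (Polynomial K), IsUnit (φ y) := fun y => by
    apply isUnit_of_constantCoeff_ne_zero
    rw [← hε, hφ]
    intro h0
    exact nonZeroDivisors.coe_ne_zero y ((transcendental_iff.1 ht) _ h0)
  let ψ : RatFunc K →ₐ[K] PowerSeries L := 
    IsLocalization.liftAlgHom (M := nonZeroDivisors (Polynomial K)) (f := φ) hu
  have hψ : ∀ g : Polynomial K, ψ (algebraMap _ _ g) = φ g := fun g => by
    change IsLocalization.lift hu _ = _
    rw [IsLocalization.lift_eq]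
    rfl
  let e := RatFunc.algEquivOfTranscendental t ht
  refine ⟨ψ.comp e.symm.toAlgHom, ?_, ?_⟩
  · have h1 : (ε.comp ψ) = (K⟮t⟯.val).comp e.toAlgHom := by
      apply IsLocalization.algHom_ext (nonZeroDivisors (Polynomial K))
      ext
      change ε (ψ (algebraMap (Polynomial K) _ Polynomial.X)) =
        (e (algebraMap (Polynomial K) _ Polynomial.X) : L)
      rw [hψ, hφ]
      simp [e]
    intro g
    have h2 := DFunLike.congr_fun h1 (e.symm g)
    simpa [hε] using h2
  · have : e.symm (AdjoinSimple.gen K t) = algebraMap (Polynomial K) _ Polynomial.X := by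
      simp [e]
    change ψ (e.symm _) = _
    rw [this, hψ]
    simp [φ]

/-- A finite separable extension lifts along a Henselian surjection. -/
theorem exists_section_of_henselian {F S : Type*} [Field F] [Algebra F L] [FiniteDimensional F L]
    [Algebra.IsSeparable F L] [CommRing S] [Algebra F S] (ε : S →ₐ[F] L)
    (hε : Function.Surjective ε) [HenselianRing S (RingHom.ker ε)]
    (hu : ∀ s, ε s ≠ 0 → IsUnit s) : ∃ τ : L →ₐ[F] S, ε.comp τ = AlgHom.id F L := by
  let B := Field.powerBasisOfFiniteOfSeparable F L
  let f := minpoly F B.gen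
  have hmon : f.Monic := minpoly.monic (Algebra.IsIntegral.isIntegral B.gen)
  obtain ⟨b, hb⟩ := hε B.gen
  obtain ⟨a, ha, ha'⟩ := HenselianRing.is_henselian (I := RingHom.ker ε)
    (f.map (algebraMap F S)) (hmon.map _) b
    (by
      rw [RingHom.mem_ker, Polynomial.eval_map_algebraMap, ← Polynomial.aeval_algHom_apply, hb]
      exact minpoly.aeval _ _)
    (by
      apply IsUnit.map
      apply hu
      rw [Polynomial.derivative_map, Polynomial.eval_map_algebraMap,
        ← Polynomial.aeval_algHom_apply, hb]
      exact (Algebra.IsSeparable.isSeparable F B.gen).aeval_derivative_ne_zero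
        (minpoly.aeval _ _))
  have ha1 : ε a = B.gen := by
    rw [RingHom.mem_ker, map_sub, hb, sub_eq_zero] at ha'
    exact ha'
  have ha2 : Polynomial.aeval a f = 0 := by
    rw [← Polynomial.eval_map_algebraMap]
    exact ha
  refine ⟨B.lift a ha2, B.algHom_ext ?_⟩
  rw [AlgHom.comp_apply, PowerBasis.lift_gen, ha1, AlgHom.id_apply]

theorem exists_taylor {t : L} (ht : Transcendental K t) [FiniteDimensional K⟮t⟯ L]
    [Algebra.IsSeparable K⟮t⟯ L] : ∃ τ : L →ₐ[K] PowerSeries L, IsTaylor t τ := by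
  obtain ⟨σ, hσ, hσt⟩ := exists_taylor_adjoin ht
  let A : Algebra K⟮t⟯ (PowerSeries L) := σ.toRingHom.toAlgebra
  let ε : @AlgHom K⟮t⟯ (PowerSeries L) L _ _ _ A _ :=
    @AlgHom.mk K⟮t⟯ (PowerSeries L) L _ _ _ A _ PowerSeries.constantCoeff hσ
  have hker : RingHom.ker ε = Ideal.span {(PowerSeries.X : PowerSeries L)} := by
    ext g
    rw [Ideal.mem_span_singleton, PowerSeries.X_dvd_iff]
    rfl
  have : HenselianRing (PowerSeries L) (RingHom.ker ε) := by
    rw [hker]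
    exact IsAdicComplete.henselianRing _ _
  obtain ⟨τ, hτ⟩ := @exists_section_of_henselian L _ K⟮t⟯ (PowerSeries L) _ _ _ _ _ A ε
    (fun y => ⟨PowerSeries.C y, PowerSeries.constantCoeff_C y⟩) this
    (fun s hs => isUnit_of_constantCoeff_ne_zero hs)
  have hc : ∀ g : K⟮t⟯, τ g = σ g := fun g =>
    @AlgHom.commutes K⟮t⟯ L (PowerSeries L) _ _ _ _ A τ g
  let τ' : L →ₐ[K] PowerSeries L :=
    { (τ : L →+* PowerSeries L) with
      commutes' := fun r => by
        have := hc (algebraMap K K⟮t⟯ r)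
        rw [AlgHom.commutes] at this
        exact this }
  refine ⟨τ', fun g => DFunLike.congr_fun hτ g, ?_⟩
  have h3 := hc (AdjoinSimple.gen K t)
  rw [hσt] at h3
  exact h3

variable {p : ℕ} [Fact p.Prime] [CharP L p]

/-- A separating variable of a function field over an algebraically closed field is a
`p`-basis. -/
theorem isPBasis_of_isSeparable [IsAlgClosed K] {t : L} [FiniteDimensional K⟮t⟯ L]
    [Algebra.IsSeparable K⟮t⟯ L] : IsPBasis p t := by
  have hp := (Fact.out : p.Prime)
  have : CharP K⟮t⟯ p := charP_base K⟮t⟯ (L := L) p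
  let Lp : Subfield L := (frobenius L p).fieldRange
  have hLp : ∀ y : L, y ^ p ∈ Lp := fun y => ⟨y, rfl⟩
  let M : IntermediateField Lp L := IntermediateField.adjoin Lp {t}
  have htM : t ∈ M := IntermediateField.mem_adjoin_simple_self Lp t
  have hpM : ∀ y : L, y ^ p ∈ M := fun y => M.algebraMap_mem ⟨y ^ p, hLp y⟩
  let M' : IntermediateField K L :=
    { M.toSubfield with
      algebraMap_mem' := fun c => by
        obtain ⟨d, hd⟩ := IsAlgClosed.exists_pow_nat_eq c hp.pos
        rw [← hd, map_pow]
        exact hpM _ }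
  have hle : K⟮t⟯ ≤ M' := by
    rw [IntermediateField.adjoin_simple_le_iff]
    exact htM
  have htop : ∀ y : L, y ∈ M := by
    intro y
    let b := Module.finBasis K⟮t⟯ L
    have h1 := Field.span_map_pow_expChar_pow_eq_top_of_isSeparable (F := K⟮t⟯) (E := L) p 1
      b.span_eq
    have h2 : y ∈ Submodule.span K⟮t⟯ (Set.range fun i => b i ^ p ^ 1) := by
      rw [h1]; trivial
    induction h2 using Submodule.span_induction with
    | mem x hx =>
      obtain ⟨i, rfl⟩ := hx
      simp only [pow_one]
      exact hpM _
    | zero => exact M.zero_mem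
    | add x y _ _ hx hy => exact M.add_mem hx hy
    | smul c x _ hx => exact M.mul_mem (hle c.2) hx
  intro y
  let g : Polynomial Lp := Polynomial.X ^ p - Polynomial.C ⟨t ^ p, hLp t⟩
  have hg : g.Monic := Polynomial.monic_X_pow_sub_C _ hp.ne_zero
  have hgt : Polynomial.aeval t g = 0 := by
    simp [g, Algebra.algebraMap_eq_smul_one, Subfield.smul_def]
  have halg : IsAlgebraic Lp t := ⟨g, hg.ne_zero, hgt⟩
  have hy : y ∈ M.toSubalgebra := htop y
  rw [IntermediateField.adjoin_simple_toSubalgebra_of_isAlgebraic halg,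
    Algebra.adjoin_singleton_eq_range_aeval] at hy
  obtain ⟨h, rfl⟩ := hy
  have hdeg : (h %ₘ g).natDegree < p := by
    have := Polynomial.natDegree_modByMonic_lt h hg (by
      intro h1
      have := congrArg Polynomial.natDegree h1
      rw [Polynomial.natDegree_X_pow_sub_C] at this
      simp [hp.ne_zero] at this)
    rwa [Polynomial.natDegree_X_pow_sub_C] at this
  choose z hz using fun c : Lp => c.2
  refine ⟨fun i => z ((h %ₘ g).coeff i), ?_⟩
  have h5 := Polynomial.aeval_modByMonic_eq_self_of_root (p := h) hgt
  change Polynomial.aeval t h = _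
  rw [← h5, Polynomial.aeval_eq_sum_range' hdeg]
  refine Finset.sum_congr rfl fun i _ => ?_
  have := hz ((h %ₘ g).coeff i)
  rw [frobenius_def] at this
  rw [this, Subfield.smul_def, smul_eq_mul]

theorem isSeparable_of_isPBasis {t : L} [FiniteDimensional K⟮t⟯ L] (ht : IsPBasis p t) :
    Algebra.IsSeparable K⟮t⟯ L := by
  rw [← Algebra.FormallyUnramified.iff_isSeparable, Algebra.formallyUnramified_iff]
  have hz : ∀ y : L, KaehlerDifferential.D K⟮t⟯ L y = 0 := by
    intro y
    obtain ⟨z, rfl⟩ := ht y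
    have h0 : KaehlerDifferential.D K⟮t⟯ L t = 0 :=
      Derivation.map_algebraMap (KaehlerDifferential.D K⟮t⟯ L) (AdjoinSimple.gen K t)
    rw [derivation_pBasis_sum, h0, smul_zero]
  have htop := KaehlerDifferential.span_range_derivation K⟮t⟯ L
  have hr : Set.range (KaehlerDifferential.D K⟮t⟯ L) = {0} := by
    ext x
    simp only [Set.mem_range, hz, Set.mem_singleton_iff, exists_const, eq_comm]
  rw [hr, Submodule.span_zero_singleton] at htop
  exact (Submodule.subsingleton_iff L).1 (subsingleton_of_bot_eq_top htop)

end Existence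

section Change

open PowerSeries

variable {K L : Type*} [Field K] [Field L] [Algebra K L] {p : ℕ} [Fact p.Prime] [CharP L p]

theorem X_pow_dvd_taylor_pow {τ : L →ₐ[K] PowerSeries L} (hτ : ∀ g, constantCoeff (τ g) = g)
    (z : L) (k : ℕ) : (X : PowerSeries L) ^ p ^ k ∣ τ (z ^ p ^ k) - C (z ^ p ^ k) := by
  have : CharP (PowerSeries L) p := charP_of_injective_algebraMap (algebraMap L _).injective p
  rw [map_pow, map_pow, ← sub_pow_char_pow]
  apply pow_dvd_pow_of_dvd
  rw [X_dvd_iff, map_sub, hτ, constantCoeff_C, sub_self]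

theorem coeff_mul_eq_of_dvd {q s : ℕ} (hs : s < q) {F A B : PowerSeries L}
    (h : (X : PowerSeries L) ^ q ∣ A - B) : coeff s (F * A) = coeff s (F * B) := by
  rw [← sub_eq_zero, ← map_sub, ← mul_sub]
  exact X_pow_dvd_iff.1 (h.mul_left F) s hs

theorem coeff_mul_taylor_sum {τ : L →ₐ[K] PowerSeries L} (hτ : ∀ g, constantCoeff (τ g) = g)
    {s k : ℕ} (hs : s < p ^ k) (F : PowerSeries L) (z : ℕ → L) (t : L) (N : ℕ) :
    coeff s (F * τ (∑ i ∈ Finset.range N, z i ^ p ^ k * t ^ i)) =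
      ∑ i ∈ Finset.range N, z i ^ p ^ k * coeff s (F * τ t ^ i) := by
  rw [map_sum, Finset.mul_sum, map_sum]
  refine Finset.sum_congr rfl fun i _ => ?_
  rw [map_mul τ, mul_left_comm, mul_comm, map_pow τ t i,
    coeff_mul_eq_of_dvd hs (X_pow_dvd_taylor_pow hτ (z i) k), mul_comm, coeff_C_mul]

theorem coeff_C_add_X_pow (t : L) (i j : ℕ) :
    coeff j ((C t + X : PowerSeries L) ^ i) = t ^ (i - j) * (i.choose j : L) := by
  rw [add_comm, ← Polynomial.coeff_X_add_C_pow t i j, ← Polynomial.coeff_coe]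
  simp

theorem coeff_mul_pow_change {F G : PowerSeries L} {t : L} (hG : X ∣ G) (s i : ℕ) :
    coeff s (F * (C t + G) ^ i) =
      ∑ j ∈ Finset.range (s + 1), coeff s (F * G ^ j) * coeff j ((C t + X : PowerSeries L) ^ i) := by
  have h1 : ∀ j, s < j → coeff s (F * G ^ j) = 0 := fun j hj =>
    X_pow_dvd_iff.1 ((pow_dvd_pow_of_dvd hG j).mul_left F) s hj
  have h2 : ∑ j ∈ Finset.range (s + 1),
      coeff s (F * G ^ j) * coeff j ((C t + X : PowerSeries L) ^ i) =
      ∑ j ∈ Finset.range (s + 1 + i),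
      coeff s (F * G ^ j) * coeff j ((C t + X : PowerSeries L) ^ i) := by
    apply Finset.sum_subset (fun j hj => by simp at hj ⊢; omega)
    intro j _ hj
    rw [h1 j (by simpa using hj), zero_mul]
  rw [h2, add_comm (C t) G, add_pow, Finset.mul_sum, map_sum]
  have h3 : ∀ j ∈ Finset.range (s + 1 + i), j ∉ Finset.range (i + 1) →
      coeff s (F * G ^ j) * coeff j ((C t + X : PowerSeries L) ^ i) = 0 := fun j _ hj => by
    rw [coeff_C_add_X_pow, Nat.choose_eq_zero_of_lt (by simpa using hj)]
    simp
  rw [← Finset.sum_subset (fun j hj => by simp at hj ⊢; omega) h3]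
  refine Finset.sum_congr rfl fun j _ => ?_
  rw [coeff_C_add_X_pow]
  have : F * (G ^ j * C t ^ (i - j) * ((i.choose j : ℕ) : PowerSeries L)) =
      F * G ^ j * C (t ^ (i - j) * (i.choose j : L)) := by
    rw [map_mul, map_pow, map_natCast]
    ring
  rw [this, coeff_mul_C]

/-- Change of variables for Taylor expansions. -/
theorem coeff_mul_taylor_change {t : L} (ht : IsPBasis p t) {τ τ' : L →ₐ[K] PowerSeries L}
    (hτ : IsTaylor t τ) (hτ' : ∀ g, constantCoeff (τ' g) = g) (F : PowerSeries L) (s : ℕ) (y : L) :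
    coeff s (F * τ' y) =
      ∑ j ∈ Finset.range (s + 1), coeff s (F * (τ' t - C t) ^ j) * coeff j (τ y) := by
  have hs : s < p ^ s := Nat.lt_pow_self (Fact.out : p.Prime).one_lt
  obtain ⟨z, hz⟩ := ht.pow s y
  have hG : X ∣ τ' t - C t := by
    rw [X_dvd_iff, map_sub, hτ', constantCoeff_C, sub_self]
  have h1 : ∀ j ∈ Finset.range (s + 1), coeff j (τ y) =
      ∑ i ∈ Finset.range (p ^ s), z i ^ p ^ s * coeff j ((C t + X : PowerSeries L) ^ i) := by
    intro j hj
    have := coeff_mul_taylor_sum hτ.const (s := j) (k := s)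
      (lt_of_le_of_lt (Nat.lt_succ_iff.1 (Finset.mem_range.1 hj)) hs) 1 z t (p ^ s)
    simpa only [one_mul, ← hz, hτ.map_self] using this
  rw [Finset.sum_congr rfl fun j hj => by rw [h1 j hj]]
  conv_lhs => rw [hz]
  rw [coeff_mul_taylor_sum hτ' hs]
  simp_rw [Finset.mul_sum]
  rw [Finset.sum_comm]
  refine Finset.sum_congr rfl fun i _ => ?_
  have h2 := coeff_mul_pow_change (F := F) (t := t) hG s i
  rw [add_sub_cancel] at h2
  rw [h2, Finset.mul_sum]
  refine Finset.sum_congr rfl fun j _ => ?_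
  ring

theorem IsTaylor.unique {t : L} (ht : IsPBasis p t) {τ τ' : L →ₐ[K] PowerSeries L}
    (hτ : IsTaylor t τ) (hτ' : IsTaylor t τ') : τ = τ' := by
  ext y s
  have h := coeff_mul_taylor_change ht hτ hτ'.const 1 s y
  rw [hτ'.map_self] at h
  simp only [one_mul, add_sub_cancel_left, coeff_X_pow] at h
  rw [h, Finset.sum_eq_single s (fun j _ hj => by rw [if_neg (Ne.symm hj), zero_mul])
    (fun h => absurd (Finset.self_mem_range_succ s) h)]
  simp

theorem IsTaylor.hasseDeriv_eq {t : L} (ht : IsPBasis p t) {τ : L →ₐ[K] PowerSeries L}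
    (hτ : IsTaylor t τ) (r : ℕ) (f : L) : hasseDeriv K t r f = coeff r (τ f) := by
  have h : ∃ τ : L →ₐ[K] PowerSeries L, (∀ g, constantCoeff (τ g) = g) ∧ τ t = C t + X :=
    ⟨τ, hτ.const, hτ.map_self⟩
  rw [hasseDeriv, dif_pos h,
    IsTaylor.unique ht (⟨h.choose_spec.1, h.choose_spec.2⟩ : IsTaylor t h.choose) hτ]

/-- The derivation `d/dt`. -/
def taylorDerivation (τ : L →ₐ[K] PowerSeries L) (hτ : ∀ g, constantCoeff (τ g) = g) :
    Derivation K L L :=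
  Derivation.mk'
    { toFun := fun y => coeff 1 (τ y)
      map_add' := fun x y => by rw [map_add, map_add]
      map_smul' := fun c y => by
        rw [map_smul, RingHom.id_apply, Algebra.smul_def, Algebra.smul_def,
          IsScalarTower.algebraMap_apply K L (PowerSeries L), ← C_eq_algebraMap, coeff_C_mul] }
    fun a b => by
      change coeff 1 (τ (a * b)) = a * coeff 1 (τ b) + b * coeff 1 (τ a)
      rw [map_mul, coeff_one_mul, hτ, hτ]
      ring

theorem IsTaylor.derivation_self {t : L} {τ : L →ₐ[K] PowerSeries L} (hτ : IsTaylor t τ) :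
    taylorDerivation τ hτ.const t = 1 := by
  change coeff 1 (τ t) = 1
  rw [hτ.map_self, map_add, coeff_C, if_neg one_ne_zero, coeff_one_X, zero_add]

end Change

section Local

open PowerSeries

variable {K L : Type*} [Field K] [Field L] [Algebra K L] {p : ℕ} [Fact p.Prime] [CharP L p]
variable {P : Place K L} {π : L} {τ : L →ₐ[K] PowerSeries L}

theorem Place.ge_natCast (P : Place K L) (n : ℕ) : P.ge 0 (n : L) := by
  have := P.ge_algebraMap (n : K)
  rwa [map_natCast] at this

theorem coeff_taylor_eq (hτ : IsTaylor π τ) {s k : ℕ} (hs : s < p ^ k)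
    (z : ℕ → L) :
    coeff s (τ (∑ i ∈ Finset.range (p ^ k), z i ^ p ^ k * π ^ i)) * π ^ s =
      ∑ i ∈ Finset.range (p ^ k), (i.choose s : L) * (z i ^ p ^ k * π ^ i) := by
  have := coeff_mul_taylor_sum hτ.const hs 1 z π (p ^ k)
  rw [one_mul] at this
  rw [this, Finset.sum_mul]
  refine Finset.sum_congr rfl fun i _ => ?_
  rw [one_mul, hτ.map_self, coeff_C_add_X_pow]
  by_cases h : s ≤ i
  · have : π ^ i = π ^ (i - s) * π ^ s := by rw [← pow_add, Nat.sub_add_cancel h]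
    rw [this]
    ring
  · rw [Nat.choose_eq_zero_of_lt (by omega)]
    simp

theorem Place.ge.coeff_taylor (hP : IsPBasis p π) (hπ : P.ord π = 1) (hτ : IsTaylor π τ)
    {n : ℤ} {y : L} (hy : P.ge n y) (s : ℕ) : P.ge (n - s) (coeff s (τ y)) := by
  have hπ0 : π ≠ 0 := P.ne_zero_of_ord_ne (by omega)
  have hs : s < p ^ s := Nat.lt_pow_self (Fact.out : p.Prime).one_lt
  obtain ⟨z, hz⟩ := hP.pow s y
  have h1 := coeff_taylor_eq hτ hs z
  rw [← hz] at h1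
  have h2 : P.ge n (coeff s (τ y) * π ^ s) := by
    rw [h1]
    refine Place.ge.sum fun i hi => (P.ge_natCast _).zero_mul ?_
    rw [hz] at hy
    exact P.ge_term_of_ge_sum hπ z hy (Finset.mem_range.1 hi)
  have h3 : coeff s (τ y) = (coeff s (τ y) * π ^ s) * (π ^ s)⁻¹ := by
    field_simp
  rw [h3, sub_eq_add_neg]
  refine h2.mul ?_
  have h4 := P.ge_ord (π ^ s)⁻¹
  rwa [P.ord_inv, P.ord_pow, hπ, mul_one] at h4

theorem Place.ge_coeff_taylor_mul_sub (hP : IsPBasis p π) (hπ : P.ord π = 1)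
    (hτ : IsTaylor π τ) {s : ℕ} {y : L} (hy : P.ge s y) :
    P.ge (s + 1) (coeff s (τ y) * π ^ s - y) := by
  have hπ0 : π ≠ 0 := P.ne_zero_of_ord_ne (by omega)
  have hs : s < p ^ s := Nat.lt_pow_self (Fact.out : p.Prime).one_lt
  obtain ⟨z, hz⟩ := hP.pow s y
  have h1 := coeff_taylor_eq hτ hs z
  rw [← hz] at h1
  rw [h1]
  conv in _ - y => rw [hz]
  rw [← Finset.sum_sub_distrib]
  refine Place.ge.sum fun i hi => ?_
  by_cases his : i = s
  · subst his
    simp [Place.ge]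
  rw [hz] at hy
  have h2 := P.ge_term_of_ge_sum hπ z hy (Finset.mem_range.1 hi)
  have h3 : P.ge (s + 1) (z i ^ p ^ s * π ^ i) := by
    by_cases h0 : z i = 0
    · rw [h0, zero_pow (by omega), zero_mul]
      simp [Place.ge]
    rw [P.ge_iff_le_ord (mul_ne_zero (pow_ne_zero _ h0) (pow_ne_zero _ hπ0)),
      P.ord_pow_mul_pow hπ h0] at h2 ⊢
    by_contra hlt
    have h4 : (s : ℤ) - i = (p ^ s : ℕ) * P.ord (z i) := by omega
    have h5 : (s : ℤ) - i = 0 :=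
      Int.eq_zero_of_abs_lt_dvd ⟨_, h4⟩ (by rw [abs_lt]; have := Finset.mem_range.1 hi; omega)
    omega
  exact ((P.ge_natCast _).zero_mul h3).sub h3

theorem Place.ord_coeff_taylor (hP : IsPBasis p π) (hπ : P.ord π = 1)
    (hτ : IsTaylor π τ) {s : ℕ} {y : L} (hy0 : y ≠ 0) (hy : P.ord y = s) :
    coeff s (τ y) ≠ 0 ∧ P.ord (coeff s (τ y)) = 0 := by
  have hπ0 : π ≠ 0 := P.ne_zero_of_ord_ne (by omega)
  have h1 := Place.ge_coeff_taylor_mul_sub hP hπ hτ (hy ▸ P.ge_ord y)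
  obtain ⟨h2, h3⟩ := P.ord_add_eq hy0 (hy.symm ▸ h1)
  rw [add_sub_cancel] at h2 h3
  have h4 := left_ne_zero_of_mul h2
  rw [P.ord_mul h4 (pow_ne_zero _ hπ0), P.ord_pow, hπ, hy] at h3
  exact ⟨h4, by omega⟩

theorem Place.exists_taylor [IsAlgClosed K] [IsCurveField K L] (P : Place K L) (hπ : P.ord π = 1)
    (hP : IsPBasis p π) : ∃ τ : L →ₐ[K] PowerSeries L, IsTaylor π τ := by
  have hr := P.notMem_range_of_ord_ne (x := π) (by omega)
  have := IsCurveField.finite (K := K) π hr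
  have := isSeparable_of_isPBasis (K := K) hP
  exact FrobCurve.exists_taylor (transcendental_of_notMem_range hr)

end Local

section LexMin

variable {r : ℕ} {S : Set (Fin r → ℕ)}

theorem lexMin_mem (h : S.Nonempty) : lexMin S ∈ S := by
  rw [lexMin, dif_pos h]
  exact (wellFounded_lt (α := Lex (Fin r → ℕ))).min_mem (ofLex ⁻¹' S)
    (h.elim fun a ha => ⟨toLex a, ha⟩)

theorem lexMin_le {ρ : Fin r → ℕ} (h : ρ ∈ S) : toLex (lexMin S) ≤ toLex ρ := by
  rw [lexMin, dif_pos ⟨ρ, h⟩]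
  exact not_lt.1 ((wellFounded_lt (α := Lex (Fin r → ℕ))).not_lt_min (ofLex ⁻¹' S) h)

theorem lexMin_eq_of_subset {T : Set (Fin r → ℕ)} (hT : T ⊆ S) (h : lexMin S ∈ T) :
    lexMin T = lexMin S :=
  toLex.injective (le_antisymm (lexMin_le h) (lexMin_le (hT (lexMin_mem ⟨_, h⟩))))

end LexMin

section RowFamily

variable {L : Type*} [Field L] {ι : Type*} [Fintype ι] [DecidableEq ι] {r : ℕ}

/-- A family of square matrices with fixed rows, except that the rows `σ l` are `w (ρ l)`. -/
structure IsRowFamily (R : (Fin r → ℕ) → Matrix ι ι L) (w : ℕ → ι → L) (σ : Fin r → ι) :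
    Prop where
  inj : Function.Injective σ
  row : ∀ ρ l, R ρ (σ l) = w (ρ l)
  row_of_notMem : ∀ ρ ρ' i, i ∉ Set.range σ → R ρ i = R ρ' i

namespace IsRowFamily

variable {R : (Fin r → ℕ) → Matrix ι ι L} {w : ℕ → ι → L} {σ : Fin r → ι}

theorem update (h : IsRowFamily R w σ) (ρ : Fin r → ℕ) (l : Fin r) (s : ℕ) :
    R (Function.update ρ l s) = (R ρ).updateRow (σ l) (w s) := by
  funext i
  by_cases hi : i ∈ Set.range σ
  · obtain ⟨k, rfl⟩ := hi
    rw [h.row]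
    by_cases hk : k = l
    · subst hk
      rw [Function.update_self, Matrix.updateRow_self]
    · rw [Function.update_of_ne hk, Matrix.updateRow_ne (h.inj.ne hk), h.row]
  · rw [Matrix.updateRow_ne (fun h' => hi ⟨l, h'.symm⟩)]
    exact h.row_of_notMem _ _ _ hi

theorem det_swap (h : IsRowFamily R w σ) (ρ : Fin r → ℕ) (i l : Fin r) :
    (R (ρ ∘ Equiv.swap i l)).det ≠ 0 ↔ (R ρ).det ≠ 0 := by
  have h1 : R (ρ ∘ Equiv.swap i l) = (R ρ).submatrix (Equiv.swap (σ i) (σ l)) id := by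
    funext x
    suffices R (ρ ∘ Equiv.swap i l) x = R ρ (Equiv.swap (σ i) (σ l) x) from this
    by_cases hx : x ∈ Set.range σ
    · obtain ⟨k, rfl⟩ := hx
      rw [h.inj.swap_apply, h.row, h.row]
      rfl
    · rw [Equiv.swap_apply_of_ne_of_ne (fun h' => hx ⟨i, h'.symm⟩) (fun h' => hx ⟨l, h'.symm⟩)]
      exact h.row_of_notMem _ _ _ hx
  rw [h1, Matrix.det_permute]
  have h2 : ((Equiv.Perm.sign (Equiv.swap (σ i) (σ l)) : ℤ) : L) ≠ 0 := by
    rcases Int.units_eq_one_or (Equiv.Perm.sign (Equiv.swap (σ i) (σ l))) with h | h <;> simp [h]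
  exact mul_ne_zero_iff_left h2

theorem injective_of_det_ne_zero (h : IsRowFamily R w σ) {ρ : Fin r → ℕ} (hρ : (R ρ).det ≠ 0) :
    Function.Injective ρ := by
  intro a b hab
  by_contra hne
  exact hρ (Matrix.det_zero_of_row_eq (h.inj.ne hne) (by rw [h.row, h.row, hab]))

theorem strictMono_lexMin (h : IsRowFamily R w σ) (hne : {ρ | (R ρ).det ≠ 0}.Nonempty) :
    StrictMono (lexMin {ρ | (R ρ).det ≠ 0}) := by
  have hmem : (R (lexMin {ρ | (R ρ).det ≠ 0})).det ≠ 0 := lexMin_mem hne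
  have hinj := h.injective_of_det_ne_zero hmem
  intro i j hij
  by_contra hlt
  have hlt' := lt_of_le_of_ne (not_lt.1 hlt) (fun h' => hij.ne (hinj h'.symm))
  exact not_lt.2 (lexMin_le (S := {ρ | (R ρ).det ≠ 0}) ((h.det_swap _ i j).2 hmem))
    (Pi.lex_desc hij.le hlt')

theorem lexMin_strictMono_eq (h : IsRowFamily R w σ) (hne : {ρ | (R ρ).det ≠ 0}.Nonempty) :
    lexMin {ρ | StrictMono ρ ∧ (R ρ).det ≠ 0} = lexMin {ρ | (R ρ).det ≠ 0} :=
  lexMin_eq_of_subset (fun _ hρ => hρ.2) ⟨h.strictMono_lexMin hne, lexMin_mem hne⟩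

/-- Rows of smaller order depend on the earlier rows of the lexicographically minimal matrix. -/
theorem exists_eq_sum_of_lt (h : IsRowFamily R w σ) (hne : {ρ | (R ρ).det ≠ 0}.Nonempty)
    {κ : Fin r → ℕ} (hκ : κ = lexMin {ρ | (R ρ).det ≠ 0}) {i : Fin r} {s : ℕ} (hs : s < κ i) :
    ∃ c : ι → L, (∀ l, i ≤ l → c (σ l) = 0) ∧ w s = ∑ x, c x • R κ x := by
  have hmem : (R κ).det ≠ 0 := by
    rw [hκ]
    exact lexMin_mem hne
  have hw : w s = ∑ x, (Matrix.vecMul (w s) (R κ)⁻¹) x • R κ x := by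
    rw [← Matrix.vecMul_eq_sum, Matrix.vecMul_vecMul,
      Matrix.nonsing_inv_mul _ (isUnit_iff_ne_zero.2 hmem), Matrix.vecMul_one]
  refine ⟨_, fun l hl => ?_, hw⟩
  by_contra hc
  have h1 : (R (Function.update κ l s)).det ≠ 0 := by
    rw [h.update]
    conv in w s => rw [hw]
    rw [Matrix.det_updateRow_sum]
    exact mul_ne_zero hc hmem
  have h2 := lexMin_le (S := {ρ | (R ρ).det ≠ 0}) ((h.det_swap _ i l).2 h1)
  rw [← hκ] at h2
  refine not_lt.2 h2 ⟨i, fun j hj => ?_, ?_⟩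
  · change Function.update κ l s (Equiv.swap i l j) = κ j
    rw [Equiv.swap_apply_of_ne_of_ne hj.ne (hj.trans_le hl).ne,
      Function.update_of_ne (hj.trans_le hl).ne]
  · change Function.update κ l s (Equiv.swap i l i) < κ i
    rw [Equiv.swap_apply_left, Function.update_self]
    exact hs

end IsRowFamily

/-- The determinant of a matrix whose rows are obtained by a triangular change. -/
theorem det_eq_of_triangular {N : ℕ} (A B : Matrix (Fin N) (Fin N) L) (d : Fin N → L)
    (h : ∀ i, ∃ c : Fin N → L, (∀ l, i ≤ l → c l = 0) ∧ B i = d i • A i + ∑ x, c x • A x) :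
    B.det = (∏ i, d i) * A.det := by
  choose c hc hB using h
  let C : Matrix (Fin N) (Fin N) L := Matrix.of fun i l => c i l + if i = l then d i else 0
  have hBC : B = C * A := by
    funext i
    rw [hB i]
    funext j
    simp only [Pi.add_apply, Pi.smul_apply, Finset.sum_apply, smul_eq_mul, Matrix.mul_apply, C,
      Matrix.of_apply, add_mul, Finset.sum_add_distrib, ite_mul, zero_mul, Finset.sum_ite_eq,
      Finset.mem_univ, if_true]
    ring
  have hC : C.det = ∏ i, d i := by
    rw [Matrix.det_of_isLowerTriangular]
    · refine Finset.prod_congr rfl fun i _ => ?_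
      simp [C, hc i i le_rfl]
    · intro i j hij
      have hij' : i < j := hij
      simp [C, hc i j hij'.le, hij'.ne]
  rw [hBC, Matrix.det_mul, hC]

/-- Fewer than `N` rows have a common nonzero annihilator supported on `N` given columns. -/
theorem exists_annihilator {ι : Type*} [Fintype ι] [DecidableEq ι] (I : Finset ι) {β : Type*}
    [Fintype β] (hβ : Fintype.card β < I.card) (v : β → ι → L) :
    ∃ x : ι → L, x ≠ 0 ∧ (∀ c ∉ I, x c = 0) ∧ ∀ b, ∑ c, x c * v b c = 0 := by
  let T : (I → L) →ₗ[L] (β → L) :=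
    { toFun := fun x b => ∑ c : I, x c * v b c
      map_add' := fun x y => by
        funext b
        simp [add_mul, Finset.sum_add_distrib]
      map_smul' := fun a x => by
        funext b
        simp [Finset.mul_sum, mul_assoc] }
  have hT : ¬ Function.Injective T := fun hinj => by
    have := LinearMap.finrank_le_finrank_of_injective hinj
    simp at this
    omega
  rw [← LinearMap.ker_eq_bot, Submodule.eq_bot_iff] at hT
  push Not at hT
  obtain ⟨x, hx, hx0⟩ := hT
  refine ⟨fun c => if hc : c ∈ I then x ⟨c, hc⟩ else 0, fun h0 => hx0 ?_, fun c hc => dif_neg hc,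
    fun b => ?_⟩
  · funext c
    have := congrFun h0 c
    simpa using this
  · have h1 := congrFun (LinearMap.mem_ker.1 hx) b
    change ∑ c : I, x c * v b c = 0 at h1
    rw [← Finset.sum_subset (Finset.subset_univ I) (fun c _ hc => by simp only [hc, dite_false, zero_mul]),
      ← Finset.sum_coe_sort I]
    refine Eq.trans (Finset.sum_congr rfl fun c _ => ?_) h1
    simp only [c.2, dite_true]

end RowFamily

namespace Place

open PowerSeries

variable {K L : Type*} [Field K] [Field L] [Algebra K L]

theorem ge_det {ι : Type*} [Fintype ι] [DecidableEq ι] (P : Place K L) (A : Matrix ι ι L)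
    (α β : ι → ℤ) (h : ∀ i c, P.ge (α i + β c) (A i c)) : P.ge (∑ i, α i + ∑ c, β c) A.det := by
  rw [Matrix.det_apply]
  refine ge.sum fun σ _ => ?_
  have h1 : P.ge (∑ i, α i + ∑ c, β c) (∏ i, A (σ i) i) := by
    have h2 := ge.prod (P := P) (s := Finset.univ) (n := fun i => α (σ i) + β i)
      (f := fun i => A (σ i) i) (fun i _ => h _ _)
    rwa [Finset.sum_add_distrib, Equiv.sum_comp σ α] at h2
  rcases Int.units_eq_one_or (Equiv.Perm.sign σ) with h3 | h3
  · rwa [h3, one_smul]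
  · rw [h3, Units.neg_smul, one_smul]
    exact h1.neg

theorem ge.of_mul_unit {P : Place K L} {n : ℤ} {x y : L} (h : P.ge n (x * y)) (hy0 : y ≠ 0)
    (hy : P.ord y = 0) : P.ge n x := by
  have h1 : P.ge 0 y⁻¹ := by
    rw [P.ge_iff_le_ord (inv_ne_zero hy0), P.ord_inv, hy, neg_zero]
  have h2 := h.mul_zero h1
  rwa [mul_inv_cancel_right₀ hy0] at h2

section Taylor

variable {p : ℕ} [Fact p.Prime] [CharP L p]
variable {P : Place K L} {π : L} {τ : L →ₐ[K] PowerSeries L}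

theorem ge.coeff_taylor_regular (hP : IsPBasis p π) (hπ : P.ord π = 1) (hτ : IsTaylor π τ)
    {y : L} (hy : P.ge 0 y) (s : ℕ) : P.ge 0 (coeff s (τ y)) := by
  have hs : s < p ^ s := Nat.lt_pow_self (Fact.out : p.Prime).one_lt
  obtain ⟨z, hz⟩ := hP.pow s y
  have h1 := coeff_mul_taylor_sum hτ.const hs 1 z π (p ^ s)
  rw [← hz] at h1
  simp only [one_mul] at h1
  rw [h1]
  refine ge.sum fun i hi => ?_
  rw [hτ.map_self, coeff_C_add_X_pow]
  have hi' := Finset.mem_range.1 hi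
  rw [hz] at hy
  have h2 : P.ge 0 (z i) := P.ge_coeff_of_ge_sum hπ z hy hi' (by
    push_cast
    have : ((p : ℤ) ^ s) > i := by exact_mod_cast hi'
    linarith)
  have h3 : P.ge 0 π := by
    have := P.ge_ord π
    rw [hπ] at this
    exact this.mono zero_le_one
  have h4 := h2.pow (p ^ s)
  have h5 := h3.pow (i - s)
  simp only [MulZeroClass.mul_zero] at h4 h5
  exact h4.zero_mul (h5.zero_mul (P.ge_natCast _))

variable {ι : Type*}

theorem ge_of_coeff_taylor_sum (hP : IsPBasis p π) (hπ : P.ord π = 1) (hτ : IsTaylor π τ)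
    (I : Finset ι) (x y : ι → L) (i : ι → ℕ) (hy0 : ∀ c ∈ I, y c ≠ 0)
    (hy : ∀ c ∈ I, P.ord (y c) = i c) (hi : Set.InjOn i I) (M : ℤ)
    (hx : ∀ c ∈ I, P.ge (M - i c) (x c))
    (hs : ∀ c ∈ I, P.ge (M + 1 - i c) (∑ d ∈ I, x d * coeff (i c) (τ (y d)))) :
    ∀ c ∈ I, P.ge (M + 1 - i c) (x c) := by
  classical
  by_contra hcon
  push Not at hcon
  obtain ⟨c₀, hc₀, hc₀'⟩ := hcon
  obtain ⟨r, hr, hmax⟩ := Finset.exists_max_image (I.filter fun c => ¬ P.ge (M + 1 - i c) (x c)) i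
    ⟨c₀, Finset.mem_filter.2 ⟨hc₀, hc₀'⟩⟩
  obtain ⟨hrI, hr'⟩ := Finset.mem_filter.1 hr
  have hd : ∀ d ∈ I.erase r, P.ge (M + 1 - i r) (x d * coeff (i r) (τ (y d))) := by
    intro d hd
    obtain ⟨hdr, hdI⟩ := Finset.mem_erase.1 hd
    have hreg : P.ge (i d) (y d) := hy d hdI ▸ P.ge_ord (y d)
    rcases lt_trichotomy (i d) (i r) with h | h | h
    · have h1 := (hx d hdI).mul_zero (ge.coeff_taylor_regular hP hπ hτ (hreg.mono (by omega)) (i r))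
      exact h1.mono (by omega)
    · exact absurd (hi hdI hrI h) hdr
    · have h1 : P.ge (M + 1 - i d) (x d) := by
        by_contra h2
        have := hmax d (Finset.mem_filter.2 ⟨hdI, h2⟩)
        omega
      exact (h1.mul (ge.coeff_taylor hP hπ hτ hreg (i r))).mono (by omega)
  have h1 := (hs r hrI).sub (ge.sum hd)
  rw [← Finset.add_sum_erase I _ hrI, add_sub_cancel_right] at h1
  obtain ⟨h2, h3⟩ := ord_coeff_taylor hP hπ hτ (hy0 r hrI) (hy r hrI)
  exact hr' (h1.of_mul_unit h2 h3)

theorem exists_min_order (P : Place K L) (I : Finset ι) (x : ι → L) (i : ι → ℕ)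
    (h : ∃ c ∈ I, x c ≠ 0) :
    ∃ M : ℤ, (∀ c ∈ I, P.ge (M - i c) (x c)) ∧ ∃ c ∈ I, ¬ P.ge (M + 1 - i c) (x c) := by
  classical
  obtain ⟨c₀, hc₀, hc₀'⟩ := h
  obtain ⟨r, hr, hmin⟩ := Finset.exists_min_image (I.filter fun c => x c ≠ 0)
    (fun c => P.ord (x c) + i c) ⟨c₀, Finset.mem_filter.2 ⟨hc₀, hc₀'⟩⟩
  obtain ⟨hrI, hr'⟩ := Finset.mem_filter.1 hr
  refine ⟨P.ord (x r) + i r, fun c hc => ?_, r, hrI, ?_⟩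
  · by_cases h0 : x c = 0
    · simp [h0]
    · rw [P.ge_iff_le_ord h0]
      have := hmin c (Finset.mem_filter.2 ⟨hc, h0⟩)
      omega
  · rw [P.ge_iff_le_ord hr']
    omega

theorem eq_zero_of_coeff_taylor_sum (hP : IsPBasis p π) (hπ : P.ord π = 1) (hτ : IsTaylor π τ)
    (I : Finset ι) (x y : ι → L) (i : ι → ℕ) (hy0 : ∀ c ∈ I, y c ≠ 0)
    (hy : ∀ c ∈ I, P.ord (y c) = i c) (hi : Set.InjOn i I)
    (hs : ∀ c ∈ I, ∑ d ∈ I, x d * coeff (i c) (τ (y d)) = 0) : ∀ c ∈ I, x c = 0 := by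
  by_contra hcon
  push Not at hcon
  obtain ⟨M, hM, c, hc, hc'⟩ := P.exists_min_order I x i hcon
  exact hc' (ge_of_coeff_taylor_sum hP hπ hτ I x y i hy0 hy hi M hM
    (fun c hc => by rw [hs c hc]; simp [Place.ge]) c hc)

end Taylor

section Hermite

variable {k₀ : Type*} [Field k₀] [Algebra k₀ K] [Algebra k₀ L] [IsScalarTower k₀ K L]

theorem ord_smul (P : Place K L) {a : k₀} (ha : a ≠ 0) (g : L) : P.ord (a • g) = P.ord g := by
  rw [Algebra.smul_def, IsScalarTower.algebraMap_apply k₀ K L]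
  unfold Place.ord
  rw [map_mul, P.triv _ (by simpa using ha), one_mul]

theorem linearIndependent_of_injective_ord (P : Place K L) {ι : Type*} (g : ι → L)
    (hg0 : ∀ i, g i ≠ 0) (hg : Function.Injective fun i => P.ord (g i)) :
    LinearIndependent k₀ g := by
  rw [linearIndependent_iff']
  intro s a hsum i hi
  by_contra hai
  have h1 := P.ge_of_ge_sum s (fun i => a i • g i) (fun b hb c hc hb0 hc0 hbc => hg (by
    have h2 := P.ord_smul (left_ne_zero_of_smul hb0) (g b)
    have h3 := P.ord_smul (left_ne_zero_of_smul hc0) (g c)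
    change P.ord (g b) = P.ord (g c)
    rw [← h2, ← h3]
    exact hbc)) (n := P.ord (a i • g i) + 1) (by rw [hsum]; simp [Place.ge]) i hi
  have := h1.le_ord (smul_ne_zero hai (hg0 i))
  omega

/-- A finite-dimensional space of functions has a basis whose elements have distinct orders at a
point with small residue field. -/
theorem exists_hermite_basis (P : Place K L) {N : ℕ} (f : Fin N → L)
    (hf : LinearIndependent k₀ f)
    (hres : ∀ x ∈ Submodule.span k₀ (Set.range f), ∀ y ∈ Submodule.span k₀ (Set.range f), y ≠ 0 →
      P.ge (P.ord y) x → ∃ a : k₀, P.ge (P.ord y + 1) (x - a • y)) :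
    ∃ M M' : Matrix (Fin N) (Fin N) k₀, M' * M = 1 ∧ (∀ c, ∑ j, M c j • f j ≠ 0) ∧
      StrictMono fun c => P.ord (∑ j, M c j • f j) := by
  classical
  set V := Submodule.span k₀ (Set.range f) with hV
  have hVdim : Module.finrank k₀ V = N := by
    rw [hV, finrank_span_eq_card hf, Fintype.card_fin]
  let T : Set ℤ := {a | ∃ y ∈ V, y ≠ 0 ∧ P.ord y = a}
  have hg : ∀ a : ℤ, ∃ y : L, a ∈ T → y ∈ V ∧ y ≠ 0 ∧ P.ord y = a := fun a => by
    by_cases ha : a ∈ T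
    · obtain ⟨y, hy⟩ := ha
      exact ⟨y, fun _ => hy⟩
    · exact ⟨0, fun h => absurd h ha⟩
  choose g hg using hg
  have hLI : ∀ A : Finset ℤ, (↑A ⊆ T) → LinearIndependent k₀ (fun a : A => g a) := fun A hA =>
    P.linearIndependent_of_injective_ord _ (fun a => (hg a (hA a.2)).2.1) fun a b hab =>
      Subtype.ext (by
        have h1 := (hg a (hA a.2)).2.2
        have h2 := (hg b (hA b.2)).2.2
        rw [← h1, ← h2]
        exact hab)
  have hspan_le : ∀ A : Finset ℤ, (↑A ⊆ T) →
      Submodule.span k₀ (Set.range fun a : A => g a) ≤ V := fun A hA => by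
    rw [Submodule.span_le]
    rintro _ ⟨a, rfl⟩
    exact (hg a (hA a.2)).1
  have hVfin : FiniteDimensional k₀ V := FiniteDimensional.span_of_finite k₀ (Set.finite_range f)
  have hcard : ∀ A : Finset ℤ, (↑A ⊆ T) → A.card ≤ N := fun A hA => by
    have h1 := Submodule.finrank_mono (hspan_le A hA)
    rwa [finrank_span_eq_card (hLI A hA), Fintype.card_coe, hVdim] at h1
  have hTfin : T.Finite := by
    by_contra hinf
    obtain ⟨A, hA, hA'⟩ := Set.Infinite.exists_subset_card_eq hinf (N + 1)
    have := hcard A hA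
    omega
  let A := hTfin.toFinset
  have hAT : ↑A ⊆ T := by simp [A]
  have hspan : ∀ m : ℕ, ∀ x ∈ V, (A.filter fun a => P.ord x ≤ a).card = m →
      x ∈ Submodule.span k₀ (Set.range fun a : A => g a) := by
    intro m
    induction m using Nat.strong_induction_on with
    | _ m ih =>
      intro x hx hm
      by_cases hx0 : x = 0
      · rw [hx0]
        exact Submodule.zero_mem _
      have hxT : P.ord x ∈ T := ⟨x, hx, hx0, rfl⟩
      obtain ⟨h1, h2, h3⟩ := hg _ hxT
      obtain ⟨a, ha⟩ := hres x hx _ h1 h2 (by rw [h3]; exact P.ge_ord x)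
      have hmem : g (P.ord x) ∈ Submodule.span k₀ (Set.range fun a : A => g a) :=
        Submodule.subset_span ⟨⟨P.ord x, by simpa [A] using hxT⟩, rfl⟩
      have hx' : x - a • g (P.ord x) ∈ V := V.sub_mem hx (V.smul_mem _ h1)
      have hfin : x - a • g (P.ord x) ∈ Submodule.span k₀ (Set.range fun a : A => g a) := by
        by_cases h0 : x - a • g (P.ord x) = 0
        · rw [h0]
          exact Submodule.zero_mem _
        have h4 := ha.le_ord h0
        rw [h3] at h4
        refine ih _ ?_ _ hx' rfl
        rw [← hm]
        apply Finset.card_lt_card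
        rw [Finset.ssubset_iff_of_subset]
        · refine ⟨P.ord x, ?_, ?_⟩
          · simp [A, hxT]
          · simp only [Finset.mem_filter, not_and, not_le]
            intro _
            omega
        · intro b hb
          simp only [Finset.mem_filter] at hb ⊢
          exact ⟨hb.1, by omega⟩
      have := Submodule.add_mem _ hfin (Submodule.smul_mem _ a hmem)
      rwa [sub_add_cancel] at this
  have hVeq : Submodule.span k₀ (Set.range fun a : A => g a) = V :=
    le_antisymm (hspan_le A hAT) fun x hx => hspan _ x hx rfl
  have hAN : A.card = N := by
    have := finrank_span_eq_card (hLI A hAT)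
    rw [hVeq, hVdim, Fintype.card_coe] at this
    exact this.symm
  let e : Fin N ≃o A := A.orderIsoOfFin hAN
  have hge : ∀ c, g (e c) ∈ V ∧ g (e c) ≠ 0 ∧ P.ord (g (e c)) = e c := fun c =>
    hg _ (hAT (e c).2)
  have hM : ∀ c, ∃ M : Fin N → k₀, ∑ j, M j • f j = g (e c) := fun c =>
    (Submodule.mem_span_range_iff_exists_fun k₀).1 (hge c).1
  choose M hM using hM
  have hM' : ∀ j, ∃ M' : Fin N → k₀, ∑ c, M' c • g (e c) = f j := fun j => by
    have h1 : f j ∈ Submodule.span k₀ (Set.range fun a : A => g a) := by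
      rw [hVeq]
      exact Submodule.subset_span ⟨j, rfl⟩
    obtain ⟨d, hd⟩ := (Submodule.mem_span_range_iff_exists_fun k₀).1 h1
    refine ⟨fun c => d (e c), ?_⟩
    rw [← hd]
    exact Equiv.sum_comp e.toEquiv (fun a : A => d a • g a)
  choose M' hM' using hM'
  refine ⟨Matrix.of M, Matrix.of M', ?_, fun c => ?_, fun c d hcd => ?_⟩
  · ext j l
    have h1 : ∑ l, ((Matrix.of M' * Matrix.of M) j l - (1 : Matrix (Fin N) (Fin N) k₀) j l) • f l =
        0 := by
      simp only [sub_smul, Finset.sum_sub_distrib, Matrix.mul_apply, Matrix.of_apply,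
        Finset.sum_smul]
      rw [Finset.sum_comm]
      simp only [mul_smul, ← Finset.smul_sum, hM, hM', Matrix.one_apply, ite_smul, one_smul,
        zero_smul, Finset.sum_ite_eq, Finset.mem_univ, if_true, sub_self]
    exact sub_eq_zero.1 (Fintype.linearIndependent_iff.1 hf _ h1 l)
  · simp only [Matrix.of_apply, hM]
    exact (hge c).2.1
  · simp only [Matrix.of_apply, hM, (hge _).2.2]
    exact e.strictMono hcd

end Hermite

end Place

open PowerSeries

section FrobMatrix

variable {K L : Type*} [Field K] [Field L] [Algebra K L] {n : ℕ}

/-- The matrix with rows `b₀`, `b₁` and `w (ρ l)`. -/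
def frobMatrix (w : ℕ → Fin (n + 1) → L) (b₀ b₁ : Fin (n + 1) → L) (ρ : Fin (n - 1) → ℕ) :
    Matrix (Fin (n + 1)) (Fin (n + 1)) L :=
  Matrix.of fun i j =>
    if h0 : (i : ℕ) = 0 then b₀ j
    else if h1 : (i : ℕ) = 1 then b₁ j
    else w (ρ ⟨i - 2, by omega⟩) j

/-- The index of the row of the `l`-th derivative. -/
def derivRow (l : Fin (n - 1)) : Fin (n + 1) := ⟨l + 2, by omega⟩

variable {w : ℕ → Fin (n + 1) → L} {b₀ b₁ : Fin (n + 1) → L} {ρ : Fin (n - 1) → ℕ}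

theorem frobMatrix_derivRow (l : Fin (n - 1)) :
    frobMatrix w b₀ b₁ ρ (derivRow l) = w (ρ l) := by
  funext j
  simp [frobMatrix, derivRow]

theorem frobMatrix_zero {i : Fin (n + 1)} (hi : (i : ℕ) = 0) : frobMatrix w b₀ b₁ ρ i = b₀ := by
  funext j
  rw [frobMatrix, Matrix.of_apply, dif_pos hi]

theorem frobMatrix_one {i : Fin (n + 1)} (hi : (i : ℕ) = 1) : frobMatrix w b₀ b₁ ρ i = b₁ := by
  funext j
  rw [frobMatrix, Matrix.of_apply, dif_neg (by omega), dif_pos hi]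

theorem exists_derivRow {i : Fin (n + 1)} (h0 : (i : ℕ) ≠ 0) (h1 : (i : ℕ) ≠ 1) :
    ∃ l : Fin (n - 1), derivRow l = i :=
  ⟨⟨i - 2, by omega⟩, Fin.ext (by simp only [derivRow]; omega)⟩

theorem isRowFamily_frobMatrix : IsRowFamily (frobMatrix w b₀ b₁) w derivRow where
  inj := fun a b h => Fin.ext (by
    have := congrArg Fin.val h
    simp only [derivRow] at this
    omega)
  row := fun ρ l => frobMatrix_derivRow l
  row_of_notMem := fun ρ ρ' i hi => by
    by_cases h0 : (i : ℕ) = 0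
    · rw [frobMatrix_zero h0, frobMatrix_zero h0]
    by_cases h1 : (i : ℕ) = 1
    · rw [frobMatrix_one h1, frobMatrix_one h1]
    · exact absurd (exists_derivRow h0 h1) hi

@[to_additive]
theorem prod_derivRow {A : Type*} [CommMonoid A] (hn : 2 ≤ n) (F : Fin (n + 1) → A) :
    ∏ i, F i = F ⟨0, by omega⟩ * (F ⟨1, by omega⟩ * ∏ l, F (derivRow l)) := by
  obtain ⟨r, rfl⟩ : ∃ r, n = r + 1 := ⟨n - 1, by omega⟩
  rw [Fin.prod_univ_succ, Fin.prod_univ_succ]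
  rfl

/-- If the `w s` separate the points of the dual, then two independent rows can be completed to an
invertible matrix. -/
theorem exists_frobMatrix_det_ne_zero (hn : 2 ≤ n)
    (hw : ∀ x : Fin (n + 1) → L, (∀ s, ∑ c, x c * w s c = 0) → x = 0)
    (hb : ∀ α β : L, α • b₀ + β • b₁ = 0 → α = 0 ∧ β = 0) :
    ∃ ρ : Fin (n - 1) → ℕ, (frobMatrix w b₀ b₁ ρ).det ≠ 0 := by
  let row : (ℕ → ℕ) → ℕ → Fin (n + 1) → L := fun ρ i =>
    if i = 0 then b₀ else if i = 1 then b₁ else w (ρ (i - 2))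
  have key : ∀ k, k ≤ n - 1 → ∃ ρ : ℕ → ℕ,
      LinearIndependent L (fun i : Fin (k + 2) => row ρ i) := by
    intro k
    induction k with
    | zero =>
      intro _
      refine ⟨fun _ => 0, ?_⟩
      rw [Fintype.linearIndependent_iff]
      intro g hg
      rw [Fin.sum_univ_two] at hg
      have := hb _ _ hg
      intro i
      fin_cases i
      · exact this.1
      · exact this.2
    | succ k ih =>
      intro hk
      obtain ⟨ρ, hρ⟩ := ih (by omega)
      obtain ⟨x, hx0, -, hx⟩ := exists_annihilator (L := L) (Finset.univ : Finset (Fin (n + 1)))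
        (β := Fin (k + 2)) (by simp; omega) (fun i => row ρ i)
      obtain ⟨s, hs⟩ : ∃ s, ∑ c, x c * w s c ≠ 0 := by
        by_contra hcon
        push Not at hcon
        exact hx0 (hw x hcon)
      have hns : w s ∉ Submodule.span L (Set.range fun i : Fin (k + 2) => row ρ i) := by
        suffices ∀ v ∈ Submodule.span L (Set.range fun i : Fin (k + 2) => row ρ i),
            ∑ c, x c * v c = 0 from fun hmem => hs (this _ hmem)
        intro v hmem
        induction hmem using Submodule.span_induction with
        | mem v hv =>
          obtain ⟨i, rfl⟩ := hv
          exact hx i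
        | zero => simp
        | add v v' _ _ h1 h2 =>
          simp only [Pi.add_apply, mul_add, Finset.sum_add_distrib, h1, h2, add_zero]
        | smul a v _ h1 =>
          simp only [Pi.smul_apply, smul_eq_mul, mul_left_comm _ a, ← Finset.mul_sum, h1, mul_zero]
      refine ⟨Function.update ρ k s, ?_⟩
      have h1 := linearIndependent_finSnoc.2 ⟨hρ, hns⟩
      convert! h1 using 1
      funext i
      refine Fin.lastCases ?_ (fun i => ?_) i
      · rw [Fin.snoc_last]
        simp [row]
      · rw [Fin.snoc_castSucc]
        have := i.2
        simp only [row, Fin.val_castSucc]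
        split_ifs with h0 h2
        · rfl
        · rfl
        · rw [Function.update_of_ne (by omega)]
  obtain ⟨ρ, hρ⟩ := key (n - 1) le_rfl
  refine ⟨fun l => ρ l, ?_⟩
  have h2 : LinearIndependent L (fun i : Fin (n + 1) => row ρ i) := by
    have e : n - 1 + 2 = n + 1 := by omega
    rw [e] at hρ
    exact hρ
  have h3 : (frobMatrix w b₀ b₁ fun l => ρ l).row = fun i : Fin (n + 1) => row ρ i := by
    funext i
    change frobMatrix w b₀ b₁ _ i = _
    by_cases h0 : (i : ℕ) = 0
    · rw [frobMatrix_zero h0]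
      simp [row, h0]
    by_cases h1 : (i : ℕ) = 1
    · rw [frobMatrix_one h1]
      simp [row, h1]
    obtain ⟨l, rfl⟩ := exists_derivRow h0 h1
    rw [frobMatrix_derivRow]
    simp [row, derivRow]
  rw [← h3, Matrix.linearIndependent_rows_iff_isUnit, Matrix.isUnit_iff_isUnit_det] at h2
  exact h2.ne_zero

theorem frobDet_eq {p : ℕ} [Fact p.Prime] [CharP L p] {t : L} (ht : IsPBasis p t)
    {τ : L →ₐ[K] PowerSeries L} (hτ : IsTaylor t τ) (f : Fin (n + 1) → L) (a b : ℕ)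
    (ρ : Fin (n - 1) → ℕ) : frobDet K t f a b ρ =
      (frobMatrix (fun s j => coeff s (τ (f j))) (fun j => f j ^ b) (fun j => f j ^ a) ρ).det := by
  rw [frobDet, frobMatrix]
  simp only [hτ.hasseDeriv_eq ht]

end FrobMatrix

section Change

variable {K L : Type*} [Field K] [Field L] [Algebra K L] {N : ℕ}

/-- The action of a constant matrix on vectors of functions. -/
def transform (M : Matrix (Fin N) (Fin N) K) (v : Fin N → L) : Fin N → L :=
  fun c => ∑ j, M c j • v j

theorem transform_add (M : Matrix (Fin N) (Fin N) K) (v v' : Fin N → L) :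
    transform M (v + v') = transform M v + transform M v' := by
  funext c
  simp [transform, Finset.sum_add_distrib]

theorem transform_smul (M : Matrix (Fin N) (Fin N) K) (a : L) (v : Fin N → L) :
    transform M (a • v) = a • transform M v := by
  funext c
  simp only [transform, Pi.smul_apply, smul_eq_mul, Finset.mul_sum]
  exact Finset.sum_congr rfl fun j _ => (mul_smul_comm _ _ _).symm

theorem transform_sum (M : Matrix (Fin N) (Fin N) K) {ι : Type*} (s : Finset ι)
    (v : ι → Fin N → L) : transform M (∑ i ∈ s, v i) = ∑ i ∈ s, transform M (v i) := by
  classical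
  induction s using Finset.induction_on with
  | empty =>
    funext c
    simp [transform]
  | insert i s hi ih => rw [Finset.sum_insert hi, Finset.sum_insert hi, transform_add, ih]

theorem det_transform (M : Matrix (Fin N) (Fin N) K) (A : Matrix (Fin N) (Fin N) L) :
    (Matrix.of fun i => transform M (A i)).det = A.det * algebraMap K L M.det := by
  have h : (Matrix.of fun i => transform M (A i)) = A * (M.map (algebraMap K L)).transpose := by
    ext i c
    simp only [Matrix.of_apply, transform, Matrix.mul_apply, Matrix.transpose_apply,
      Matrix.map_apply, Algebra.smul_def]
    exact Finset.sum_congr rfl fun j _ => mul_comm _ _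
  rw [h, Matrix.det_mul, Matrix.det_transpose, RingHom.map_det]
  rfl

variable {p : ℕ} [Fact p.Prime] [CharP L p] {t : L} {τ τ' : L →ₐ[K] PowerSeries L}

/-- The transition coefficient between Taylor expansions. -/
def transCoeff (τ' : L →ₐ[K] PowerSeries L) (t h : L) (s i : ℕ) : L :=
  coeff s (τ' h * (τ' t - C t) ^ i)

theorem transCoeff_self (hτ' : ∀ g, constantCoeff (τ' g) = g) (t h : L) (s : ℕ) :
    transCoeff τ' t h s s = h * coeff 1 (τ' t) ^ s := by
  have hG : X ∣ τ' t - C t := by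
    rw [X_dvd_iff, map_sub, hτ', constantCoeff_C, sub_self]
  obtain ⟨G, hG⟩ := hG
  have h1 : coeff 1 (τ' t) = constantCoeff G := by
    have := congrArg (coeff 1) hG
    rw [map_sub, coeff_C, if_neg one_ne_zero, sub_zero, ← zero_add 1, coeff_succ_X_mul,
      coeff_zero_eq_constantCoeff_apply] at this
    exact this
  rw [transCoeff, hG, mul_pow, mul_left_comm, coeff_X_pow_mul', if_pos le_rfl, Nat.sub_self,
    coeff_zero_eq_constantCoeff_apply, map_mul, map_pow, hτ', h1]

theorem jet_change (ht : IsPBasis p t) (hτ : IsTaylor t τ) (hτ' : ∀ g, constantCoeff (τ' g) = g)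
    {f g : Fin N → L} {h : L} {M : Matrix (Fin N) (Fin N) K}
    (hg : ∀ c, g c = h * transform M f c) (s : ℕ) :
    (fun c => coeff s (τ' (g c))) = ∑ i ∈ Finset.range (s + 1), transCoeff τ' t h s i •
      transform M (fun j => coeff i (τ (f j))) := by
  funext c
  rw [hg, map_mul, coeff_mul_taylor_change ht hτ hτ', Finset.sum_apply]
  refine Finset.sum_congr rfl fun i _ => ?_
  rw [Pi.smul_apply, smul_eq_mul, transCoeff]
  congr 1
  rw [transform, map_sum, map_sum, transform]
  refine Finset.sum_congr rfl fun j _ => ?_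
  rw [map_smul, Algebra.smul_def, Algebra.smul_def,
    IsScalarTower.algebraMap_apply K L (PowerSeries L), ← C_eq_algebraMap, coeff_C_mul]

/-- A vector that annihilates the transformed jets of low order annihilates the new jets. -/
theorem jet_annihilator (ht : IsPBasis p t) (hτ : IsTaylor t τ)
    (hτ' : ∀ g, constantCoeff (τ' g) = g) {f g : Fin N → L} {h : L}
    {M : Matrix (Fin N) (Fin N) K} (hg : ∀ c, g c = h * transform M f c) {x : Fin N → L} {s : ℕ}
    (hx : ∀ i ≤ s, ∑ c, x c * transform M (fun j => coeff i (τ (f j))) c = 0) :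
    ∑ c, x c * coeff s (τ' (g c)) = 0 := by
  have h1 := jet_change ht hτ hτ' hg s
  have h2 : ∀ c, coeff s (τ' (g c)) = ∑ i ∈ Finset.range (s + 1), transCoeff τ' t h s i *
      transform M (fun j => coeff i (τ (f j))) c := fun c => by
    have := congrFun h1 c
    simpa [Finset.sum_apply] using this
  simp_rw [h2, Finset.mul_sum]
  rw [Finset.sum_comm]
  refine Finset.sum_eq_zero fun i hi => ?_
  rw [Finset.sum_congr rfl fun c _ => mul_left_comm (x c) _ _, ← Finset.mul_sum,
    hx i (Nat.lt_succ_iff.1 (Finset.mem_range.1 hi)), mul_zero]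

theorem transform_pow {a k : ℕ} (ha : a = p ^ k) {f g : Fin N → L} {h : L}
    {M : Matrix (Fin N) (Fin N) K} (hM : ∀ i j, M i j ^ a = M i j)
    (hg : ∀ c, g c = h * transform M f c) (c : Fin N) :
    g c ^ a = h ^ a * transform M (fun j => f j ^ a) c := by
  rw [hg, mul_pow]
  congr 1
  rw [transform, transform, ha, sum_pow_char_pow, ← ha]
  refine Finset.sum_congr rfl fun j _ => ?_
  rw [smul_pow, hM]

end Change

section LocalLemma

variable {K L : Type*} [Field K] [Field L] [Algebra K L] {p : ℕ} [Fact p.Prime] [CharP L p]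
variable {P : Place K L} {π : L} {τ : L →ₐ[K] PowerSeries L} {n : ℕ}

namespace Place

theorem ord_pow_sub_pow (P : Place K L) {g : L} (hg0 : g ≠ 0) (hg : 0 < P.ord g) {a b : ℕ}
    (hab : a < b) : g ^ b - g ^ a ≠ 0 ∧ P.ord (g ^ b - g ^ a) = a * P.ord g := by
  have h1 := P.ord_add_eq (f := -g ^ a) (g := g ^ b) (neg_ne_zero.2 (pow_ne_zero a hg0)) (by
    rw [P.ge_iff_le_ord (pow_ne_zero b hg0), P.ord_neg, P.ord_pow, P.ord_pow]
    have : (a : ℤ) + 1 ≤ b := by exact_mod_cast hab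
    nlinarith)
  rw [P.ord_neg, P.ord_pow, neg_add_eq_sub] at h1
  exact h1

theorem ge_pow_sub_pow (P : Place K L) {g : L} {j : ℤ} (hj : 0 ≤ j) (hg : P.ge j g) {a b : ℕ}
    (hab : a ≤ b) : P.ge (a * j) (g ^ b - g ^ a) :=
  ((hg.pow b).mono (by
    have : (a : ℤ) ≤ b := by exact_mod_cast hab
    nlinarith)).sub (hg.pow a)

/-- A vector supported on the first columns that annihilates the Frobenius rows and the jets of
small order of a basis with distinct orders vanishes. -/
theorem eq_zero_of_annihilates (hP : IsPBasis p π) (hπ : P.ord π = 1) (hτ : IsTaylor π τ)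
    (hn : 2 ≤ n) (g : Fin (n + 1) → L) (j : Fin (n + 1) → ℕ) (hj : StrictMono j)
    (hg0 : ∀ c, g c ≠ 0) (hg1 : g ⟨0, by omega⟩ = 1) (hg : ∀ c, P.ord (g c) = j c)
    {a b : ℕ} (ha : 2 ≤ a) (hab : a < b) (i : Fin (n + 1))
    (x : Fin (n + 1) → L) (hx : ∀ c, i < c → x c = 0) (hxa : ∑ c, x c * g c ^ a = 0)
    (hxb : ∑ c, x c * g c ^ b = 0)
    (hxs : ∀ s ≤ j i - j ⟨2, by omega⟩, ∑ c, x c * coeff s (τ (g c)) = 0) : x = 0 := by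
  classical
  set c₀ : Fin (n + 1) := ⟨0, by omega⟩ with hc₀
  set c₁ : Fin (n + 1) := ⟨1, by omega⟩ with hc₁
  set c₂ : Fin (n + 1) := ⟨2, by omega⟩ with hc₂
  let I : Finset (Fin (n + 1)) := Finset.univ.filter fun c => c₂ ≤ c ∧ c ≤ i
  have hI : ∀ c, c ∈ I ↔ c₂ ≤ c ∧ c ≤ i := fun c => by simp [I]
  have hcases : ∀ c, c ≠ c₀ → c ≠ c₁ → c₂ ≤ c := fun c h0 h1 => by
    rw [Fin.le_def]
    have h0' : (c : ℕ) ≠ 0 := fun h => h0 (Fin.ext h)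
    have h1' : (c : ℕ) ≠ 1 := fun h => h1 (Fin.ext h)
    change 2 ≤ (c : ℕ)
    omega
  have h01 : c₀ ≠ c₁ := by simp [hc₀, hc₁]
  have h0I : c₀ ∉ insert c₁ I := by simp [hI, hc₀, hc₁, hc₂]
  have h1I : c₁ ∉ I := by simp [hI, hc₁, hc₂]
  have hsplit : ∀ F : Fin (n + 1) → L, ∑ c, x c * F c =
      x c₀ * F c₀ + (x c₁ * F c₁ + ∑ c ∈ I, x c * F c) := fun F => by
    rw [← Finset.sum_insert (f := fun c => x c * F c) h1I,
      ← Finset.sum_insert (f := fun c => x c * F c) h0I]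
    symm
    apply Finset.sum_subset (Finset.subset_univ _)
    intro c _ hc
    simp only [Finset.mem_insert, not_or, hI, not_and, not_le] at hc
    rw [hx c (hc.2.2 (hcases c hc.1 hc.2.1)), zero_mul]
  have hj1 : 1 ≤ j c₁ := by
    have := hj (show c₀ < c₁ by simp [hc₀, hc₁, Fin.lt_def])
    omega
  have hj12 : j c₁ < j c₂ := hj (by simp [hc₁, hc₂, Fin.lt_def])
  have hjI : ∀ c ∈ I, j c₂ ≤ j c := fun c hc => hj.monotone ((hI c).1 hc).1
  have hgge : ∀ c, P.ge (j c) (g c) := fun c => hg c ▸ P.ge_ord (g c)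
  have hba : ∑ c, x c * (g c ^ b - g c ^ a) = 0 := by
    simp only [mul_sub, Finset.sum_sub_distrib, hxa, hxb, sub_zero]
  have hx0 := hxs 0 (Nat.zero_le _)
  simp only [coeff_zero_eq_constantCoeff_apply, hτ.const] at hx0
  have ha1 : ∑ c, x c * (g c ^ a - g c ^ 1) = 0 := by
    simp only [mul_sub, Finset.sum_sub_distrib, hxa, pow_one, hx0, sub_zero]
  rw [hsplit, hg1, one_pow, one_pow, sub_self, mul_zero, zero_add] at hba ha1
  have hpos : 0 < P.ord (g c₁) := by rw [hg]; exact_mod_cast hj1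
  by_cases hxI : ∃ c ∈ I, x c ≠ 0
  swap
  · push Not at hxI
    rw [Finset.sum_eq_zero fun c hc => by rw [hxI c hc, zero_mul], add_zero] at ha1
    have hx1 : x c₁ = 0 := (mul_eq_zero.1 ha1).resolve_right
      (P.ord_pow_sub_pow (hg0 c₁) hpos (by omega : 1 < a)).1
    rw [hsplit, hx1, Finset.sum_eq_zero fun c hc => by rw [hxI c hc, zero_mul], hg1, mul_one,
      zero_mul, add_zero, add_zero] at hx0
    funext c
    by_cases hc0 : c = c₀
    · rw [hc0, hx0]; rfl
    by_cases hc1 : c = c₁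
    · rw [hc1, hx1]; rfl
    by_cases hci : c ≤ i
    · exact hxI c ((hI c).2 ⟨hcases c hc0 hc1, hci⟩)
    · exact hx c (not_le.1 hci)
  exfalso
  obtain ⟨M, hM, r, hrI, hr⟩ := P.exists_min_order I x j hxI
  have hx1 : P.ge (M + 1 - j c₁) (x c₁) := by
    by_cases h0 : x c₁ = 0
    · simp [h0, Place.ge]
    obtain ⟨h1, h2⟩ := P.ord_pow_sub_pow (hg0 c₁) hpos hab
    have h3 : P.ge (M + (a - 1) * (j c₁ + 1)) (∑ c ∈ I, x c * (g c ^ b - g c ^ a)) := by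
      refine ge.sum fun c hc => ((hM c hc).mul (P.ge_pow_sub_pow (by positivity) (hgge c)
        hab.le)).mono ?_
      have h4 : (j c₁ : ℤ) + 1 ≤ j c := by have := hjI c hc; omega
      have h5 : (1 : ℤ) ≤ a - 1 := by omega
      nlinarith
    have h4 : P.ge (M + (a - 1) * (j c₁ + 1)) (x c₁ * (g c₁ ^ b - g c₁ ^ a)) := by
      rw [eq_neg_of_add_eq_zero_left hba]
      exact h3.neg
    have h5 := h4.le_ord (mul_ne_zero h0 h1)
    rw [P.ord_mul h0 h1, h2, hg] at h5
    rw [P.ge_iff_le_ord h0]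
    have h6 : (2 : ℤ) ≤ a := by exact_mod_cast ha
    nlinarith
  have hcoef : ∀ s ≤ j i - j c₂, P.ge (M + 1 - s) (∑ c ∈ I, x c * coeff s (τ (g c))) := by
    intro s hs
    rcases Nat.eq_zero_or_pos s with rfl | hspos
    · simp only [coeff_zero_eq_constantCoeff_apply, hτ.const]
      have h1 : ∑ c ∈ I, x c * g c = ∑ c ∈ I, x c * g c ^ a + x c₁ * (g c₁ ^ a - g c₁ ^ 1) := by
        simp only [mul_sub, Finset.sum_sub_distrib, pow_one] at ha1 ⊢
        linear_combination -ha1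
      rw [h1]
      refine (ge.sum fun c hc => ((hM c hc).mul ((hgge c).pow a)).mono ?_).add
        ((hx1.mul (P.ge_pow_sub_pow (by positivity) (hgge c₁) (by omega : 1 ≤ a))).mono ?_)
      · have h4 : (1 : ℤ) ≤ j c := by have := hjI c hc; omega
        have h6 : (2 : ℤ) ≤ a := by exact_mod_cast ha
        push_cast
        nlinarith
      · push_cast
        linarith
    · have h1 := hxs s hs
      rw [hsplit, hg1, map_one, coeff_one, if_neg hspos.ne', mul_zero, zero_add] at h1
      rw [eq_neg_of_add_eq_zero_right h1]
      exact ((hx1.mul (ge.coeff_taylor hP hπ hτ (hgge c₁) s)).mono (by linarith)).neg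
  refine hr ?_
  have hg2 : P.ge (-j c₂) (g c₂)⁻¹ := by
    have := P.ge_ord (g c₂)⁻¹
    rwa [P.ord_inv, hg] at this
  have hfin := ge_of_coeff_taylor_sum hP hπ hτ I x (fun c => (g c₂)⁻¹ * g c) (fun c => j c - j c₂)
    (fun c _ => mul_ne_zero (inv_ne_zero (hg0 _)) (hg0 c))
    (fun c hc => by
      rw [P.ord_mul (inv_ne_zero (hg0 _)) (hg0 c), P.ord_inv, hg, hg]
      have := hjI c hc
      omega)
    (fun c hc d hd hcd => hj.injective (by
      have h1 := hjI c hc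
      have h2 := hjI d hd
      simp only at hcd
      omega)) (M - j c₂)
    (fun c hc => (hM c hc).mono (by have := hjI c hc; omega))
    (fun c hc => by
      set s := j c - j c₂ with hs
      have hsS : s ≤ j i - j c₂ := by
        have := hj.monotone ((hI c).1 hc).2
        omega
      have h1 : ∑ d ∈ I, x d * coeff s (τ ((g c₂)⁻¹ * g d)) =
          coeff s (τ (g c₂)⁻¹ * ∑ d ∈ I, C (x d) * τ (g d)) := by
        rw [Finset.mul_sum, map_sum]
        refine Finset.sum_congr rfl fun d _ => ?_
        rw [map_mul, mul_left_comm, coeff_C_mul]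
      rw [h1, coeff_mul]
      refine ge.sum fun e he => ?_
      have he' := Finset.HasAntidiagonal.mem_antidiagonal.1 he
      have h2 := hcoef e.2 (by omega)
      rw [map_sum]
      simp only [coeff_C_mul]
      exact ((ge.coeff_taylor hP hπ hτ hg2 e.1).mul h2).mono (by omega))
    r hrI
  exact hfin.mono (by have := hjI r hrI; omega)

end Place

end LocalLemma

section BaseCoeff

variable {K L : Type*} [Field K] [Field L] [Algebra K L] {n : ℕ}

theorem Place.exists_ord_eq_baseCoeff (P : Place K L) (f : Fin (n + 1) → L) (hf : ∃ j, f j ≠ 0) :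
    ∃ j₀, f j₀ ≠ 0 ∧ P.ord (f j₀) = -P.baseCoeff f ∧ ∀ j, P.ge (-P.baseCoeff f) (f j) := by
  obtain ⟨j₀, -, h⟩ := Finset.exists_mem_eq_sup' (Finset.univ_nonempty (α := Fin (n + 1)))
    (fun i => P.v (f i))
  have hle : ∀ j, P.v (f j) ≤ P.v (f j₀) := fun j => by
    rw [← h]
    exact Finset.le_sup' (fun i => P.v (f i)) (Finset.mem_univ j)
  have h0 : f j₀ ≠ 0 := by
    intro h0
    obtain ⟨j, hj⟩ := hf
    have := hle j
    rw [h0, map_zero, le_zero_iff] at this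
    exact P.v_ne_zero hj this
  have h1 : P.ord (f j₀) = -P.baseCoeff f := by
    rw [Place.baseCoeff, h, Place.ord]
  refine ⟨j₀, h0, h1, fun j => ?_⟩
  rw [← h1, Place.ge, ← P.v_eq_exp h0]
  exact hle j

end BaseCoeff

section Frob

variable {K L : Type*} [Field K] [Field L] [Algebra K L]
variable {p : ℕ} [Fact p.Prime] [CharP L p] {t : L} {τ : L →ₐ[K] PowerSeries L} {n : ℕ}
variable {f : Fin (n + 1) → L} {a b : ℕ}

theorem frobOrderSeq_eq (ht : IsPBasis p t) (hτ : IsTaylor t τ)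
    (hne : {ρ | frobDet K t f a b ρ ≠ 0}.Nonempty) : frobOrderSeq K t f a b =
      lexMin {ρ | (frobMatrix (fun s j => coeff s (τ (f j))) (fun j => f j ^ b)
        (fun j => f j ^ a) ρ).det ≠ 0} := by
  simp only [frobOrderSeq, frobDet_eq ht hτ] at hne ⊢
  exact isRowFamily_frobMatrix.lexMin_strictMono_eq hne

theorem frobDet_frobOrderSeq_ne_zero (ht : IsPBasis p t) (hτ : IsTaylor t τ)
    (hne : {ρ | frobDet K t f a b ρ ≠ 0}.Nonempty) :
    frobDet K t f a b (frobOrderSeq K t f a b) ≠ 0 := by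
  rw [frobOrderSeq_eq ht hτ hne, frobDet_eq ht hτ]
  simp only [frobDet_eq ht hτ] at hne
  exact lexMin_mem hne

theorem jet_eq_sum_of_lt (ht : IsPBasis p t) (hτ : IsTaylor t τ)
    (hne : {ρ | frobDet K t f a b ρ ≠ 0}.Nonempty) {l : Fin (n - 1)} {s : ℕ}
    (hs : s < frobOrderSeq K t f a b l) :
    ∃ c : Fin (n + 1) → L, (∀ x, derivRow l ≤ x → c x = 0) ∧
      (fun j => coeff s (τ (f j))) = ∑ x, c x • frobMatrix (fun s j => coeff s (τ (f j)))
        (fun j => f j ^ b) (fun j => f j ^ a) (frobOrderSeq K t f a b) x := by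
  have hκ := frobOrderSeq_eq ht hτ hne
  simp only [frobDet_eq ht hτ] at hne
  obtain ⟨c, hc, h⟩ := isRowFamily_frobMatrix.exists_eq_sum_of_lt hne hκ hs
  refine ⟨c, fun x hx => ?_, h⟩
  rw [Fin.le_def, derivRow] at hx
  simp only at hx
  obtain ⟨l', rfl⟩ := exists_derivRow (i := x) (by omega) (by omega)
  refine hc l' ?_
  simp only [derivRow] at hx
  rw [Fin.le_def]
  omega

theorem det_frobMatrix_change (hn : 2 ≤ n) (ht : IsPBasis p t) (hτ : IsTaylor t τ)
    (hne : {ρ | frobDet K t f a b ρ ≠ 0}.Nonempty) {τ' : L →ₐ[K] PowerSeries L}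
    (hτ' : ∀ g, constantCoeff (τ' g) = g) {g : Fin (n + 1) → L} {h : L}
    {M : Matrix (Fin (n + 1)) (Fin (n + 1)) K} (hg : ∀ c, g c = h * transform M f c)
    {α β : ℕ} (ha : a = p ^ α) (hb : b = p ^ β) (hMa : ∀ i j, M i j ^ a = M i j)
    (hMb : ∀ i j, M i j ^ b = M i j) :
    (frobMatrix (fun s c => coeff s (τ' (g c))) (fun c => g c ^ b) (fun c => g c ^ a)
        (frobOrderSeq K t f a b)).det =
      (h ^ b * (h ^ a * ∏ l, h * coeff 1 (τ' t) ^ frobOrderSeq K t f a b l)) *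
        (frobDet K t f a b (frobOrderSeq K t f a b) * algebraMap K L M.det) := by
  set κ := frobOrderSeq K t f a b with hκ
  let d : Fin (n + 1) → L := fun i => if h0 : (i : ℕ) = 0 then h ^ b
    else if h1 : (i : ℕ) = 1 then h ^ a else h * coeff 1 (τ' t) ^ κ ⟨i - 2, by omega⟩
  let A : Matrix (Fin (n + 1)) (Fin (n + 1)) L := Matrix.of fun i => transform M
    (frobMatrix (fun s j => coeff s (τ (f j))) (fun j => f j ^ b) (fun j => f j ^ a) κ i)
  have hA : ∀ i, A i = transform M
    (frobMatrix (fun s j => coeff s (τ (f j))) (fun j => f j ^ b) (fun j => f j ^ a) κ i) :=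
    fun _ => rfl
  rw [frobDet_eq ht hτ, ← det_transform, det_eq_of_triangular A _ d, prod_derivRow hn]
  · simp [d, derivRow, A]
  intro i
  by_cases h0 : (i : ℕ) = 0
  · refine ⟨0, fun _ _ => rfl, ?_⟩
    rw [frobMatrix_zero h0, hA, frobMatrix_zero h0, show d i = h ^ b from dif_pos h0]
    funext c
    simp [transform_pow hb hMb hg]
  by_cases h1 : (i : ℕ) = 1
  · refine ⟨0, fun _ _ => rfl, ?_⟩
    rw [frobMatrix_one h1, hA, frobMatrix_one h1,
      show d i = h ^ a from (dif_neg h0).trans (dif_pos h1)]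
    funext c
    simp [transform_pow ha hMa hg]
  obtain ⟨l, rfl⟩ := exists_derivRow h0 h1
  have hd : d (derivRow l) = h * coeff 1 (τ' t) ^ κ l := by simp [d, derivRow]
  have hs : ∀ s, ∃ c : Fin (n + 1) → L, s < κ l → (∀ x, derivRow l ≤ x → c x = 0) ∧
      (fun j => coeff s (τ (f j))) = ∑ x, c x • frobMatrix (fun s j => coeff s (τ (f j)))
        (fun j => f j ^ b) (fun j => f j ^ a) κ x := fun s => by
    by_cases hs : s < κ l
    · obtain ⟨c, hc⟩ := jet_eq_sum_of_lt ht hτ hne hs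
      exact ⟨c, fun _ => hc⟩
    · exact ⟨0, fun h => absurd h hs⟩
  choose c hc using hs
  refine ⟨fun x => ∑ s ∈ Finset.range (κ l), transCoeff τ' t h (κ l) s * c s x, fun x hx => ?_, ?_⟩
  · refine Finset.sum_eq_zero fun s hs => ?_
    rw [(hc s (Finset.mem_range.1 hs)).1 x hx, mul_zero]
  · rw [frobMatrix_derivRow, jet_change ht hτ hτ' hg, Finset.sum_range_succ, add_comm (Finset.sum _ _), hd,
      transCoeff_self hτ', hA, frobMatrix_derivRow]
    congr 1
    simp only [Finset.sum_smul, hA]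
    rw [Finset.sum_comm]
    refine Finset.sum_congr rfl fun s hs => ?_
    conv_lhs => rw [(hc s (Finset.mem_range.1 hs)).2, transform_sum]
    rw [Finset.smul_sum]
    refine Finset.sum_congr rfl fun x _ => ?_
    rw [transform_smul, smul_smul]

theorem Place.frobCoeff_eq (hn : 2 ≤ n) (ht : IsPBasis p t) (hτ : IsTaylor t τ)
    (hne : {ρ | frobDet K t f a b ρ ≠ 0}.Nonempty) (P : Place K L) {π : L} (hπ : P.ord π = 1)
    {τ' : L →ₐ[K] PowerSeries L} (hτ' : IsTaylor π τ') {g : Fin (n + 1) → L} {h : L}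
    {M : Matrix (Fin (n + 1)) (Fin (n + 1)) K} (hg : ∀ c, g c = h * transform M f c)
    (hM : M.det ≠ 0) (hh : h ≠ 0) (hhb : P.ord h = P.baseCoeff f)
    {α β : ℕ} (ha : a = p ^ α) (hb : b = p ^ β) (hMa : ∀ i j, M i j ^ a = M i j)
    (hMb : ∀ i j, M i j ^ b = M i j) :
    (frobMatrix (fun s c => coeff s (τ' (g c))) (fun c => g c ^ b) (fun c => g c ^ a)
        (frobOrderSeq K t f a b)).det ≠ 0 ∧
    P.frobCoeff t f a b = P.ord (frobMatrix (fun s c => coeff s (τ' (g c))) (fun c => g c ^ b)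
      (fun c => g c ^ a) (frobOrderSeq K t f a b)).det := by
  have hD := hτ.derivation_self
  have h1 := ht.derivation_eq hD (taylorDerivation τ' hτ'.const) π
  rw [hτ'.derivation_self, smul_eq_mul] at h1
  change 1 = _ * coeff 1 (τ' t) at h1
  have hδ : coeff 1 (τ' t) ≠ 0 := fun h0 => by simp [h0] at h1
  have hDπ : taylorDerivation τ hτ.const π ≠ 0 := fun h0 => by simp [h0] at h1
  have h2 : P.ordDiff (KaehlerDifferential.D K L t) = P.ord (coeff 1 (τ' t)) := by
    rw [P.ordDiff_eq ht hD hπ]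
    have := P.ord_mul hDπ hδ
    rw [← h1, P.ord_one] at this
    omega
  have hA := frobDet_frobOrderSeq_ne_zero ht hτ hne
  have hM' : algebraMap K L M.det ≠ 0 := by simpa using hM
  have hterm : ∀ l, h * coeff 1 (τ' t) ^ frobOrderSeq K t f a b l ≠ 0 := fun l =>
    mul_ne_zero hh (pow_ne_zero _ hδ)
  have hprod : (∏ l, h * coeff 1 (τ' t) ^ frobOrderSeq K t f a b l) ≠ 0 :=
    Finset.prod_ne_zero_iff.2 fun l _ => hterm l
  have h3 : h ^ a * ∏ l, h * coeff 1 (τ' t) ^ frobOrderSeq K t f a b l ≠ 0 :=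
    mul_ne_zero (pow_ne_zero _ hh) hprod
  rw [det_frobMatrix_change hn ht hτ hne hτ'.const hg ha hb hMa hMb]
  refine ⟨mul_ne_zero (mul_ne_zero (pow_ne_zero _ hh) h3) (mul_ne_zero hA hM'), ?_⟩
  rw [P.ord_mul (mul_ne_zero (pow_ne_zero _ hh) h3) (mul_ne_zero hA hM'),
    P.ord_mul (pow_ne_zero _ hh) h3, P.ord_mul (pow_ne_zero _ hh) hprod, P.ord_mul hA hM',
    P.ord_algebraMap, P.ord_prod _ _ (fun l _ => hterm l), P.ord_pow, P.ord_pow,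
    Place.frobCoeff, h2, ← hhb]
  have h4 : ∀ l, P.ord (h * coeff 1 (τ' t) ^ frobOrderSeq K t f a b l) =
      P.ord h + frobOrderSeq K t f a b l * P.ord (coeff 1 (τ' t)) := fun l => by
    rw [P.ord_mul hh (pow_ne_zero _ hδ), P.ord_pow]
  simp only [h4, Finset.sum_add_distrib, Finset.sum_const, Finset.card_univ, Fintype.card_fin,
    ← Finset.sum_mul, nsmul_eq_mul]
  push_cast [Nat.cast_sub (by omega : 1 ≤ n)]
  ring

variable [IsAlgClosed K] [IsCurveField K L]

/-- The local estimate away from the rational points, together with its improvement at points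
that are fixed by the `d`-th power Frobenius map. -/
theorem Place.frobCoeff_ge (hn : 2 ≤ n) (ht : IsPBasis p t) (hτ : IsTaylor t τ)
    (hne : {ρ | frobDet K t f a b ρ ≠ 0}.Nonempty) (hf : ∃ j, f j ≠ 0) (P : Place K L)
    {α β : ℕ} (ha : a = p ^ α) (hb : b = p ^ β) (N : ℤ)
    (hP : ∀ i j, f i ≠ 0 → P.ge 0 (f j / f i) →
      P.ge N ((f j / f i) ^ b - (f j / f i) ^ a)) : N ≤ P.frobCoeff t f a b := by
  obtain ⟨j₀, h0, h1, h2⟩ := P.exists_ord_eq_baseCoeff f hf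
  obtain ⟨π, hπ⟩ := P.exists_ord_eq_one
  have hPB := ht.of_ord_eq_one P hπ
  obtain ⟨τ', hτ'⟩ := P.exists_taylor hπ hPB
  have hg : ∀ c, f c / f j₀ = (f j₀)⁻¹ * transform (1 : Matrix _ _ K) f c := fun c => by
    simp [transform, Matrix.one_apply, div_eq_inv_mul]
  have hge : ∀ c, P.ge 0 (f c / f j₀) := fun c => by
    have h3 := (h2 c).mul (P.ge_ord (f j₀)⁻¹)
    rw [P.ord_inv, h1] at h3
    exact (div_eq_mul_inv (f c) _ ▸ h3).mono (by omega)
  have hpos : ∀ e k : ℕ, e = p ^ k → e ≠ 0 := fun e k h => by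
    rw [h]; exact pow_ne_zero _ (Fact.out : p.Prime).ne_zero
  have hone : ∀ e k : ℕ, e = p ^ k → ∀ i j, (1 : Matrix (Fin (n + 1)) (Fin (n + 1)) K) i j ^ e =
      (1 : Matrix (Fin (n + 1)) (Fin (n + 1)) K) i j := fun e k h i j => by
    rw [Matrix.one_apply]
    split_ifs
    · exact one_pow _
    · exact zero_pow (hpos e k h)
  obtain ⟨h3, h4⟩ := P.frobCoeff_eq hn ht hτ hne hπ hτ' hg (by simp) (inv_ne_zero h0)
    (by rw [P.ord_inv, h1, neg_neg]) ha hb (hone a α ha) (hone b β hb)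
  rw [h4]
  refine Place.ge.le_ord ?_ h3
  set B := frobMatrix (fun s c => coeff s (τ' (f c / f j₀))) (fun c => (f c / f j₀) ^ b)
    (fun c => (f c / f j₀) ^ a) (frobOrderSeq K t f a b) with hB
  have h01 : (⟨0, by omega⟩ : Fin (n + 1)) ≠ ⟨1, by omega⟩ := by simp
  rw [← Matrix.det_updateRow_add_smul_self B h01 (-1)]
  have h5 := P.ge_det (B.updateRow ⟨0, by omega⟩ (B ⟨0, by omega⟩ + (-1 : L) • B ⟨1, by omega⟩))
    (fun i => if (i : ℕ) = 0 then N else 0) (fun _ => 0) (fun i c => by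
      by_cases hi0 : (i : ℕ) = 0
      · obtain rfl : i = ⟨0, Nat.succ_pos n⟩ := Fin.ext hi0
        rw [Matrix.updateRow_self, Pi.add_apply, Pi.smul_apply, hB, frobMatrix_zero rfl,
          frobMatrix_one rfl]
        simp only [if_true, add_zero, neg_smul, one_smul, ← sub_eq_add_neg]
        exact hP j₀ c h0 (hge c)
      rw [Matrix.updateRow_ne (fun h => hi0 (by rw [h])), if_neg hi0, add_zero, hB]
      by_cases hi1 : (i : ℕ) = 1
      · rw [frobMatrix_one hi1]
        have := (hge c).pow a
        rwa [MulZeroClass.mul_zero] at this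
      obtain ⟨l, rfl⟩ := exists_derivRow hi0 hi1
      rw [frobMatrix_derivRow]
      exact Place.ge.coeff_taylor_regular hPB hπ hτ' (hge c) _)
  have h6 : ∑ i : Fin (n + 1), (if (i : ℕ) = 0 then N else 0) = N := by
    rw [sum_derivRow hn]
    simp [derivRow]
  rw [h6, Finset.sum_const_zero, add_zero] at h5
  exact h5

end Frob

section Rational

variable {K L : Type*} [Field K] [Field L] [Algebra K L]
variable {p : ℕ} [Fact p.Prime] [CharP L p] {t : L} {τ : L →ₐ[K] PowerSeries L} {n : ℕ}
variable {f : Fin (n + 1) → L} {a b : ℕ} [IsAlgClosed K] [IsCurveField K L]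
variable {k₀ : Type*} [Field k₀] [Algebra k₀ K] [Algebra k₀ L] [IsScalarTower k₀ K L]

/-- A normalized basis with distinct orders at `P`. -/
theorem Place.exists_normalized_basis (P : Place K L) (hf : LinearIndependent k₀ f)
    (hres : ∀ x ∈ Submodule.span k₀ (Set.range f), ∀ y ∈ Submodule.span k₀ (Set.range f), y ≠ 0 →
      P.ge (P.ord y) x → ∃ a : k₀, P.ge (P.ord y + 1) (x - a • y)) :
    ∃ (M : Matrix (Fin (n + 1)) (Fin (n + 1)) k₀) (h : L) (g : Fin (n + 1) → L)
      (j : Fin (n + 1) → ℕ), M.det ≠ 0 ∧ h ≠ 0 ∧ P.ord h = P.baseCoeff f ∧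
      (∀ c, g c = h * transform (M.map (algebraMap k₀ K)) f c) ∧ g 0 = 1 ∧ StrictMono j ∧
      (∀ c, g c ≠ 0) ∧ ∀ c, P.ord (g c) = j c := by
  obtain ⟨M, M', hMM, h0, hmono⟩ := P.exists_hermite_basis f hf hres
  have hT : ∀ c, transform (M.map (algebraMap k₀ K)) f c = ∑ j, M c j • f j := fun c => by
    simp [transform]
  have hdet : M.det ≠ 0 := by
    intro h
    have := congrArg Matrix.det hMM
    rw [Matrix.det_mul, h, mul_zero, Matrix.det_one] at this
    exact zero_ne_one this
  have hge : ∀ c, P.ge (P.ord (∑ j, M 0 j • f j)) (∑ j, M c j • f j) := fun c =>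
    (P.ge_ord _).mono (hmono.monotone (Fin.zero_le c))
  have hsm : ∀ (e : k₀) {y : L} {m : ℤ}, P.ge m y → P.ge m (e • y) := fun e y m hy => by
    rw [← algebraMap_smul K e y]
    exact hy.smul _
  have hf' : ∀ i, f i = ∑ c, M' i c • ∑ j, M c j • f j := fun i => by
    simp only [Finset.smul_sum, smul_smul]
    rw [Finset.sum_comm]
    simp only [← Finset.sum_smul, ← Matrix.mul_apply, hMM, Matrix.one_apply, ite_smul, one_smul,
      zero_smul, Finset.sum_ite_eq, Finset.mem_univ, if_true]
  have hbase : P.ord (∑ j, M 0 j • f j) = -P.baseCoeff f := by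
    obtain ⟨j₀, h1, h2, h3⟩ := P.exists_ord_eq_baseCoeff f ⟨0, hf.ne_zero 0⟩
    apply le_antisymm
    · rw [← h2]
      refine Place.ge.le_ord ?_ h1
      rw [hf' j₀]
      exact Place.ge.sum fun c _ => hsm _ (hge c)
    · exact Place.ge.le_ord (Place.ge.sum fun j _ => hsm _ (h3 j)) (h0 0)
  refine ⟨M, (∑ j, M 0 j • f j)⁻¹, fun c => (∑ j, M 0 j • f j)⁻¹ * ∑ j, M c j • f j,
    fun c => (P.ord (∑ j, M c j • f j) - P.ord (∑ j, M 0 j • f j)).toNat, hdet,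
    inv_ne_zero (h0 0), by rw [P.ord_inv, hbase, neg_neg], fun c => by rw [hT],
    inv_mul_cancel₀ (h0 0), fun c d hcd => ?_, fun c => mul_ne_zero (inv_ne_zero (h0 0)) (h0 c),
    fun c => ?_⟩
  · have h1 : P.ord (∑ j, M c j • f j) < P.ord (∑ j, M d j • f j) := hmono hcd
    have h2 : P.ord (∑ j, M 0 j • f j) ≤ P.ord (∑ j, M c j • f j) :=
      hmono.monotone (Fin.zero_le c)
    simp only
    omega
  · rw [P.ord_mul (inv_ne_zero (h0 0)) (h0 c), P.ord_inv]
    have h2 : P.ord (∑ j, M 0 j • f j) ≤ P.ord (∑ j, M c j • f j) :=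
      hmono.monotone (Fin.zero_le c)
    simp only
    omega

/-- The jets of linearly independent functions span. -/
theorem eq_zero_of_forall_jet (ht : IsPBasis p t) (hτ : IsTaylor t τ)
    (hf : LinearIndependent K f) {x : Fin (n + 1) → L}
    (hx : ∀ s, ∑ c, x c * coeff s (τ (f c)) = 0) : x = 0 := by
  obtain ⟨P⟩ : Nonempty (Place K L) := (infinite_place (K := K) (L := L)).nonempty
  obtain ⟨π, hπ⟩ := P.exists_ord_eq_one
  have hPB := ht.of_ord_eq_one P hπ
  obtain ⟨τ', hτ'⟩ := P.exists_taylor hπ hPB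
  obtain ⟨M, h, g, j, hM, hh, -, hg, -, hj, hg0, hgj⟩ := P.exists_normalized_basis hf
    (fun x _ y _ hy0 hxy => by
      have h1 : P.ge 0 (x * y⁻¹) := by
        have := hxy.mul (P.ge_ord y⁻¹)
        rw [P.ord_inv] at this
        exact this.mono (by omega)
      refine ⟨P.eval (x * y⁻¹), ?_⟩
      have h2 := h1.sub_eval.mul (P.ge_ord y)
      rw [sub_mul, inv_mul_cancel_right₀ hy0, ← Algebra.smul_def] at h2
      exact h2.mono (by omega))
  have hM1 : M⁻¹ * M = 1 := Matrix.nonsing_inv_mul _ (isUnit_iff_ne_zero.2 hM)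
  let x' : Fin (n + 1) → L := fun c => ∑ i, algebraMap K L (M⁻¹ i c) * x i
  have hxx : ∀ i, x i = ∑ c, x' c * algebraMap K L (M c i) := fun i => by
    simp only [x', Finset.sum_mul]
    rw [Finset.sum_comm]
    have : ∀ l, ∑ c, algebraMap K L (M⁻¹ l c) * x l * algebraMap K L (M c i) =
        algebraMap K L ((M⁻¹ * M) l i) * x l := fun l => by
      rw [Matrix.mul_apply, map_sum, Finset.sum_mul]
      refine Finset.sum_congr rfl fun c _ => ?_
      rw [map_mul]
      ring
    simp only [this, hM1, Matrix.one_apply]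
    simp
  have hkill : ∀ s, ∑ c, x' c * coeff s (τ' (g c)) = 0 := fun s => by
    refine jet_annihilator ht hτ hτ'.const hg fun i _ => ?_
    rw [← hx i]
    simp only [transform, Finset.mul_sum]
    rw [Finset.sum_comm]
    refine Finset.sum_congr rfl fun l _ => ?_
    rw [hxx l, Finset.sum_mul]
    refine Finset.sum_congr rfl fun c _ => ?_
    simp [Algebra.smul_def, mul_assoc]
  have h1 := Place.eq_zero_of_coeff_taylor_sum hPB hπ hτ' Finset.univ x' g j (fun c _ => hg0 c)
    (fun c _ => hgj c) hj.injective.injOn (fun c _ => hkill (j c))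
  funext i
  rw [hxx i]
  simp [fun c => h1 c (Finset.mem_univ c)]

theorem frobDet_nonempty (hn : 2 ≤ n) (ht : IsPBasis p t) (hτ : IsTaylor t τ)
    (hf : LinearIndependent K f) (hab : a < b) :
    {ρ | frobDet K t f a b ρ ≠ 0}.Nonempty := by
  simp only [frobDet_eq ht hτ]
  refine exists_frobMatrix_det_ne_zero hn (fun x hx => eq_zero_of_forall_jet ht hτ hf hx)
    fun α β hαβ => ?_
  have h0 : f 0 ≠ 0 := hf.ne_zero 0
  have h01 : (0 : Fin (n + 1)) ≠ ⟨1, by omega⟩ := by simp [Fin.ext_iff]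
  have hα : α = 0 := by
    by_contra hα
    set z := f ⟨1, by omega⟩ / f 0 with hz
    have h1 := congrFun hαβ 0
    have h2 := congrFun hαβ ⟨1, by omega⟩
    simp only [Pi.add_apply, Pi.smul_apply, smul_eq_mul, Pi.zero_apply] at h1 h2
    have hz' : f ⟨1, by omega⟩ = z * f 0 := by rw [hz, div_mul_cancel₀ _ h0]
    rw [hz', mul_pow, mul_pow] at h2
    have h3 : α * f 0 ^ b * (z ^ b - z ^ a) = 0 := by linear_combination h2 - z ^ a * h1
    have h4 : z ^ b - z ^ a = 0 :=
      (mul_eq_zero.1 h3).resolve_left (mul_ne_zero hα (pow_ne_zero _ h0))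
    have h5 : z ∈ Set.range (algebraMap K L) := by
      by_contra hz
      refine aeval_ne_zero_of_notMem_range hz (p := (Polynomial.X ^ b - Polynomial.X ^ a)) ?_
        (by simp [h4])
      intro h6
      have := congrArg (fun q => Polynomial.coeff q b) h6
      simp [Polynomial.coeff_X_pow, hab.ne'] at this
    obtain ⟨c, hc⟩ := h5
    have h6 := linearIndependent_iff'.1 hf {0, ⟨1, by omega⟩}
      (fun i => if i = 0 then c else -1) (by
        rw [Finset.sum_pair h01, if_pos rfl, if_neg h01.symm, Algebra.smul_def, hc, hz']
        simp) ⟨1, by omega⟩ (by simp)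
    rw [if_neg h01.symm] at h6
    exact one_ne_zero (neg_eq_zero.1 h6)
  refine ⟨hα, ?_⟩
  have h1 := congrFun hαβ 0
  simp only [hα, Pi.add_apply, Pi.smul_apply, smul_eq_mul, Pi.zero_apply, zero_mul, zero_add] at h1
  exact (mul_eq_zero.1 h1).resolve_right (pow_ne_zero _ h0)

section Bounds

variable {P : Place K L} {π h : L} {τ' : L →ₐ[K] PowerSeries L} {g : Fin (n + 1) → L}
  {M : Matrix (Fin (n + 1)) (Fin (n + 1)) K} {j : Fin (n + 1) → ℕ}

theorem card_subtype_lt (m : ℕ) (hm : m ≤ n + 1) :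
    Fintype.card {x : Fin (n + 1) // (x : ℕ) < m} = m := by
  rw [Fintype.card_subtype, Fin.card_filter_val_lt, min_eq_right hm]

/-- The order-sequence is bounded by the sequence of orders at a point. -/
theorem orderSeq_le (hn : 2 ≤ n) (ht : IsPBasis p t) (hτ : IsTaylor t τ) (hPB : IsPBasis p π)
    (hπ : P.ord π = 1) (hτ' : IsTaylor π τ') (hg : ∀ c, g c = h * transform M f c)
    (hj : StrictMono j) (hg0 : ∀ c, g c ≠ 0) (hgj : ∀ c, P.ord (g c) = j c) :
    orderSeq K t f ⟨2, by omega⟩ ≤ j ⟨2, by omega⟩ := by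
  set R : (Fin (n + 1) → ℕ) → Matrix (Fin (n + 1)) (Fin (n + 1)) L :=
    fun ε => Matrix.of fun i c => coeff (ε i) (τ (f c)) with hR
  have hfam : IsRowFamily R (fun s c => coeff s (τ (f c))) id :=
    ⟨Function.injective_id, fun ρ l => rfl, fun ρ ρ' i hi => absurd ⟨i, rfl⟩ hi⟩
  have hε : orderSeq K t f = lexMin {ε | (R ε).det ≠ 0} := by
    simp only [orderSeq, hτ.hasseDeriv_eq ht, hR]
  by_cases hne : {ε | (R ε).det ≠ 0}.Nonempty
  swap
  · rw [hε, lexMin, dif_neg hne]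
    exact Nat.zero_le _
  by_contra hlt
  rw [not_le] at hlt
  let I : Finset (Fin (n + 1)) := Finset.univ.filter fun c => (c : ℕ) < 3
  have hI : I.card = 3 := by
    rw [Fin.card_filter_val_lt, min_eq_right (by omega)]
  obtain ⟨x, hx0, hxI, hx⟩ := exists_annihilator I (β := {x : Fin (n + 1) // (x : ℕ) < 2})
    (by rw [card_subtype_lt 2 (by omega), hI]; omega)
    (fun i => transform M (R (orderSeq K t f) i))
  have hkill : ∀ s ≤ j ⟨2, by omega⟩, ∑ c, x c * coeff s (τ' (g c)) = 0 := fun s hs => by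
    refine jet_annihilator ht hτ hτ'.const hg fun i hi => ?_
    obtain ⟨c, hc, hw⟩ := hfam.exists_eq_sum_of_lt hne hε (lt_of_le_of_lt (hi.trans hs) hlt)
    rw [hw, transform_sum]
    simp only [Finset.sum_apply, Finset.mul_sum]
    rw [Finset.sum_comm]
    refine Finset.sum_eq_zero fun y _ => ?_
    simp only [transform_smul, Pi.smul_apply, smul_eq_mul]
    rw [Finset.sum_congr rfl fun d _ => mul_left_comm (x d) _ _, ← Finset.mul_sum]
    by_cases hy : (y : ℕ) < 2
    · rw [hx ⟨y, hy⟩, mul_zero]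
    · have : c y = 0 := hc y (by rw [Fin.le_def]; exact not_lt.1 hy)
      rw [this, zero_mul]
  have hsub : ∀ F : Fin (n + 1) → L, ∑ c ∈ I, x c * F c = ∑ c, x c * F c := fun F =>
    Finset.sum_subset (Finset.subset_univ _) fun c _ hc => by rw [hxI c hc, zero_mul]
  have h1 := Place.eq_zero_of_coeff_taylor_sum hPB hπ hτ' I x g j (fun c _ => hg0 c)
    (fun c _ => hgj c) hj.injective.injOn (fun c hc => by
      rw [hsub]
      refine hkill _ (hj.monotone ?_)
      rw [Fin.le_def]
      have : (c : ℕ) < 3 := by simpa [I] using hc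
      change (c : ℕ) ≤ 2
      omega)
  refine hx0 (funext fun c => ?_)
  by_cases hc : c ∈ I
  · exact h1 c hc
  · exact hxI c hc

/-- The Frobenius order-sequence is bounded by the differences of the orders at a point. -/
theorem frobOrderSeq_le (hn : 2 ≤ n) (ht : IsPBasis p t) (hτ : IsTaylor t τ)
    (hne : {ρ | frobDet K t f a b ρ ≠ 0}.Nonempty) (hPB : IsPBasis p π)
    (hπ : P.ord π = 1) (hτ' : IsTaylor π τ') (hg : ∀ c, g c = h * transform M f c)
    (hg1 : g 0 = 1) (hj : StrictMono j) (hg0 : ∀ c, g c ≠ 0) (hgj : ∀ c, P.ord (g c) = j c)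
    {α β : ℕ} (ha : a = p ^ α) (hb : b = p ^ β) (hMa : ∀ i j, M i j ^ a = M i j)
    (hMb : ∀ i j, M i j ^ b = M i j) (ha2 : 2 ≤ a) (hab : a < b) (l : Fin (n - 1)) :
    frobOrderSeq K t f a b l ≤ j (derivRow l) - j ⟨2, by omega⟩ := by
  by_contra hlt
  rw [not_le] at hlt
  set κ := frobOrderSeq K t f a b with hκ
  let I : Finset (Fin (n + 1)) := Finset.univ.filter fun c => (c : ℕ) < l + 3
  have hI : I.card = l + 3 := by
    rw [Fin.card_filter_val_lt, min_eq_right (by omega)]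
  obtain ⟨x, hx0, hxI, hx⟩ := exists_annihilator I (β := {x : Fin (n + 1) // (x : ℕ) < l + 2})
    (by rw [card_subtype_lt (l + 2) (by omega), hI]; omega)
    (fun i => transform M (frobMatrix (fun s j => coeff s (τ (f j))) (fun j => f j ^ b)
      (fun j => f j ^ a) κ i))
  have hbase : ∀ {e k : ℕ}, e = p ^ k → (∀ i j, M i j ^ e = M i j) →
      ∑ c, x c * transform M (fun j => f j ^ e) c = 0 → ∑ c, x c * g c ^ e = 0 := by
    intro e k he hMe h1
    simp only [transform_pow he hMe hg]
    rw [Finset.sum_congr rfl fun d _ => mul_left_comm (x d) _ _, ← Finset.mul_sum, h1, mul_zero]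
  refine hx0 (Place.eq_zero_of_annihilates hPB hπ hτ' hn g j hj hg0 hg1 hgj ha2 hab (derivRow l) x
    (fun c hc => hxI c ?_) (hbase ha hMa ?_) (hbase hb hMb ?_) fun s hs => ?_)
  · rw [Fin.lt_def, derivRow] at hc
    simp only [I, Finset.mem_filter, Finset.mem_univ, true_and]
    simp only at hc
    omega
  · have := hx ⟨⟨1, by omega⟩, by simp⟩
    rwa [frobMatrix_one rfl] at this
  · have := hx ⟨⟨0, by omega⟩, by simp⟩
    rwa [frobMatrix_zero rfl] at this
  · refine jet_annihilator ht hτ hτ'.const hg fun i hi => ?_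
    obtain ⟨c, hc, hw⟩ := jet_eq_sum_of_lt ht hτ hne (lt_of_le_of_lt (hi.trans hs) hlt)
    rw [hw, transform_sum]
    simp only [Finset.sum_apply, Finset.mul_sum]
    rw [Finset.sum_comm]
    refine Finset.sum_eq_zero fun y _ => ?_
    simp only [transform_smul, Pi.smul_apply, smul_eq_mul]
    rw [Finset.sum_congr rfl fun d _ => mul_left_comm (x d) _ _, ← Finset.mul_sum]
    by_cases hy : (y : ℕ) < l + 2
    · rw [hx ⟨y, hy⟩, mul_zero]
    · have : c y = 0 := hc y (by rw [Fin.le_def]; simpa [derivRow] using hy)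
      rw [this, zero_mul]

end Bounds

/-- The local estimate at the rational points. -/
theorem Place.frobCoeff_ge_of_rational (hn : 2 ≤ n) (ht : IsPBasis p t) (hτ : IsTaylor t τ)
    (hne : {ρ | frobDet K t f a b ρ ≠ 0}.Nonempty) (P : Place K L)
    {α β : ℕ} (ha : a = p ^ α) (hb : b = p ^ β) (ha2 : 2 ≤ a) (hab : a < b)
    (hka : ∀ c : k₀, c ^ a = c) (hkb : ∀ c : k₀, c ^ b = c) (hf : LinearIndependent k₀ f)
    (hres : ∀ x ∈ Submodule.span k₀ (Set.range f), ∀ y ∈ Submodule.span k₀ (Set.range f), y ≠ 0 →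
      P.ge (P.ord y) x → ∃ a : k₀, P.ge (P.ord y + 1) (x - a • y)) :
    (a : ℤ) + orderSeq K t f ⟨2, by omega⟩ * ((n : ℤ) - 1) ≤ P.frobCoeff t f a b := by
  obtain ⟨π, hπ⟩ := P.exists_ord_eq_one
  have hPB := ht.of_ord_eq_one P hπ
  obtain ⟨τ', hτ'⟩ := P.exists_taylor hπ hPB
  obtain ⟨M, h, g, j, hM, hh, hhb, hg, hg1, hj, hg0, hgj⟩ := P.exists_normalized_basis hf hres
  have hMa : ∀ i j, M.map (algebraMap k₀ K) i j ^ a = M.map (algebraMap k₀ K) i j := fun i j => by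
    rw [Matrix.map_apply, ← map_pow, hka]
  have hMb : ∀ i j, M.map (algebraMap k₀ K) i j ^ b = M.map (algebraMap k₀ K) i j := fun i j => by
    rw [Matrix.map_apply, ← map_pow, hkb]
  have hMdet : (M.map (algebraMap k₀ K)).det ≠ 0 := by
    have := RingHom.map_det (algebraMap k₀ K) M
    rw [RingHom.mapMatrix_apply] at this
    rw [← this]
    simpa using hM
  have hκ := frobOrderSeq_le hn ht hτ hne hPB hπ hτ' hg hg1 hj hg0 hgj ha hb hMa hMb ha2 hab
  have hε := orderSeq_le hn ht hτ hPB hπ hτ' hg hj hg0 hgj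
  obtain ⟨h3, h4⟩ := P.frobCoeff_eq hn ht hτ hne hπ hτ' hg hMdet hh hhb ha hb hMa hMb
  set κ := frobOrderSeq K t f a b
  let c₀ : Fin (n + 1) := ⟨0, by omega⟩
  let c₁ : Fin (n + 1) := ⟨1, by omega⟩
  let c₂ : Fin (n + 1) := ⟨2, by omega⟩
  let l₀ : Fin (n - 1) := ⟨0, by omega⟩
  have hκ0 : κ l₀ = 0 := by
    have := hκ l₀
    have h5 : derivRow l₀ = c₂ := rfl
    rw [h5] at this
    change _ ≤ j c₂ - j c₂ at this
    omega
  set B := frobMatrix (fun s c => coeff s (τ' (g c))) (fun c => g c ^ b) (fun c => g c ^ a) κ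
    with hB
  have hB0 : B c₀ = fun c => g c ^ b := frobMatrix_zero rfl
  have hB1 : B c₁ = fun c => g c ^ a := frobMatrix_one rfl
  have hB2 : B c₂ = g := by
    have h5 : B (derivRow l₀) = fun c => coeff (κ l₀) (τ' (g c)) := frobMatrix_derivRow l₀
    rw [hκ0] at h5
    simp only [coeff_zero_eq_constantCoeff_apply, hτ'.const] at h5
    exact h5
  have h01 : c₀ ≠ c₁ := by simp [c₀, c₁]
  have h02 : c₀ ≠ c₂ := by simp [c₀, c₂]
  have h12 : c₁ ≠ c₂ := by simp [c₁, c₂]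
  set B₁ := B.updateRow c₀ (B c₀ + (-1 : L) • B c₁) with hB₁
  set B₂ := B₁.updateRow c₁ (B₁ c₁ + (-1 : L) • B₁ c₂) with hB₂
  have hdet : B₂.det = B.det := by
    rw [hB₂, Matrix.det_updateRow_add_smul_self _ h12, hB₁,
      Matrix.det_updateRow_add_smul_self _ h01]
  have hB₁1 : B₁ c₁ = fun c => g c ^ a := by rw [hB₁, Matrix.updateRow_ne h01.symm, hB1]
  have hB₁2 : B₁ c₂ = g := by rw [hB₁, Matrix.updateRow_ne h02.symm, hB2]
  have hgge : ∀ c, P.ge (j c) (g c) := fun c => hgj c ▸ P.ge_ord (g c)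
  have hj1 : 1 ≤ j c₁ := by
    have := hj (show c₀ < c₁ by simp [c₀, c₁, Fin.lt_def])
    omega
  let w : Fin (n + 1) → ℤ := fun i => if h0 : (i : ℕ) = 0 then ((a : ℤ) - 1) * j c₁
    else if h1 : (i : ℕ) = 1 then 0 else -(κ ⟨i - 2, by omega⟩ : ℤ)
  have hentry : ∀ i c, P.ge (w i + j c) (B₂ i c) := by
    intro i c
    by_cases hi0 : (i : ℕ) = 0
    · obtain rfl : i = c₀ := Fin.ext hi0
      rw [hB₂, Matrix.updateRow_ne h01, hB₁, Matrix.updateRow_self, hB0, hB1]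
      simp only [Pi.add_apply, neg_smul, one_smul, Pi.neg_apply, ← sub_eq_add_neg]
      have hw : w c₀ = ((a : ℤ) - 1) * j c₁ := dif_pos rfl
      by_cases hc : c = c₀
      · rw [hc, show g c₀ = 1 from hg1, one_pow, one_pow, sub_self]
        simp [Place.ge]
      · refine (P.ge_pow_sub_pow (by positivity) (hgge c) hab.le).mono ?_
        have h5 : j c₁ ≤ j c := hj.monotone (by
          rw [Fin.le_def]
          have : (c : ℕ) ≠ 0 := fun h => hc (Fin.ext h)
          change 1 ≤ (c : ℕ)
          omega)
        have h6 : (j c₁ : ℤ) ≤ j c := by exact_mod_cast h5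
        have h7 : (2 : ℤ) ≤ a := by exact_mod_cast ha2
        rw [hw]
        nlinarith
    by_cases hi1 : (i : ℕ) = 1
    · obtain rfl : i = c₁ := Fin.ext hi1
      rw [hB₂, Matrix.updateRow_self, hB₁1, hB₁2]
      simp only [Pi.add_apply, neg_smul, one_smul, Pi.neg_apply, ← sub_eq_add_neg]
      have hw : w c₁ = 0 := (dif_neg hi0).trans (dif_pos rfl)
      have := P.ge_pow_sub_pow (by positivity) (hgge c) (by omega : 1 ≤ a)
      rw [pow_one, Nat.cast_one, one_mul] at this
      rwa [hw, zero_add]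
    obtain ⟨l, rfl⟩ := exists_derivRow hi0 hi1
    have hw : w (derivRow l) = -(κ l : ℤ) := by simp [w, derivRow]
    rw [hB₂, Matrix.updateRow_ne (fun h => hi1 (by rw [h])), hB₁,
      Matrix.updateRow_ne (fun h => hi0 (by rw [h])), hB, frobMatrix_derivRow, hw]
    exact (Place.ge.coeff_taylor hPB hπ hτ' (hgge c) (κ l)).mono (by omega)
  have h5 := (P.ge_det B₂ w (fun c => j c) hentry).le_ord (hdet ▸ h3)
  rw [hdet, ← h4, sum_derivRow hn, sum_derivRow hn] at h5
  have hw0 : w ⟨0, by omega⟩ = ((a : ℤ) - 1) * j c₁ := dif_pos rfl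
  have hw1 : w ⟨1, by omega⟩ = 0 := (dif_neg (by simp)).trans (dif_pos rfl)
  have hwl : ∀ l, w (derivRow l) = -(κ l : ℤ) := fun l => by simp [w, derivRow]
  rw [hw0, hw1, Finset.sum_congr rfl fun l _ => hwl l, Finset.sum_neg_distrib] at h5
  have h6 : ∑ l : Fin (n - 1), (j c₂ : ℤ) ≤ ∑ l, ((j (derivRow l) : ℤ) - κ l) := by
    refine Finset.sum_le_sum fun l _ => ?_
    have h7 := hκ l
    change κ l ≤ j (derivRow l) - j c₂ at h7
    have h8 : j c₂ ≤ j (derivRow l) := hj.monotone (by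
      rw [Fin.le_def]
      change 2 ≤ (l : ℕ) + 2
      omega)
    omega
  rw [Finset.sum_const, Finset.card_univ, Fintype.card_fin, nsmul_eq_mul,
    Finset.sum_sub_distrib, Nat.cast_sub (by omega), Nat.cast_one] at h6
  change orderSeq K t f c₂ ≤ j c₂ at hε
  have h7 : (orderSeq K t f c₂ : ℤ) ≤ j c₂ := by exact_mod_cast hε
  have h8 : (1 : ℤ) ≤ n - 1 := by omega
  have h9 : (1 : ℤ) ≤ j c₁ := by exact_mod_cast hj1
  have h10 : (0 : ℤ) ≤ j c₀ := by positivity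
  have h11 : (orderSeq K t f c₂ : ℤ) * ((n : ℤ) - 1) ≤ ((n : ℤ) - 1) * j c₂ := by nlinarith
  have h12 : (a : ℤ) ≤ a * j c₁ := by
    have : (2 : ℤ) ≤ a := by exact_mod_cast ha2
    nlinarith
  change ((a : ℤ) - 1) * j c₁ + (0 + -∑ l, (κ l : ℤ)) +
    (j c₀ + (j c₁ + ∑ l, (j (derivRow l) : ℤ))) ≤ _ at h5
  change (a : ℤ) + orderSeq K t f c₂ * ((n : ℤ) - 1) ≤ _
  linarith

end Rational

section Extension

open IntermediateField IntermediateField.algebraAdjoinAdjoin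

variable {k F K L : Type*} [Field k] [Field F] [Field K] [Field L]
  [Algebra k F] [Algebra k K] [Algebra F L] [Algebra K L] [Algebra k L]
  [IsScalarTower k F L] [IsScalarTower k K L]

theorem mem_of_isPushout (k : Type*) {F K L : Type*} [Field k] [Field F] [Field K] [Field L]
    [Algebra k F] [Algebra k K] [Algebra F L] [Algebra K L] [Algebra k L]
    [IsScalarTower k F L] [IsScalarTower k K L] [h : Algebra.IsPushout k F K L] (S : Subring L)
    (hK : ∀ c : K, algebraMap K L c ∈ S) (hF : ∀ y : F, algebraMap F L y ∈ S) (y : L) :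
    y ∈ S := by
  refine h.out.inductionOn y (fun y => y ∈ S) S.zero_mem (fun c => hK c) (fun s n hn => ?_)
    (fun _ _ => S.add_mem)
  rw [Algebra.smul_def]
  exact S.mul_mem (hF s) hn

theorem algebraMap_mem_of_mem_adjoin {s : Set F} {E : IntermediateField K L}
    (hE : ∀ y ∈ s, algebraMap F L y ∈ E) {y : F} (hy : y ∈ IntermediateField.adjoin k s) :
    algebraMap F L y ∈ E := by
  let E' : IntermediateField k F :=
    { E.toSubfield.comap (algebraMap F L) with
      algebraMap_mem' := fun c => by
        change algebraMap F L (algebraMap k F c) ∈ E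
        rw [← IsScalarTower.algebraMap_apply, IsScalarTower.algebraMap_apply k K L]
        exact E.algebraMap_mem _ }
  have : IntermediateField.adjoin k s ≤ E' := IntermediateField.adjoin_le_iff.2 hE
  exact this hy

theorem essFiniteType_of_isPushout [Algebra.IsPushout k F K L]
    (hF : (⊤ : IntermediateField k F).FG) : Algebra.EssFiniteType K L := by
  classical
  rw [← IntermediateField.fg_top_iff]
  obtain ⟨S, hS⟩ := hF
  refine ⟨S.image (algebraMap F L), ?_⟩
  rw [eq_top_iff]
  intro y _
  refine mem_of_isPushout k (F := F) (IntermediateField.adjoin K _).toSubring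
    (fun c => (IntermediateField.adjoin K _).algebraMap_mem c) (fun y => ?_) y
  refine algebraMap_mem_of_mem_adjoin (k := k) (s := S) (fun z hz => ?_) (by rw [hS]; trivial)
  apply IntermediateField.subset_adjoin
  simp only [Finset.coe_image]
  exact ⟨z, hz, rfl⟩

theorem finiteDimensional_of_essFiniteType {E M : Type*} [Field E] [Field M] [Algebra E M]
    [Algebra.EssFiniteType E M] [Algebra.IsAlgebraic E M] : FiniteDimensional E M := by
  obtain ⟨S, hS⟩ := IntermediateField.fg_top E M
  have := IntermediateField.finiteDimensional_adjoin (K := E) (S := (S : Set M))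
    (fun x _ => Algebra.IsIntegral.isIntegral x)
  rw [hS] at this
  exact Module.Finite.equiv IntermediateField.topEquiv.toLinearEquiv

theorem isSeparable_adjoin_of_isSeparating [Algebra.IsPushout k F K L] {t : F}
    (ht : IsSeparating k t) : Algebra.IsSeparable K⟮algebraMap F L t⟯ L := by
  have ht' : Algebra.IsSeparable k⟮t⟯ F := ht
  let φ : k⟮t⟯ →+* K⟮algebraMap F L t⟯ :=
    ((algebraMap F L).comp (algebraMap k⟮t⟯ F)).codRestrict K⟮algebraMap F L t⟯ fun y =>
      algebraMap_mem_of_mem_adjoin (k := k) (s := {t}) (fun z hz => by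
        rw [Set.mem_singleton_iff.1 hz]
        exact IntermediateField.mem_adjoin_simple_self K _) y.2
  have hsep : ∀ y : F, IsSeparable K⟮algebraMap F L t⟯ (algebraMap F L y) := by
    intro y
    have h1 := Algebra.IsSeparable.isSeparable k⟮t⟯ y
    have h2 : Polynomial.aeval (algebraMap F L y) ((minpoly k⟮t⟯ y).map φ) = 0 := by
      rw [Polynomial.aeval_def, Polynomial.eval₂_map]
      have h3 : (algebraMap K⟮algebraMap F L t⟯ L).comp φ =
          (algebraMap F L).comp (algebraMap k⟮t⟯ F) := rfl
      rw [h3, ← Polynomial.hom_eval₂, ← Polynomial.aeval_def, minpoly.aeval, map_zero]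
    exact Polynomial.Separable.of_dvd (Polynomial.Separable.map h1) (minpoly.dvd _ _ h2)
  have h4 : ∀ y : L, y ∈ separableClosure K⟮algebraMap F L t⟯ L := fun y =>
    mem_of_isPushout k (F := F) (separableClosure K⟮algebraMap F L t⟯ L).toSubring
      (fun c => (separableClosure K⟮algebraMap F L t⟯ L).algebraMap_mem
        (algebraMap K K⟮algebraMap F L t⟯ c))
      (fun y => mem_separableClosure_iff.2 (hsep y)) y
  exact ⟨fun y => mem_separableClosure_iff.1 (h4 y)⟩

theorem transcendental_of_isSeparating (hF : IsFunctionField k F) {t : F}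
    (ht : IsSeparating k t) : Transcendental k t := by
  intro halg
  have ht' : Algebra.IsSeparable k⟮t⟯ F := ht
  have h1 : Algebra.IsAlgebraic k k⟮t⟯ := isAlgebraic_adjoin_simple halg.isIntegral
  have h2 : Algebra.IsAlgebraic k F := Algebra.IsAlgebraic.trans k k⟮t⟯ F
  have := hF.trdeg
  rw [trdeg_eq_zero] at this
  exact zero_ne_one this

theorem algebraMap_notMem_range [Algebra.IsAlgebraic k K] {t : F} (ht : Transcendental k t) :
    algebraMap F L t ∉ Set.range (algebraMap K L) := by
  rintro ⟨c, hc⟩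
  have h1 : IsAlgebraic k (algebraMap F L t) := by
    rw [← hc]
    exact (Algebra.IsAlgebraic.isAlgebraic c).algebraMap
  exact ht ((isAlgebraic_algebraMap_iff (algebraMap F L).injective).1 h1)

theorem isCurveField_of_isAlgebraic [IsAlgClosed K] [Algebra.EssFiniteType K L] {t : L}
    (ht : t ∉ Set.range (algebraMap K L)) [halg : Algebra.IsAlgebraic K⟮t⟯ L] :
    IsCurveField K L where
  exists_notMem := ⟨t, ht⟩
  finite := fun x hx => by
    have h1 : Algebra.IsAlgebraic (Algebra.adjoin K {t}) L := by
      rw [IsFractionRing.comap_isAlgebraic_iff (K := K⟮t⟯)]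
      exact halg
    have h2 : Algebra.trdeg K L ≤ 1 := by
      have := Algebra.IsAlgebraic.trdeg_le_cardinalMk K ({t} : Set L)
      rwa [Cardinal.mk_singleton] at this
    have h3 : AlgebraicIndependent K (fun _ : Unit => x) :=
      algebraicIndependent_unique_type_iff.2 (transcendental_of_notMem_range hx)
    have h4 := h3.isTranscendenceBasis_of_lift_trdeg_le_of_finite (by simpa using h2)
    have h5 := h4.isAlgebraic_field
    rw [Set.range_const] at h5
    have h6 : Algebra.EssFiniteType K⟮x⟯ L := Algebra.EssFiniteType.of_comp K K⟮x⟯ L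
    exact finiteDimensional_of_essFiniteType

end Extension

section RationalPoints

variable {k F K L : Type*} [Field k] [Field F] [Field K] [Field L]
  [Algebra k F] [Algebra k K] [Algebra F L] [Algebra K L] [Algebra k L]
  [IsScalarTower k F L] [IsScalarTower k K L] [IsAlgClosed K] [IsCurveField K L]

theorem mem_rationalPoints_iff {P : Place K L} {Q : ℕ} : P ∈ rationalPoints F K L Q ↔
    ∀ y : F, P.ge 0 (algebraMap F L y) →
      P.eval (algebraMap F L y) ^ Q = P.eval (algebraMap F L y) := by
  refine forall_congr' fun y => ?_
  rw [P.v_le_one_iff, P.v_lt_one_iff]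
  refine imp_congr_right fun hy => ?_
  have h1 : P.ge 0 (algebraMap F L y ^ Q) := by
    have := hy.pow Q
    rwa [mul_zero] at this
  have h2 : P.ge 0 (algebraMap F L y ^ Q - algebraMap F L y) := h1.sub hy
  rw [← Place.eval_eq_zero_iff h2]
  have h3 := Place.eval_add h2 hy
  rw [sub_add_cancel, Place.eval_pow hy] at h3
  rw [h3]
  simp

theorem rationalPoints_one_subset (q r : ℕ) :
    rationalPoints F K L (q ^ 1) ⊆ rationalPoints F K L (q ^ r) := by
  intro P hP
  rw [mem_rationalPoints_iff] at hP ⊢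
  intro y hy
  have h1 := hP y hy
  rw [pow_one] at h1
  induction r with
  | zero => simp
  | succ r ih => rw [pow_succ, pow_mul, ih, h1]

theorem rationalPoints_inter_subset (q : ℕ) {r s : ℕ} (hrs : Nat.Coprime r s) :
    rationalPoints F K L (q ^ r) ∩ rationalPoints F K L (q ^ s) ⊆
      rationalPoints F K L (q ^ 1) := by
  rintro P ⟨h1, h2⟩
  rw [mem_rationalPoints_iff] at h1 h2 ⊢
  intro y hy
  have hiter : ∀ n, ∀ z : K, (fun z : K => z ^ q)^[n] z = z ^ q ^ n := fun n => by
    induction n with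
    | zero => simp
    | succ n ih =>
      intro z
      rw [Function.iterate_succ_apply', ih, ← pow_mul, pow_succ]
  have h3 : Function.IsPeriodicPt (fun z : K => z ^ q) r (P.eval (algebraMap F L y)) :=
    (hiter _ _).trans (h1 y hy)
  have h4 : Function.IsPeriodicPt (fun z : K => z ^ q) s (P.eval (algebraMap F L y)) :=
    (hiter _ _).trans (h2 y hy)
  have h5 := h3.gcd h4
  rw [hrs] at h5
  rw [← hiter]
  exact h5

theorem rationalPoints_finite {t : F} (ht : algebraMap F L t ∉ Set.range (algebraMap K L))
    {Q : ℕ} (hQ : 1 < Q) : (rationalPoints F K L Q).Finite := by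
  set x := algebraMap F L t with hx
  have h0 : x ^ Q - x ≠ 0 := by
    have := aeval_ne_zero_of_notMem_range ht (FiniteField.X_pow_card_sub_X_ne_zero K hQ)
    simpa using this
  refine ((finite_zeros (K := K) h0).union (finite_ord_ne (K := K) (x := x))).subset ?_
  intro P hP
  by_cases h1 : P.ge 0 x
  · left
    have h2 := hP t ((P.v_le_one_iff).2 h1)
    rw [← hx, P.v_lt_one_iff] at h2
    have := h2.le_ord h0
    simp only [Set.mem_ofPred_eq]
    omega
  · right
    have h2 := P.ne_zero_of_not_ge h1
    rw [P.ge_iff_le_ord h2] at h1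
    simp only [Set.mem_ofPred_eq]
    omega

/-- The residue field of `F` at a rational point is `k`. -/
theorem exists_sub_smul_ge [Finite k] {P : Place K L} (hP : P ∈ rationalPoints F K L (Nat.card k))
    {x y : F} (hy : y ≠ 0) (hxy : P.ge (P.ord (algebraMap F L y)) (algebraMap F L x)) :
    ∃ c : k, P.ge (P.ord (algebraMap F L y) + 1) (algebraMap F L x - c • algebraMap F L y) := by
  have := Fintype.ofFinite k
  have hy' : algebraMap F L y ≠ 0 := by simpa using hy
  have h1 : P.ge 0 (algebraMap F L (x / y)) := by
    have := hxy.mul (P.ge_ord (algebraMap F L y)⁻¹)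
    rw [P.ord_inv, ← div_eq_mul_inv, ← map_div₀] at this
    exact this.mono (by omega)
  set e := P.eval (algebraMap F L (x / y)) with he
  have h2 : e ^ Fintype.card k = e := by
    rw [← Nat.card_eq_fintype_card]
    exact mem_rationalPoints_iff.1 hP _ h1
  obtain ⟨c, hc⟩ : e ∈ Set.range (algebraMap k K) := by
    classical
    by_contra hne
    have hq : 1 < Fintype.card k := Fintype.one_lt_card
    have hX := FiniteField.X_pow_card_sub_X_ne_zero K hq
    have h3 : insert e (Finset.univ.image (algebraMap k K)) ⊆
        (Polynomial.X ^ Fintype.card k - Polynomial.X : Polynomial K).roots.toFinset := by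
      intro z hz
      rw [Multiset.mem_toFinset, Polynomial.mem_roots hX]
      rcases Finset.mem_insert.1 hz with rfl | hz
      · simp [Polynomial.IsRoot, h2]
      · obtain ⟨c, -, rfl⟩ := Finset.mem_image.1 hz
        simp [Polynomial.IsRoot, ← map_pow, FiniteField.pow_card]
    have h4 := (Finset.card_le_card h3).trans (Multiset.toFinset_card_le _)
    have h5 := Polynomial.card_roots' (Polynomial.X ^ Fintype.card k - Polynomial.X : Polynomial K)
    rw [FiniteField.X_pow_card_sub_X_natDegree_eq K hq] at h5
    rw [Finset.card_insert_of_notMem (by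
      intro hmem
      obtain ⟨c, -, hc⟩ := Finset.mem_image.1 hmem
      exact hne ⟨c, hc⟩), Finset.card_image_of_injective _ (algebraMap k K).injective,
      Finset.card_univ] at h4
    omega
  refine ⟨c, ?_⟩
  have h3 := h1.sub_eval.mul (P.ge_ord (algebraMap F L y))
  rw [← he, ← hc, sub_mul, map_div₀, div_mul_cancel₀ _ hy', ← IsScalarTower.algebraMap_apply,
    ← Algebra.smul_def] at h3
  exact h3.mono (by omega)

end RationalPoints

section Degree

variable {K L : Type*} [Field K] [Field L] [Algebra K L] [IsAlgClosed K] [IsCurveField K L]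
variable {p : ℕ} [Fact p.Prime] [CharP L p] {t : L} {τ : L →ₐ[K] PowerSeries L} {n : ℕ}
variable {f : Fin (n + 1) → L} {a b : ℕ}

theorem finite_baseCoeff_ne (hf : ∃ j, f j ≠ 0) : {P : Place K L | P.baseCoeff f ≠ 0}.Finite := by
  refine (Set.finite_iUnion fun j => finite_ord_ne (K := K) (x := f j)).subset fun P hP => ?_
  obtain ⟨j₀, -, h, -⟩ := P.exists_ord_eq_baseCoeff f hf
  refine Set.mem_iUnion.2 ⟨j₀, ?_⟩
  simp only [Set.mem_ofPred_eq] at hP ⊢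
  omega

/-- The degree of the Frobenius divisor bounds its partial sums. -/
theorem sum_frobCoeff_le (ht : IsPBasis p t) (hτ : IsTaylor t τ) (hf : ∃ j, f j ≠ 0)
    (hv : ∀ P : Place K L, 0 ≤ P.frobCoeff t f a b) (S : Finset (Place K L)) :
    ∑ P ∈ S, P.frobCoeff t f a b ≤
      (2 * genus K L - 2) * ∑ i, (frobOrderSeq K t f a b i : ℤ) +
        ((b : ℤ) + a + n - 1) * seriesDegree K f := by
  classical
  have hD := hτ.derivation_self
  have hfin := finite_baseCoeff_ne (K := K) hf
  set A := frobDet K t f a b (frobOrderSeq K t f a b) with hA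
  let T : Finset (Place K L) := S ∪ (divisor A : Place K L →₀ ℤ).support ∪
    (diffDivisor (K := K) ht hD).support ∪ hfin.toFinset
  have hST : S ⊆ T := fun P hP => by simp [T, hP]
  have h1 : ∑ P ∈ T, P.ord A = 0 := by
    rw [← divDeg_divisor (K := K) A, divDeg_eq_sum _ (S := T) (fun P hP => by
      simp only [T, Finset.mem_union]; tauto)]
    rfl
  have h2 : ∑ P ∈ T, P.ordDiff (KaehlerDifferential.D K L t) ≤ 2 * genus K L - 2 := by
    refine le_trans (le_of_eq ?_) (divDeg_diffDivisor_le (K := K) ht hD)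
    rw [divDeg_eq_sum _ (S := T) (fun P hP => by simp only [T, Finset.mem_union]; tauto)]
    rfl
  have h3 : ∑ P ∈ T, P.baseCoeff f = seriesDegree K f := by
    rw [seriesDegree, finsum_eq_sum_of_support_subset]
    intro P hP
    have : P ∈ hfin.toFinset := by simpa using hP
    simp only [T, Finset.coe_union, Set.mem_union, Finset.mem_coe]
    tauto
  refine (Finset.sum_le_sum_of_subset_of_nonneg hST fun P _ _ => hv P).trans ?_
  simp only [Place.frobCoeff, Finset.sum_add_distrib, ← Finset.mul_sum]
  rw [h1, h3, zero_add, mul_comm]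
  have h4 : (0 : ℤ) ≤ ∑ i, (frobOrderSeq K t f a b i : ℤ) :=
    Finset.sum_nonneg fun i _ => Int.natCast_nonneg _
  have := mul_le_mul_of_nonneg_right h2 h4
  linarith

end Degree

/-- The counting argument: bounds for sums of a nonnegative function over sets that meet pairwise
in a common subset. -/
theorem sum_sInf_mul_ncard_le {α : Type*} (v : α → ℤ) (hv : ∀ x, 0 ≤ v x) {X₁ A B C : Set α}
    (hA : A.Finite) (hB : B.Finite) (hC : C.Finite) (h1A : X₁ ⊆ A) (h1B : X₁ ⊆ B) (h1C : X₁ ⊆ C)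
    (hAB : A ∩ B ⊆ X₁) (hAC : A ∩ C ⊆ X₁) (hBC : B ∩ C ⊆ X₁) {D : ℤ}
    (hD : ∀ S : Finset α, ∑ x ∈ S, v x ≤ D) :
    sInf (v '' X₁) * X₁.ncard + sInf (v '' A) * (A.ncard - X₁.ncard) +
      sInf (v '' B) * (B.ncard - X₁.ncard) + sInf (v '' C) * (C.ncard - X₁.ncard) ≤ D := by
  classical
  have hX := hA.subset h1A
  have hle : ∀ (Y : Set α) (Z : Set α) (hZ : Z.Finite), Z ⊆ Y →
      sInf (v '' Y) * Z.ncard ≤ ∑ x ∈ hZ.toFinset, v x := by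
    intro Y Z hZ hZY
    rw [Set.ncard_eq_toFinset_card Z hZ, mul_comm, ← nsmul_eq_mul]
    refine Finset.card_nsmul_le_sum _ _ _ fun x hx => ?_
    refine csInf_le ⟨0, ?_⟩ ⟨x, hZY (hZ.mem_toFinset.1 hx), rfl⟩
    rintro _ ⟨y, -, rfl⟩
    exact hv y
  have hcard : ∀ Y : Set α, Y.Finite → X₁ ⊆ Y → ((Y.ncard : ℤ) - X₁.ncard) = (Y \ X₁).ncard := by
    intro Y hY h1Y
    have := Set.ncard_sdiff_add_ncard_of_subset h1Y hY
    omega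
  rw [hcard A hA h1A, hcard B hB h1B, hcard C hC h1C]
  have hA' : (A \ X₁).Finite := hA.subset Set.sdiff_subset
  have hB' : (B \ X₁).Finite := hB.subset Set.sdiff_subset
  have hC' : (C \ X₁).Finite := hC.subset Set.sdiff_subset
  have h := hD (hX.toFinset ∪ hA'.toFinset ∪ hB'.toFinset ∪ hC'.toFinset)
  have d1 : Disjoint hX.toFinset hA'.toFinset := by
    rw [Finset.disjoint_left]
    intro x h1 h2
    simp at h1 h2
    exact h2.2 h1
  have d2 : Disjoint (hX.toFinset ∪ hA'.toFinset) hB'.toFinset := by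
    rw [Finset.disjoint_left]
    intro x h1 h2
    simp at h1 h2
    rcases h1 with h1 | h1
    · exact h2.2 h1
    · exact h2.2 (hAB ⟨h1.1, h2.1⟩)
  have d3 : Disjoint (hX.toFinset ∪ hA'.toFinset ∪ hB'.toFinset) hC'.toFinset := by
    rw [Finset.disjoint_left]
    intro x h1 h2
    simp at h1 h2
    rcases h1 with h1 | h1 | h1
    · exact h2.2 h1
    · exact h2.2 (hAC ⟨h1.1, h2.1⟩)
    · exact h2.2 (hBC ⟨h1.1, h2.1⟩)
  rw [Finset.sum_union d3, Finset.sum_union d2, Finset.sum_union d1] at h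
  have e1 := hle X₁ X₁ hX subset_rfl
  have e2 := hle A (A \ X₁) hA' Set.sdiff_subset
  have e3 := hle B (B \ X₁) hB' Set.sdiff_subset
  have e4 := hle C (C \ X₁) hC' Set.sdiff_subset
  linarith

end FrobCurve

end

/-- A projective geometrically irreducible nonsingular curve over the finite field `k = 𝔽_q` is
given by its function field `F`; `K` is an algebraic closure of `k`, and `L = K ⊗ F`, which is a
field because the curve is geometrically irreducible, is the function field over `K`. The morphism
`φ = (f_0 : ⋯ : f_n)` is given by its coordinate functions `f_i ∈ F`. -/
theorem theorem4p4
    (k F K L : Type*) [Field k] [Finite k] [Field F] [Field K] [Field L]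
    [Algebra k F] [Algebra k K] [Algebra F L] [Algebra K L] [Algebra k L]
    [IsScalarTower k F L] [IsScalarTower k K L]
    [IsAlgClosure k K] [Algebra.IsPushout k F K L]
    (hF : FrobCurve.IsFunctionField k F)
    (q : ℕ) (hq : Nat.card k = q)
    (u m : ℕ) (hu : 1 ≤ u) (hum : u < m) (hcop : Nat.Coprime u m)
    (n : ℕ) (hn : 2 ≤ n)
    (f : Fin (n + 1) → F) (hf : LinearIndependent K fun i => algebraMap F L (f i))
    (t : F) (ht : FrobCurve.IsSeparating k t) :
    let φ : Fin (n + 1) → L := fun i => algebraMap F L (f i)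
    let x : L := algebraMap F L t
    let κ : Fin (n - 1) → ℕ := FrobCurve.frobOrderSeq K x φ (q ^ u) (q ^ m)
    let ε : Fin (n + 1) → ℕ := FrobCurve.orderSeq K x φ
    let X : ℕ → Set (FrobCurve.Place K L) := fun r => FrobCurve.rationalPoints F K L (q ^ r)
    let N : ℕ → ℤ := fun r => ((X r).ncard : ℤ)
    let c : ℕ → ℤ := fun r => sInf ((fun P => P.frobCoeff x φ (q ^ u) (q ^ m)) '' X r)
    (c 1 * N 1 + c u * (N u - N 1) + c m * (N m - N 1) + c (m - u) * (N (m - u) - N 1)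
        ≤ (2 * FrobCurve.genus K L - 2) * ∑ i, (κ i : ℤ)
          + ((q : ℤ) ^ m + (q : ℤ) ^ u + n - 1) * FrobCurve.seriesDegree K φ) ∧
      ((X (m - u)).Nonempty → (q : ℤ) ^ u ≤ c (m - u)) ∧
      ((X 1).Nonempty → (q : ℤ) ^ u + (ε ⟨2, by omega⟩ : ℤ) * ((n : ℤ) - 1) ≤ c 1) := by
  intro φ x κ ε X N c
  classical
  obtain ⟨p, hp⟩ := CharP.exists k
  have hprime : Fact p.Prime := ⟨CharP.char_is_prime k p⟩
  have : CharP L p := charP_of_injective_algebraMap (algebraMap k L).injective p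
  have : IsAlgClosed K := IsAlgClosure.isAlgClosed k
  have : Algebra.IsAlgebraic k K := IsAlgClosure.isAlgebraic
  obtain ⟨e, he⟩ : ∃ e : ℕ, q = p ^ e := by
    have := Fintype.ofFinite k
    obtain ⟨e, -, he⟩ := FiniteField.card k p
    exact ⟨e, by rw [← hq, Nat.card_eq_fintype_card, he]⟩
  have hq2 : 2 ≤ q := by
    rw [← hq]
    exact Finite.one_lt_card
  have hx : x ∉ Set.range (algebraMap K L) := FrobCurve.algebraMap_notMem_range (k := k)
    (FrobCurve.transcendental_of_isSeparating hF ht)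
  have : Algebra.EssFiniteType K L := FrobCurve.essFiniteType_of_isPushout (k := k) (F := F) hF.fg
  have : Algebra.IsSeparable (IntermediateField.adjoin K {x}) L :=
    FrobCurve.isSeparable_adjoin_of_isSeparating ht
  have : FrobCurve.IsCurveField K L := FrobCurve.isCurveField_of_isAlgebraic hx
  have : FiniteDimensional (IntermediateField.adjoin K {x}) L := FrobCurve.IsCurveField.finite x hx
  obtain ⟨τ, hτ⟩ := FrobCurve.exists_taylor (FrobCurve.transcendental_of_notMem_range hx)
  have htb : FrobCurve.IsPBasis p x := FrobCurve.isPBasis_of_isSeparable (K := K)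
  have hab : q ^ u < q ^ m := Nat.pow_lt_pow_right (by omega) hum
  have ha2 : 2 ≤ q ^ u := hq2.trans (Nat.le_self_pow (by omega) q)
  have ha : q ^ u = p ^ (e * u) := by rw [he, pow_mul]
  have hb : q ^ m = p ^ (e * m) := by rw [he, pow_mul]
  have hne := FrobCurve.frobDet_nonempty hn htb hτ hf hab
  have hf0 : ∃ j, φ j ≠ 0 := ⟨0, hf.ne_zero 0⟩
  have hv : ∀ P : FrobCurve.Place K L, 0 ≤ P.frobCoeff x φ (q ^ u) (q ^ m) := fun P =>
    P.frobCoeff_ge hn htb hτ hne hf0 ha hb 0 fun i j _ h => by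
      have h1 := h.pow (q ^ m)
      have h2 := h.pow (q ^ u)
      rw [mul_zero] at h1 h2
      exact h1.sub h2
  have hfin : ∀ r, r ≠ 0 → (X r).Finite := fun r hr =>
    FrobCurve.rationalPoints_finite hx (Nat.one_lt_pow hr (by omega))
  have hsub : ∀ r, X 1 ⊆ X r := fun r => FrobCurve.rationalPoints_one_subset q r
  have hinter : ∀ {r s : ℕ}, Nat.Coprime r s → X r ∩ X s ⊆ X 1 := fun h =>
    FrobCurve.rationalPoints_inter_subset q h
  refine ⟨?_, fun hX => ?_, fun hX => ?_⟩
  · refine FrobCurve.sum_sInf_mul_ncard_le _ hv (hfin u (by omega)) (hfin m (by omega))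
      (hfin (m - u) (by omega)) (hsub u) (hsub m) (hsub (m - u)) (hinter hcop)
      (hinter ((Nat.coprime_sub_self_right hum.le).2 hcop))
      (hinter ((Nat.coprime_self_sub_right hum.le).2 hcop.symm)) fun S => ?_
    have := FrobCurve.sum_frobCoeff_le htb hτ hf0 hv S
    push_cast at this
    exact this
  · refine le_csInf (hX.image _) ?_
    rintro _ ⟨P, hP, rfl⟩
    have h1 := P.frobCoeff_ge hn htb hτ hne hf0 ha hb ((q ^ u : ℕ) : ℤ) fun i j hi hij => by
      have h2 : φ j / φ i = algebraMap F L (f j / f i) := (map_div₀ _ _ _).symm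
      rw [h2] at hij ⊢
      have h3 := (P.v_lt_one_iff).1 (hP _ ((P.v_le_one_iff).2 hij))
      have h4 := h3.pow (q ^ u)
      rw [mul_one] at h4
      have h5 : (algebraMap F L (f j / f i) ^ q ^ (m - u) - algebraMap F L (f j / f i)) ^ q ^ u =
          algebraMap F L (f j / f i) ^ q ^ m - algebraMap F L (f j / f i) ^ q ^ u := by
        have h6 : q ^ m = q ^ (m - u) * q ^ u := by rw [← pow_add, Nat.sub_add_cancel hum.le]
        rw [h6, pow_mul, ha, sub_pow_char_pow]
      rwa [h5] at h4
    push_cast at h1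
    exact h1
  · refine le_csInf (hX.image _) ?_
    rintro _ ⟨P, hP, rfl⟩
    have := Fintype.ofFinite k
    have hpow : ∀ r, ∀ c : k, c ^ q ^ r = c := fun r c => by
      rw [← hq, Nat.card_eq_fintype_card, FiniteField.pow_card_pow]
    have hrange : Submodule.span k (Set.range φ) ≤
        LinearMap.range (IsScalarTower.toAlgHom k F L).toLinearMap := by
      rw [Submodule.span_le]
      rintro _ ⟨i, rfl⟩
      exact ⟨f i, rfl⟩
    have hP' : P ∈ FrobCurve.rationalPoints F K L (Nat.card k) := by
      have h2 : P ∈ FrobCurve.rationalPoints F K L (q ^ 1) := hP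
      rwa [pow_one, ← hq] at h2
    have h1 := P.frobCoeff_ge_of_rational (k₀ := k) hn htb hτ hne ha hb ha2 hab (hpow u) (hpow m)
      (hf.restrict_scalars' k) fun y hy z hz hz0 hyz => by
        obtain ⟨y, rfl⟩ := hrange hy
        obtain ⟨z, rfl⟩ := hrange hz
        exact FrobCurve.exists_sub_smul_ge hP' (fun h0 => hz0 (by rw [h0, map_zero])) hyz
    push_cast at h1
    exact h1
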